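/- **The language.** Layers are $i\in\{0,1\}$. Types: $T::=\mathbf{Unit}\mid\mathbf{Int}\mid T_1\to T_2\mid\mathbf{ref}\,T\mid\Box(\Gamma\vdash T)$, with $\Gamma$ a list of declarations $x:T$ of distinct local variables. $\mathbf{Unit}$, $\mathbf{Int}$ are well formed at both layers, $\to$ and $\mathbf{ref}$ preserve the layer, and $\Box(\Gamma\vdash T)$ is well formed at layer $1$ only, provided that $T$ and the types in $\Gamma$ are well formed at layer $0$. Store contexts $\Sigma$ are finite maps from locations $\ell$ to types $\mathbf{ref}\,T$ (well formed at layer $1$); global contexts $\Psi$ consist of declarations $u:(\Gamma\vdash T)$ with everything well formed at layer $0$. Terms: $()$, $\hat n$ ($n\in\mathbb N$), $x$, $u^\delta$, $\ell$, $\lambda x.M$, $MN$, $\mathbf{rec}\,y(x).M$, $M\oplus N$ ($\oplus\in\{+,-,*,<,=\}$ on $\mathbb N$, with truncated subtraction), $\mathbf{if}$, $\mathbf{ref}\,M$, $!M$, $M:=N$, $\mathbf{box}\,M$, $\mathbf{letbox}\,u=M\,\mathbf{in}\,N$, up to renaming of the variables bound by $\lambda$, $\mathbf{rec}$, $\mathbf{letbox}$.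 Values $V$: $()$, $\hat n$, $\ell$, $x$, $\lambda x.M$, $\mathbf{rec}\,y(x).M$, $\mathbf{box}\,M$. Local substitutions $\delta$ are finite maps from local variables to values, global substitutions $\sigma$ finite maps from global variables to terms, heaps $h$ finite maps from locations to values. Substitution avoids capture, $(\mathbf{box}\,M)[\delta]=\mathbf{box}\,M$, $(u^{\delta})[\delta']=u^{\delta[\delta']}$, $(u^{\delta})[\sigma]=\sigma(u)[\delta[\sigma]]$. The judgement $\Sigma;\Psi;\Gamma\vdash_iM:T$ is the usual one of call-by-value $\lambda$-calculus with recursion and references (contexts well formed, $\Gamma$ at layer $i$; conditions of $\mathbf{if}$ are integers, true when nonzero), where $\ell:\mathbf{ref}\,T$ requires $\ell:\mathbf{ref}\,T\in\Sigma$ and $T$ well formed at layer $i$; $u^\delta:T$ requires $u:(\Gamma'\vdash T)\in\Psi$ and $\Sigma;\Psi;\Gamma\vdash_i\delta:\Gamma'$ (equal domains, $\Sigma;\Psi;\Gamma\vdash_i\delta(x):\Gamma'(x)$); $\mathbf{box}\,M:\Box(\Gamma'\vdash T)$ at layer $1$ requires $\Sigma;\Psi;\Gamma'\vdash_0M:T$;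 and $\mathbf{letbox}\,u=M\,\mathbf{in}\,N:T'$ at layer $1$ requires $M:\Box(\Gamma'\vdash T)$ and $\Sigma;\Psi,u:(\Gamma'\vdash T);\Gamma\vdash_1N:T'$. $\Sigma;\cdot\vdash\sigma:\Psi$ means equal domains and $\Sigma;\cdot;\Gamma\vdash_0\sigma(u):T$ for $u:(\Gamma\vdash T)\in\Psi$. $\Sigma\vdash h:\mathbf{heap}$ means $\mathrm{dom}\,\Sigma=\mathrm{dom}\,h$ and, for some layer $i$, $\Sigma;\cdot;\cdot\vdash_ih(\ell):T$ for all $\ell:\mathbf{ref}\,T\in\Sigma$. Evaluation contexts: $K::=\bullet\mid KM\mid VK\mid K\oplus M\mid V\oplus K\mid\mathbf{if}\,K\,M_1\,M_2\mid\mathbf{ref}\,K\mid{!K}\mid K:=M\mid V:=K\mid\mathbf{letbox}\,u=K\,\mathbf{in}\,M$; $\Sigma\vdash K:(\cdot;\cdot;i;T)\to(\cdot;\cdot;i';T')$ is the induced closed typing, where $\bullet$ requires $T=T'$, $i\le i'$. Reduction $(M,h)\to(M',h')$ is the usual call-by-value small-step relation closed under evaluation contexts ($\mathbf{ref}\,V$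 allocates any $\ell\notin\mathrm{dom}\,h$), with $(\mathbf{letbox}\,u=\mathbf{box}\,M\,\mathbf{in}\,N,h)\to(N[M/u],h)$. $(M,h)\Downarrow$ means $(M,h)\to^*(V,h')$ for some value $V$ and heap $h'$. **Names and abstraction.** There are disjoint countably infinite sets $\mathrm{Names}_{T_1\to T_2,i}$ (function names $f$; $T_1\to T_2$ well formed at $i$) and $\mathrm{Names}_{\Box(\Gamma\vdash T),1}$ (box names $b$). Terms are extended with names, which are closed values of their type at every layer $\ge i$, and with $\#b^\delta:T$ for $b\in\mathrm{Names}_{\Box(\Gamma\vdash T),1}$, $\delta:\Gamma$; moreover $(\mathbf{letbox}\,u=b\,\mathbf{in}\,N,h)\to(N[\#b/u],h)$, and $\#(\mathbf{box}\,M)=M$. The abstraction set $\mathbf{AVal}_i(V:T)$ of a closed value is $\{(V,\emptyset)\}$ if $T$ is $\mathbf{Unit}$, $\mathbf{Int}$ or $\mathbf{ref}\,T'$, and $\{(n,n\mapsto V)\mid n\in\mathrm{Names}_{T,i}\}$ otherwise. Let $A$ range over $()$, numerals, locations and names; $\nu$ and $\mu$ give the names and the locations that occur in an abstraction. $\mathbf{AVal}_i(\delta:\Gamma)$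 consists of pairs $(\rho,\bigcup_x\gamma_x)$ with $(\rho(x),\gamma_x)\in\mathbf{AVal}_i(\delta(x):\Gamma(x))$, different $x$ having different names. $\mathbf{AVal}(\sigma:\Psi)$ consists of pairs $(\eta,\bigcup_u\gamma_u)$ with $\eta(u)=\#b_u$, $(b_u,\gamma_u)\in\mathbf{AVal}_1(\mathbf{box}\,\sigma(u):\Box(\Gamma\vdash T))$ for $u:(\Gamma\vdash T)\in\Psi$, the $b_u$ being distinct. For a subheap $h'$ of a heap typed by $\Sigma$, $\mathbf{AVal}(\Sigma\vdash h':\mathbf{heap})$ consists of pairs $(\chi,\bigcup_\ell\gamma_\ell)$ such that, for some layer $j$, $\Sigma;\cdot;\cdot\vdash_jh'(\ell):T$ and $(\chi(\ell),\gamma_\ell)\in\mathbf{AVal}_j(h'(\ell):T)$ for $\ell\in\mathrm{dom}\,\chi=\mathrm{dom}\,h'$, $\ell:\mathbf{ref}\,T\in\Sigma$, different $\ell$ having different names. $(\Sigma,h)|_\theta=(\Sigma',h')$, where $h'$ is the least subheap of $h$ with $\theta\subseteq\mathrm{dom}\,h'$ such that $h'(\ell)=\ell'$ implies $\ell'\in\mathrm{dom}\,h'$,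 and $\Sigma'\subseteq\Sigma$ has domain $\mathrm{dom}\,h'$. **Transition system.** Passive configurations are tuples $(\Sigma,h,\gamma,\phi,\xi,\theta)$, active ones $(M,i,T,\Sigma,h,\gamma,\phi,\xi,\theta)$: $\gamma$ maps names to values, $\phi$ is the set of names introduced, $\xi$ a stack of evaluation contexts, each with the layer and type of its hole and of its result, and $\theta$ the set of shared locations. An action is a polarity (P or O), a move $A$ (answer), $f(A)$ or $\mathbf{run}\,b^\rho$ (questions), and a pair $(\Sigma',\chi)$. Silent moves $\xrightarrow{\tau}$ replace $(M,h)$ in an active configuration by $(M_2,h_2)$ with $(M,h)\to(M_2,h_2)$, and $\Sigma$ by some $\Sigma_2\supseteq\Sigma$ with $\Sigma_2\vdash h_2:\mathbf{heap}$ and $\Sigma_2;\cdot;\cdot\vdash_jM_2:T$ for some $j$. *P actions* lead from an active configuration to $(\Sigma,h,\gamma\uplus\gamma'\uplus\gamma'',\phi\uplus\nu\uplus\nu(\chi),\xi',\mathrm{dom}\,\chi)$, where $\nu$ and $\mu$ denote the names and locations in $A$, resp. $\rho$, and $(\Sigma',h')=(\Sigma,h)|_{\theta\cup\mu}$, $(\chi,\gamma'')\in\mathbf{AVal}(\Sigma\vdash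 h':\mathbf{heap})$: (PA) if $M=V$, the move is $A$ with $(A,\gamma')\in\mathbf{AVal}_i(V:T)$, $\xi'=\xi$; (PQF) if $M=K[fV]$, $f\in\mathrm{Names}_{T_1\to T_2,i_1}$, the move is $f(A)$ with $\Sigma;\cdot;\cdot\vdash_{i_2}V:T_1$, $(A,\gamma')\in\mathbf{AVal}_{i_2}(V:T_1)$, and $\xi'$ is $\xi$ with $K:(\max(i_1,i_2),T_2)\to(i,T)$ pushed; (PQB) if $M=K[\#b^\delta]$, $b\in\mathrm{Names}_{\Box(\Gamma\vdash T_1),1}$, the move is $\mathbf{run}\,b^\rho$ with $\Sigma;\cdot;\cdot\vdash_{i_1}\delta:\Gamma$, $(\rho,\gamma')\in\mathbf{AVal}_{i_1}(\delta:\Gamma)$, and $\xi'$ is $\xi$ with $K:(i_1,T_1)\to(i,T)$ pushed. *O actions* lead from a passive configuration to $(N,i^*,T^*,\Sigma\cup\Sigma',\chi+h,\gamma,\phi\uplus\nu\uplus\nu(\chi),\xi',\mathrm{dom}\,\chi)$ ($\chi$ takes precedence over $h$), where $\chi$ has abstract values with distinct names, $\Sigma'\vdash\chi:\mathbf{heap}$,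 $\Sigma,\Sigma'$ agree on common locations, $\mathrm{dom}\,\chi\cap\mathrm{dom}\,h=\theta$, $\chi=\chi|_{\theta\cup\mu}$: (OA) the move is $A$, the top $K:(i_1,T_1)\to(i_2,T_2)$ of $\xi$ is popped, $\Sigma';\cdot;\cdot\vdash_{i_1}A:T_1$, $(N,i^*,T^*)=(K[A],i_2,T_2)$; (OQF) the move is $f(A)$, $f\in\mathrm{Names}_{T_1\to T_2,i_1}$, $\Sigma';\cdot;\cdot\vdash_{i_2}A:T_1$, $\xi'=\xi$, $(N,i^*,T^*)=(\gamma(f)A,\max(i_1,i_2),T_2)$; (OQB) the move is $\mathbf{run}\,b^\rho$ with $\rho$ abstract with distinct names, $b\in\mathrm{Names}_{\Box(\Gamma\vdash T),1}$, $\Sigma';\cdot;\cdot\vdash_{i}\rho:\Gamma$, $\xi'=\xi$, $(N,i^*,T^*)=((\#\gamma(b))[\rho],i,T)$. $\mathbf{Tr}(\mathbf C)$ is the set of finite sequences $\mathbf a_1\cdots\mathbf a_n$ of actions such that $\mathbf C\xrightarrow{\tau}{}^*\xrightarrow{\mathbf a_1}\cdots\xrightarrow{\tau}{}^*\xrightarrow{\mathbf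 a_n}\mathbf C'$ for a passive $\mathbf C'$ with empty stack. $\overline{\mathtt t}$ is $\mathtt t$ with all polarities flipped. $\mathbf C_1|\mathbf C_2\downarrow^{\mathtt t}$ means that for some (PA) action $\mathbf a$, either $\mathtt t\in\mathbf{Tr}(\mathbf C_1)$ and $\overline{\mathtt t}\,\mathbf a\in\mathbf{Tr}(\mathbf C_2)$, or $\mathtt t\,\mathbf a\in\mathbf{Tr}(\mathbf C_1)$ and $\overline{\mathtt t}\in\mathbf{Tr}(\mathbf C_2)$. **Theorem (Correctness).** Let $\Sigma\subseteq\Sigma'$, and let the following be free of names: a term $\Sigma;\Psi;\Gamma\vdash_iM:T$, an evaluation context $\Sigma'\vdash K:(\cdot;\cdot;i;T)\to(\cdot;\cdot;i';T')$, substitutions $\Sigma';\cdot\vdash\sigma:\Psi$ and $\Sigma';\cdot;\cdot\vdash_i\delta:\Gamma$, and a heap $\Sigma'\vdash h:\mathbf{heap}$. Let $(\eta,\gamma)\in\mathbf{AVal}(\sigma:\Psi)$, $(\rho,\gamma')\in\mathbf{AVal}_i(\delta:\Gamma)$, $(\Sigma'',h')=(\Sigma',h)|_{\mathrm{dom}\,\Sigma\,\cup\,\mu(\rho)}$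 and $(\chi,\gamma'')\in\mathbf{AVal}(\Sigma'\vdash h':\mathbf{heap})$, with $\nu(\eta),\nu(\rho),\nu(\chi)$ pairwise disjoint. Put $\phi=\nu(\eta)\uplus\nu(\rho)\uplus\nu(\chi)$, $$\mathbf C_K=(\Sigma',h,\gamma\uplus\gamma'\uplus\gamma'',\phi,\;K:(i,T)\to(i',T'),\;\mathrm{dom}\,\chi),\qquad \mathbf C_M=(M[\eta][\rho],i,T,\Sigma'',\chi,\emptyset,\phi,\cdot,\mathrm{dom}\,\chi).$$ Then $(K[M[\sigma][\delta]],h)\Downarrow$ if and only if there is a trace $\mathtt t$ with $\mathbf C_K\mid\mathbf C_M\downarrow^{\mathtt t}$. -/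

import Mathlib

namespace LMML

/-! ## Types and contexts -/

abbrev Loc := ℕ
abbrev LVar := ℕ

/-- The layers `0` and `1`. -/
abbrev Layer := Fin 2

/-- Types. The context of a box type records the names of its local variables. -/
inductive Ty : Type
  | unit : Ty
  | int : Ty
  | arrow : Ty → Ty → Ty
  | ref : Ty → Ty
  | box : List (LVar × Ty) → Ty → Ty

/-- Local variable contexts. -/
abbrev LCtx := List (LVar × Ty)

/-- Global variable contexts; global variables are de Bruijn indices into the list. -/
abbrev GCtx := List (LCtx × Ty)

/-- Store contexts; `ℓ ↦ T` stands for `ℓ : ref T`. -/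
abbrev Store := Finmap (fun _ : Loc => Ty)

/-- Well-formed types at a layer: box types live at layer `1` and are not nested. -/
inductive Ty.Wf : Layer → Ty → Prop
  | unit (i : Layer) : Ty.Wf i .unit
  | int (i : Layer) : Ty.Wf i .int
  | arrow {i : Layer} {T₁ T₂ : Ty} : Ty.Wf i T₁ → Ty.Wf i T₂ → Ty.Wf i (.arrow T₁ T₂)
  | ref {i : Layer} {T : Ty} : Ty.Wf i T → Ty.Wf i (.ref T)
  | box {Γ : LCtx} {T : Ty} : (Γ.map Prod.fst).Nodup → (∀ p ∈ Γ, Ty.Wf 0 p.2) → Ty.Wf 0 T →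
      Ty.Wf 1 (.box Γ T)

def LCtx.Wf (i : Layer) (Γ : LCtx) : Prop :=
  (Γ.map Prod.fst).Nodup ∧ ∀ p ∈ Γ, Ty.Wf i p.2

def GCtx.Wf (Ψ : GCtx) : Prop := ∀ p ∈ Ψ, LCtx.Wf 0 p.1 ∧ Ty.Wf 0 p.2

def Store.Wf (i : Layer) (S : Store) : Prop := ∀ l T, S.lookup l = some T → Ty.Wf i T

/-! ## Names -/

/-- Function names are indexed by an arrow type and a layer, box names by a box type; each index
comes with countably many names. -/
inductive Name : Type
  | fn (T₁ T₂ : Ty) (i : Layer) (k : ℕ) : Name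
  | bx (Γ : LCtx) (T : Ty) (k : ℕ) : Name

/-- `NameOf n T i`: the name `n` belongs to `Names_{T,i}`. -/
inductive NameOf : Name → Ty → Layer → Prop
  | fn {T₁ T₂ : Ty} {i : Layer} (k : ℕ) : Ty.Wf i (.arrow T₁ T₂) →
      NameOf (.fn T₁ T₂ i k) (.arrow T₁ T₂) i
  | bx {Γ : LCtx} {T : Ty} (k : ℕ) : Ty.Wf 1 (.box Γ T) →
      NameOf (.bx Γ T k) (.box Γ T) 1

/-! ## Terms -/

/-- The binary operations on numerals. -/
inductive Op : Type
  | add | sub | mul | lt | eq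

/-- Numerals are natural numbers: subtraction is truncated, truth values are `1` and `0`. -/
def Op.eval : Op → ℕ → ℕ → ℕ
  | .add, m, n => m + n
  | .sub, m, n => m - n
  | .mul, m, n => m * n
  | .lt, m, n => if m < n then 1 else 0
  | .eq, m, n => if m = n then 1 else 0

/-- Terms up to renaming of the variables bound by `λ`, `rec` and `letbox`: these are de Bruijn
indices (`bvar` for the local ones, `gvar` for the global ones). Free local variables `lvar` are
named: they are the ones declared in a local context or captured by the enclosing `box`.
In `recf M`, index `0` is the argument and index `1` the function itself.
`gvar u d δ` is `u^δ` and `unbox b d δ` is `#b^δ`, where `δ` is a local substitution with finite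
domain `d`. -/
inductive Tm : Type
  | unit : Tm
  | num : ℕ → Tm
  | bvar : ℕ → Tm
  | lvar : LVar → Tm
  | gvar (u : ℕ) (d : Finset LVar) (δ : {x // x ∈ d} → Tm) : Tm
  | loc : Loc → Tm
  | lam : Tm → Tm
  | app : Tm → Tm → Tm
  | recf : Tm → Tm
  | arith : Op → Tm → Tm → Tm
  | ite : Tm → Tm → Tm → Tm
  | ref : Tm → Tm
  | deref : Tm → Tm
  | assign : Tm → Tm → Tm
  | box : Tm → Tm
  | letbox : Tm → Tm → Tm
  | name : Name → Tm
  | unbox (b : Name) (d : Finset LVar) (δ : {x // x ∈ d} → Tm) : Tm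

/-- Values; names count as values. -/
def Tm.IsValue : Tm → Prop
  | .unit | .num _ | .bvar _ | .lvar _ | .loc _ | .lam _ | .recf _ | .box _ | .name _ => True
  | _ => False

/-- Terms of the source language, without names. -/
def Tm.NameFree : Tm → Prop
  | .unit | .num _ | .bvar _ | .lvar _ | .loc _ => True
  | .gvar _ _ δ => ∀ x, (δ x).NameFree
  | .lam M | .recf M | .ref M | .deref M | .box M => M.NameFree
  | .app M N | .arith _ M N | .assign M N | .letbox M N => M.NameFree ∧ N.NameFree
  | .ite M N P => M.NameFree ∧ N.NameFree ∧ P.NameFree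
  | .name _ | .unbox _ _ _ => False

/-- Local substitutions: maps with finite domain from local variables to terms. -/
structure LSub : Type where
  dom : Finset LVar
  val : {x // x ∈ dom} → Tm

/-- A local substitution as a function on all local variables, the identity off its domain. -/
def LSub.fn (δ : LSub) (x : LVar) : Tm :=
  if hx : x ∈ δ.dom then δ.val ⟨x, hx⟩ else .lvar x

/-! ## Substitution -/

/-- Shift the local indices `≥ c` by one. A `box` contains no local index bound outside of it. -/
def Tm.shiftL : ℕ → Tm → Tm
  | _, .unit => .unit
  | _, .num n => .num n
  | c, .bvar k => if c ≤ k then .bvar (k + 1) else .bvar k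
  | _, .lvar x => .lvar x
  | c, .gvar u d δ => .gvar u d (fun x => (δ x).shiftL c)
  | _, .loc l => .loc l
  | c, .lam M => .lam (M.shiftL (c + 1))
  | c, .app M N => .app (M.shiftL c) (N.shiftL c)
  | c, .recf M => .recf (M.shiftL (c + 2))
  | c, .arith o M N => .arith o (M.shiftL c) (N.shiftL c)
  | c, .ite M N P => .ite (M.shiftL c) (N.shiftL c) (P.shiftL c)
  | c, .ref M => .ref (M.shiftL c)
  | c, .deref M => .deref (M.shiftL c)
  | c, .assign M N => .assign (M.shiftL c) (N.shiftL c)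
  | _, .box M => .box M
  | c, .letbox M N => .letbox (M.shiftL c) (N.shiftL c)
  | _, .name n => .name n
  | c, .unbox b d δ => .unbox b d (fun x => (δ x).shiftL c)

/-- Shift the global indices `≥ c` by one. -/
def Tm.shiftG : ℕ → Tm → Tm
  | _, .unit => .unit
  | _, .num n => .num n
  | _, .bvar k => .bvar k
  | _, .lvar x => .lvar x
  | c, .gvar u d δ => .gvar (if c ≤ u then u + 1 else u) d (fun x => (δ x).shiftG c)
  | _, .loc l => .loc l
  | c, .lam M => .lam (M.shiftG c)
  | c, .app M N => .app (M.shiftG c) (N.shiftG c)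
  | c, .recf M => .recf (M.shiftG c)
  | c, .arith o M N => .arith o (M.shiftG c) (N.shiftG c)
  | c, .ite M N P => .ite (M.shiftG c) (N.shiftG c) (P.shiftG c)
  | c, .ref M => .ref (M.shiftG c)
  | c, .deref M => .deref (M.shiftG c)
  | c, .assign M N => .assign (M.shiftG c) (N.shiftG c)
  | c, .box M => .box (M.shiftG c)
  | c, .letbox M N => .letbox (M.shiftG c) (N.shiftG (c + 1))
  | _, .name n => .name n
  | c, .unbox b d δ => .unbox b d (fun x => (δ x).shiftG c)

/-- Extend a substitution of local indices under one binder. -/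
def upL (β : ℕ → Tm) : ℕ → Tm
  | 0 => .bvar 0
  | k + 1 => (β k).shiftL 0

/-- Simultaneous capture-avoiding substitution of `β` for the local indices and of `δ` for the
named local variables. A `box` binds all local variables in it and is left alone. -/
def Tm.subL : (ℕ → Tm) → (LVar → Tm) → Tm → Tm
  | _, _, .unit => .unit
  | _, _, .num n => .num n
  | β, _, .bvar k => β k
  | _, δ, .lvar x => δ x
  | β, δ, .gvar u d s => .gvar u d (fun x => (s x).subL β δ)
  | _, _, .loc l => .loc l
  | β, δ, .lam M => .lam (M.subL (upL β) (fun x => (δ x).shiftL 0))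
  | β, δ, .app M N => .app (M.subL β δ) (N.subL β δ)
  | β, δ, .recf M =>
      .recf (M.subL (upL (upL β)) (fun x => ((δ x).shiftL 0).shiftL 0))
  | β, δ, .arith o M N => .arith o (M.subL β δ) (N.subL β δ)
  | β, δ, .ite M N P => .ite (M.subL β δ) (N.subL β δ) (P.subL β δ)
  | β, δ, .ref M => .ref (M.subL β δ)
  | β, δ, .deref M => .deref (M.subL β δ)
  | β, δ, .assign M N => .assign (M.subL β δ) (N.subL β δ)
  | _, _, .box M => .box M
  | β, δ, .letbox M N =>
      .letbox (M.subL β δ) (N.subL (fun k => (β k).shiftG 0) (fun x => (δ x).shiftG 0))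
  | _, _, .name n => .name n
  | β, δ, .unbox b d s => .unbox b d (fun x => (s x).subL β δ)

/-- `M[δ]`. -/
def Tm.lsub (M : Tm) (δ : LSub) : Tm := M.subL .bvar δ.fn

/-- What may be substituted for a global variable: another global variable, a term (open in the
named local variables), or `#b` for a box name `b`. -/
inductive Code : Type
  | var : ℕ → Code
  | term : Tm → Code
  | hash : Name → Code

/-- Put code in the place of `u` in `u^δ`. -/
def Code.inst : Code → LSub → Tm
  | .var u, δ => .gvar u δ.dom δ.val
  | .term M, δ => M.lsub δ
  | .hash b, δ => .unbox b δ.dom δ.val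

def Code.shift : Code → Code
  | .var u => .var (u + 1)
  | .term M => .term (M.shiftG 0)
  | .hash b => .hash b

/-- Extend a global substitution under one `letbox`. -/
def upG (σ : ℕ → Code) : ℕ → Code
  | 0 => .var 0
  | u + 1 => (σ u).shift

/-- Global substitution; the code substituted has no free local index. -/
def Tm.subG : (ℕ → Code) → Tm → Tm
  | _, .unit => .unit
  | _, .num n => .num n
  | _, .bvar k => .bvar k
  | _, .lvar x => .lvar x
  | σ, .gvar u d s => (σ u).inst ⟨d, fun x => (s x).subG σ⟩
  | _, .loc l => .loc l
  | σ, .lam M => .lam (M.subG σ)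
  | σ, .app M N => .app (M.subG σ) (N.subG σ)
  | σ, .recf M => .recf (M.subG σ)
  | σ, .arith o M N => .arith o (M.subG σ) (N.subG σ)
  | σ, .ite M N P => .ite (M.subG σ) (N.subG σ) (P.subG σ)
  | σ, .ref M => .ref (M.subG σ)
  | σ, .deref M => .deref (M.subG σ)
  | σ, .assign M N => .assign (M.subG σ) (N.subG σ)
  | σ, .box M => .box (M.subG σ)
  | σ, .letbox M N => .letbox (M.subG σ) (N.subG (upG σ))
  | _, .name n => .name n
  | σ, .unbox b d s => .unbox b d (fun x => (s x).subG σ)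

/-- A closing global substitution, given by the list of its terms. -/
abbrev GSub := List Tm

/-- An abstract global substitution `u ↦ #b_u`, given by the list of its box names. -/
abbrev AGSub := List Name

def GSub.fn (σ : GSub) (u : ℕ) : Code :=
  match σ[u]? with
  | some M => .term M
  | none => .var u

def AGSub.fn (η : AGSub) (u : ℕ) : Code :=
  match η[u]? with
  | some b => .hash b
  | none => .var u

/-- `# V` for a value `V` of box type: `#(box M) = M`, and `#b` for a box name `b`. -/
def Tm.code : Tm → Option Code
  | .box M => some (.term M)
  | .name b => some (.hash b)
  | _ => none

/-- The substitution `[V/x]` of a `β`-redex. -/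
def betaSub (V : Tm) : ℕ → Tm
  | 0 => V
  | k + 1 => .bvar k

/-- The substitution `[V/x, W/y]` of a redex `(rec y(x).M) V`. -/
def recSub (V W : Tm) : ℕ → Tm
  | 0 => V
  | 1 => W
  | k + 2 => .bvar k

/-- The substitution `[c/u]` of a `letbox` redex. -/
def boxSub (c : Code) : ℕ → Code
  | 0 => c
  | u + 1 => .var u

/-! ## Typing -/

/-- Well-formedness of all contexts of a judgement at layer `i`; `Δ` types the local indices. -/
def CtxWf (S : Store) (Ψ : GCtx) (Γ : LCtx) (Δ : List Ty) (i : Layer) : Prop :=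
  Store.Wf 1 S ∧ GCtx.Wf Ψ ∧ LCtx.Wf i Γ ∧ ∀ T ∈ Δ, Ty.Wf i T

/-- Typing `S; Ψ; Γ, Δ ⊢_i M : T`, where `Γ` types the named local variables and `Δ` the local
variables bound by `λ` and `rec`. The store context may mention box types at both layers, but a
term of layer `i` can only mention locations whose type is a type of layer `i`. -/
inductive HasTy (S : Store) : GCtx → LCtx → List Ty → Layer → Tm → Ty → Prop
  | unit {Ψ Γ Δ i} : CtxWf S Ψ Γ Δ i → HasTy S Ψ Γ Δ i .unit .unit
  | num {Ψ Γ Δ i} (n : ℕ) : CtxWf S Ψ Γ Δ i → HasTy S Ψ Γ Δ i (.num n) .int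
  | lvar {Ψ Γ Δ i x T} : CtxWf S Ψ Γ Δ i → (x, T) ∈ Γ → HasTy S Ψ Γ Δ i (.lvar x) T
  | bvar {Ψ Γ Δ i} {k : ℕ} {T : Ty} : CtxWf S Ψ Γ Δ i → Δ[k]? = some T →
      HasTy S Ψ Γ Δ i (.bvar k) T
  | gvar {Ψ Γ Δ i} {u : ℕ} {d : Finset LVar} {δ : {x // x ∈ d} → Tm} {Γ' : LCtx} {T : Ty} :
      CtxWf S Ψ Γ Δ i → Ψ[u]? = some (Γ', T) →
      (∀ x, x ∈ d ↔ x ∈ Γ'.map Prod.fst) → (∀ x, (δ x).IsValue) →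
      (∀ (x : {x // x ∈ d}) (T' : Ty), (x.1, T') ∈ Γ' → HasTy S Ψ Γ Δ i (δ x) T') →
      HasTy S Ψ Γ Δ i (.gvar u d δ) T
  | loc {Ψ Γ Δ i l T} : CtxWf S Ψ Γ Δ i → S.lookup l = some T → Ty.Wf i T →
      HasTy S Ψ Γ Δ i (.loc l) (.ref T)
  | lam {Ψ Γ Δ i M T₁ T₂} : HasTy S Ψ Γ (T₁ :: Δ) i M T₂ →
      HasTy S Ψ Γ Δ i (.lam M) (.arrow T₁ T₂)
  | app {Ψ Γ Δ i M N T₁ T₂} : HasTy S Ψ Γ Δ i M (.arrow T₁ T₂) → HasTy S Ψ Γ Δ i N T₁ →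
      HasTy S Ψ Γ Δ i (.app M N) T₂
  | recf {Ψ Γ Δ i M T₁ T₂} : HasTy S Ψ Γ (T₁ :: .arrow T₁ T₂ :: Δ) i M T₂ →
      HasTy S Ψ Γ Δ i (.recf M) (.arrow T₁ T₂)
  | arith {Ψ Γ Δ i M N} (o : Op) : HasTy S Ψ Γ Δ i M .int → HasTy S Ψ Γ Δ i N .int →
      HasTy S Ψ Γ Δ i (.arith o M N) .int
  | ite {Ψ Γ Δ i M N P T} : HasTy S Ψ Γ Δ i M .int → HasTy S Ψ Γ Δ i N T →
      HasTy S Ψ Γ Δ i P T → HasTy S Ψ Γ Δ i (.ite M N P) T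
  | ref {Ψ Γ Δ i M T} : HasTy S Ψ Γ Δ i M T → HasTy S Ψ Γ Δ i (.ref M) (.ref T)
  | deref {Ψ Γ Δ i M T} : HasTy S Ψ Γ Δ i M (.ref T) → HasTy S Ψ Γ Δ i (.deref M) T
  | assign {Ψ Γ Δ i M N T} : HasTy S Ψ Γ Δ i M (.ref T) → HasTy S Ψ Γ Δ i N T →
      HasTy S Ψ Γ Δ i (.assign M N) .unit
  | box {Ψ Γ Δ M Γ' T} : CtxWf S Ψ Γ Δ 1 → HasTy S Ψ Γ' [] 0 M T →
      HasTy S Ψ Γ Δ 1 (.box M) (.box Γ' T)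
  | letbox {Ψ Γ Δ M N Γ' T T'} : HasTy S Ψ Γ Δ 1 M (.box Γ' T) →
      HasTy S ((Γ', T) :: Ψ) Γ Δ 1 N T' → HasTy S Ψ Γ Δ 1 (.letbox M N) T'
  | name {Ψ Γ Δ i j n T} : CtxWf S Ψ Γ Δ i → NameOf n T j → j ≤ i →
      HasTy S Ψ Γ Δ i (.name n) T
  | unbox {Ψ Γ Δ i} {b : Name} {d : Finset LVar} {δ : {x // x ∈ d} → Tm} {Γ' : LCtx} {T : Ty} :
      CtxWf S Ψ Γ Δ i → NameOf b (.box Γ' T) 1 →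
      (∀ x, x ∈ d ↔ x ∈ Γ'.map Prod.fst) → (∀ x, (δ x).IsValue) →
      (∀ (x : {x // x ∈ d}) (T' : Ty), (x.1, T') ∈ Γ' → HasTy S Ψ Γ Δ i (δ x) T') →
      HasTy S Ψ Γ Δ i (.unbox b d δ) T

/-- Closed terms: `S; ·; · ⊢_i M : T`. -/
abbrev Typed (S : Store) (i : Layer) (M : Tm) (T : Ty) : Prop := HasTy S [] [] [] i M T

/-- Closed local substitutions: `S; ·; · ⊢_i δ : Γ`. -/
def LSubTyped (S : Store) (i : Layer) (δ : LSub) (Γ : LCtx) : Prop :=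
  (∀ x, x ∈ δ.dom ↔ x ∈ Γ.map Prod.fst) ∧ (∀ x, (δ.val x).IsValue) ∧
    ∀ x T, (x, T) ∈ Γ → Typed S i (δ.fn x) T

/-- Closing global substitutions: `S; · ⊢ σ : Ψ`. -/
def GSubTyped (S : Store) (σ : GSub) (Ψ : GCtx) : Prop :=
  List.Forall₂ (fun M p => HasTy S [] p.1 [] 0 M p.2) σ Ψ

/-! ## Heaps and reduction -/

abbrev Heap := Finmap (fun _ : Loc => Tm)

/-- Closed heaps: `S; ·; · ⊢ h : heap`. -/
def HeapTyped (S : Store) (h : Heap) : Prop :=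
  S.keys = h.keys ∧ (∀ l V, h.lookup l = some V → V.IsValue) ∧
    ∃ i : Layer, ∀ l T V, S.lookup l = some T → h.lookup l = some V → Typed S i V T

/-- Evaluation contexts. -/
inductive ECtx : Type
  | hole : ECtx
  | appL (K : ECtx) (M : Tm) : ECtx
  | appR (V : Tm) (hV : V.IsValue) (K : ECtx) : ECtx
  | arithL (o : Op) (K : ECtx) (M : Tm) : ECtx
  | arithR (o : Op) (V : Tm) (hV : V.IsValue) (K : ECtx) : ECtx
  | ite (K : ECtx) (M N : Tm) : ECtx
  | ref (K : ECtx) : ECtx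
  | deref (K : ECtx) : ECtx
  | assignL (K : ECtx) (M : Tm) : ECtx
  | assignR (V : Tm) (hV : V.IsValue) (K : ECtx) : ECtx
  | letbox (K : ECtx) (N : Tm) : ECtx

/-- `K[M]`. -/
def ECtx.plug : ECtx → Tm → Tm
  | .hole, M => M
  | .appL K N, M => .app (K.plug M) N
  | .appR V _ K, M => .app V (K.plug M)
  | .arithL o K N, M => .arith o (K.plug M) N
  | .arithR o V _ K, M => .arith o V (K.plug M)
  | .ite K N P, M => .ite (K.plug M) N P
  | .ref K, M => .ref (K.plug M)
  | .deref K, M => .deref (K.plug M)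
  | .assignL K N, M => .assign (K.plug M) N
  | .assignR V _ K, M => .assign V (K.plug M)
  | .letbox K N, M => .letbox (K.plug M) N

def ECtx.NameFree : ECtx → Prop
  | .hole => True
  | .appL K N | .arithL _ K N | .assignL K N | .letbox K N => K.NameFree ∧ N.NameFree
  | .appR V _ K | .arithR _ V _ K | .assignR V _ K => V.NameFree ∧ K.NameFree
  | .ite K N P => K.NameFree ∧ N.NameFree ∧ P.NameFree
  | .ref K | .deref K => K.NameFree

/-- `ECtxTyped S i₀ T₀ K i T`: the judgement `S ⊢ K : (·; ·; i₀; T₀) → (·; ·; i; T)`. -/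
inductive ECtxTyped (S : Store) (i₀ : Layer) (T₀ : Ty) : ECtx → Layer → Ty → Prop
  | hole {i} : i₀ ≤ i → ECtxTyped S i₀ T₀ .hole i T₀
  | appL {i K M T₁ T₂} : ECtxTyped S i₀ T₀ K i (.arrow T₁ T₂) → Typed S i M T₁ →
      ECtxTyped S i₀ T₀ (.appL K M) i T₂
  | appR {i K V hV T₁ T₂} : Typed S i V (.arrow T₁ T₂) → ECtxTyped S i₀ T₀ K i T₁ →
      ECtxTyped S i₀ T₀ (.appR V hV K) i T₂
  | arithL {i K M} (o : Op) : ECtxTyped S i₀ T₀ K i .int → Typed S i M .int →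
      ECtxTyped S i₀ T₀ (.arithL o K M) i .int
  | arithR {i K V hV} (o : Op) : Typed S i V .int → ECtxTyped S i₀ T₀ K i .int →
      ECtxTyped S i₀ T₀ (.arithR o V hV K) i .int
  | ite {i K M N T} : ECtxTyped S i₀ T₀ K i .int → Typed S i M T → Typed S i N T →
      ECtxTyped S i₀ T₀ (.ite K M N) i T
  | ref {i K T} : ECtxTyped S i₀ T₀ K i T → ECtxTyped S i₀ T₀ (.ref K) i (.ref T)
  | deref {i K T} : ECtxTyped S i₀ T₀ K i (.ref T) → ECtxTyped S i₀ T₀ (.deref K) i T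
  | assignL {i K M T} : ECtxTyped S i₀ T₀ K i (.ref T) → Typed S i M T →
      ECtxTyped S i₀ T₀ (.assignL K M) i .unit
  | assignR {i K V hV T} : Typed S i V (.ref T) → ECtxTyped S i₀ T₀ K i T →
      ECtxTyped S i₀ T₀ (.assignR V hV K) i .unit
  | letbox {K N Γ T T'} : ECtxTyped S i₀ T₀ K 1 (.box Γ T) →
      HasTy S [(Γ, T)] [] [] 1 N T' → ECtxTyped S i₀ T₀ (.letbox K N) 1 T'

/-- Small-step reduction `(M, h) → (M', h')`. -/
inductive Step : Tm × Heap → Tm × Heap → Prop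
  | beta {M V : Tm} {h : Heap} : V.IsValue →
      Step (.app (.lam M) V, h) (M.subL (betaSub V) .lvar, h)
  | arith {o : Op} {m n : ℕ} {h : Heap} :
      Step (.arith o (.num m) (.num n), h) (.num (o.eval m n), h)
  | iteTrue {n : ℕ} {M N : Tm} {h : Heap} : n ≠ 0 → Step (.ite (.num n) M N, h) (M, h)
  | iteFalse {M N : Tm} {h : Heap} : Step (.ite (.num 0) M N, h) (N, h)
  | ref {V : Tm} {h : Heap} {l : Loc} : V.IsValue → l ∉ h →
      Step (.ref V, h) (.loc l, h.insert l V)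
  | deref {h : Heap} {l : Loc} {V : Tm} : h.lookup l = some V →
      Step (.deref (.loc l), h) (V, h)
  | assign {V : Tm} {h : Heap} {l : Loc} : V.IsValue → l ∈ h →
      Step (.assign (.loc l) V, h) (.unit, h.insert l V)
  | recf {M V : Tm} {h : Heap} : V.IsValue →
      Step (.app (.recf M) V, h) (M.subL (recSub V (.recf M)) .lvar, h)
  | letbox {M N : Tm} {h : Heap} :
      Step (.letbox (.box M) N, h) (N.subG (boxSub (.term M)), h)
  | letboxName {Γ : LCtx} {T : Ty} {k : ℕ} {N : Tm} {h : Heap} :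
      Step (.letbox (.name (.bx Γ T k)) N, h) (N.subG (boxSub (.hash (.bx Γ T k))), h)
  | ktx {M₁ M₂ : Tm} {h₁ h₂ : Heap} (K : ECtx) : Step (M₁, h₁) (M₂, h₂) →
      Step (K.plug M₁, h₁) (K.plug M₂, h₂)

/-- `(M, h)⇓`. -/
def Converges (M : Tm) (h : Heap) : Prop :=
  ∃ V h', V.IsValue ∧ Relation.ReflTransGen Step (M, h) (V, h')

/-! ## Finite maps, restriction of heaps -/

/-- Inclusion of finite maps. -/
def MapSub {α : Type} (s t : Finmap (fun _ : Loc => α)) : Prop :=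
  ∀ l a, s.lookup l = some a → t.lookup l = some a

/-- Two store contexts agree on the locations they share. -/
def Store.Agree (S S' : Store) : Prop :=
  ∀ l T T', S.lookup l = some T → S'.lookup l = some T' → T = T'

/-- A location stored in the heap belongs to its domain. -/
def Heap.Closed (h : Heap) : Prop := ∀ l l', h.lookup l = some (.loc l') → l' ∈ h

/-- `(S', h')` is the restriction of `(S, h)` to `θ`: `h'` is the least closed subheap of `h` whose
domain contains `θ`, and `S'` is the corresponding part of `S`. -/
def IsRestr (S : Store) (h : Heap) (θ : Finset Loc) (S' : Store) (h' : Heap) : Prop :=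
  (MapSub h' h ∧ θ ⊆ h'.keys ∧ h'.Closed) ∧
  (∀ g : Heap, MapSub g h → θ ⊆ g.keys → g.Closed → MapSub h' g) ∧
  MapSub S' S ∧ S'.keys = h'.keys

/-! ## Value abstraction -/

/-- Abstract values: unit, numerals, locations and names. -/
def Tm.IsAbs : Tm → Prop
  | .unit | .num _ | .loc _ | .name _ => True
  | _ => False

/-- The set `ν(A)` of names of an abstract value. -/
def Tm.nu : Tm → Set Name
  | .name n => {n}
  | _ => ∅

/-- The set `μ(A)` of locations of an abstract value. -/
def Tm.mu : Tm → Finset Loc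
  | .loc l => {l}
  | _ => ∅

def LSub.nu (ρ : LSub) : Set Name := {n | ∃ x, ρ.val x = .name n}

def LSub.mu (ρ : LSub) : Finset Loc := Finset.univ.biUnion (fun x => (ρ.val x).mu)

def AGSub.nu (η : AGSub) : Set Name := {b | b ∈ η}

def Heap.nu (χ : Heap) : Set Name := {n | ∃ l, χ.lookup l = some (.name n)}

/-- Different variables are abstracted by different names. -/
def LSub.DistinctNames (ρ : LSub) : Prop :=
  ∀ x y n, ρ.val x = .name n → ρ.val y = .name n → x = y

/-- Different locations are abstracted by different names. -/
def Heap.DistinctNames (χ : Heap) : Prop :=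
  ∀ l l' n, χ.lookup l = some (.name n) → χ.lookup l' = some (.name n) → l = l'

/-- Partial maps from names to values. -/
abbrev NMap := Name → Option Tm

def NMap.empty : NMap := fun _ => none

open Classical in
noncomputable def NMap.single (n : Name) (V : Tm) : NMap := fun m => if m = n then some V else none

/-- Union, used for maps with disjoint domains. -/
def NMap.union (γ γ' : NMap) : NMap := fun n => (γ n).or (γ' n)

/-- `γ` is the union of the maps `g x`, for `x` in `D`. -/
def NMap.IsUnion {ι : Type} (γ : NMap) (D : Set ι) (g : ι → NMap) : Prop :=
  ∀ n V, γ n = some V ↔ ∃ x ∈ D, g x n = some V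

/-- `AbsVal i V T A γ`: the pair `(A, γ)` belongs to the abstraction set of the closed value `V` of
type `T` at layer `i`. -/
inductive AbsVal (i : Layer) : Tm → Ty → Tm → NMap → Prop
  | unit : AbsVal i .unit .unit .unit .empty
  | num (n : ℕ) : AbsVal i (.num n) .int (.num n) .empty
  | loc (l : Loc) (T : Ty) : AbsVal i (.loc l) (.ref T) (.loc l) .empty
  | fn {V : Tm} {T₁ T₂ : Ty} {f : Name} : V.IsValue → NameOf f (.arrow T₁ T₂) i →
      AbsVal i V (.arrow T₁ T₂) (.name f) (.single f V)
  | bx {V : Tm} {Γ : LCtx} {T : Ty} {b : Name} : V.IsValue → i = 1 → NameOf b (.box Γ T) 1 →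
      AbsVal i V (.box Γ T) (.name b) (.single b V)

/-- Abstraction of a local substitution `δ : Γ` at layer `i`. -/
def AbsLSub (i : Layer) (δ : LSub) (Γ : LCtx) (ρ : LSub) (γ : NMap) : Prop :=
  ρ.dom = δ.dom ∧ ρ.DistinctNames ∧ ∃ g : LVar → NMap,
    (∀ x T, (x, T) ∈ Γ → AbsVal i (δ.fn x) T (ρ.fn x) (g x)) ∧ γ.IsUnion {x | x ∈ δ.dom} g

/-- Abstraction of a global substitution `σ : Ψ`: the code values `box σ(u)` are abstracted by
distinct box names. -/
def AbsGSub (σ : GSub) (Ψ : GCtx) (η : AGSub) (γ : NMap) : Prop :=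
  η.length = σ.length ∧ η.Nodup ∧ ∃ g : ℕ → NMap,
    (∀ (u : ℕ) (M : Tm) (p : LCtx × Ty) (b : Name), σ[u]? = some M → Ψ[u]? = some p →
      η[u]? = some b → AbsVal 1 (.box M) (.box p.1 p.2) (.name b) (g u)) ∧
    γ.IsUnion {u | u < σ.length} g

/-- Abstraction of a part `h'` of a heap typed by `S`. The values of `h'` need not be typable in
the corresponding part of `S`, as the bodies of functions may use other locations. -/
def AbsHeap (S : Store) (h' : Heap) (χ : Heap) (γ : NMap) : Prop :=
  χ.keys = h'.keys ∧ χ.DistinctNames ∧ ∃ (i : Layer) (g : Loc → NMap),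
    (∀ l V, h'.lookup l = some V → ∃ T A, S.lookup l = some T ∧ χ.lookup l = some A ∧
      Typed S i V T ∧ AbsVal i V T A (g l)) ∧
    γ.IsUnion {l | l ∈ h'} g

/-! ## Actions, configurations, transitions -/

inductive Polarity : Type
  | P | O

def Polarity.flip : Polarity → Polarity
  | .P => .O
  | .O => .P

/-- Answers, questions of functions `f(A)`, questions of boxes `run b^ρ`. -/
inductive Move : Type
  | ans (A : Tm) : Move
  | qf (f : Name) (A : Tm) : Move
  | qb (b : Name) (ρ : LSub) : Move

structure Action : Type where
  pol : Polarity
  move : Move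
  store : Store
  heap : Heap

/-- The same action with the opposite polarity. -/
def Action.dual (a : Action) : Action := { a with pol := a.pol.flip }

/-- A player answer (PA). -/
def Action.IsPA (a : Action) : Prop := a.pol = .P ∧ ∃ A, a.move = .ans A

/-- A stack entry `S ⊢ K : (·; ·; Tin; iin) → (·; ·; Tout; iout)`. -/
structure Frame : Type where
  store : Store
  ctx : ECtx
  Tin : Ty
  iin : Layer
  Tout : Ty
  iout : Layer

/-- Configurations: `S`, `h` are the store context and the heap, `γ` maps names to the values they
represent, `φ` are the names introduced so far, `ξ` is the stack (top first), `θ` are the shared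
locations. Active configurations also hold a term with its layer and type. -/
inductive Config : Type
  | passive (S : Store) (h : Heap) (γ : NMap) (φ : Set Name) (ξ : List Frame) (θ : Finset Loc)
  | active (M : Tm) (i : Layer) (T : Ty) (S : Store) (h : Heap) (γ : NMap) (φ : Set Name)
      (ξ : List Frame) (θ : Finset Loc)

/-- The names `N` and those of `χ` are new with respect to `φ` and pairwise distinct. -/
def Fresh (φ N : Set Name) (χ : Heap) : Prop :=
  Disjoint φ N ∧ Disjoint φ χ.nu ∧ Disjoint N χ.nu ∧ χ.DistinctNames

/-- Conditions on the store context `S'` and the heap `χ` of an action of the context received in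
`(S, h)` with shared locations `θ`, where `L` are the locations in the rest of the action. -/
def OHeap (S : Store) (h : Heap) (θ L : Finset Loc) (S' : Store) (χ : Heap) : Prop :=
  (∀ l A, χ.lookup l = some A → A.IsAbs) ∧ HeapTyped S' χ ∧ S.Agree S' ∧
    χ.keys ∩ h.keys = θ ∧ IsRestr S' χ (θ ∪ L) S' χ

/-- The transitions; the label `none` is the silent move `τ`. In a silent move the store context is
extended by the type of the new location, if any, so that term and heap remain well-typed. A layer
that is not fixed by the configuration or by a name (that of the argument of a question, and that
of a heap) may be any layer at which the values concerned are typable. -/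
inductive Trans : Config → Option Action → Config → Prop
  | tau {M₁ M₂ i T S₁ S₂ h₁ h₂ γ φ ξ θ} :
      Step (M₁, h₁) (M₂, h₂) → MapSub S₁ S₂ → HeapTyped S₂ h₂ → (∃ j, Typed S₂ j M₂ T) →
      Trans (.active M₁ i T S₁ h₁ γ φ ξ θ) none (.active M₂ i T S₂ h₂ γ φ ξ θ)
  | pa {V i T S h γ φ ξ θ A γ' S' h' χ γ''} :
      V.IsValue → AbsVal i V T A γ' →
      IsRestr S h (θ ∪ A.mu) S' h' → AbsHeap S h' χ γ'' → Fresh φ A.nu χ →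
      Trans (.active V i T S h γ φ ξ θ) (some ⟨.P, .ans A, S', χ⟩)
        (.passive S h ((γ.union γ').union γ'') (φ ∪ A.nu ∪ χ.nu) ξ χ.keys)
  | pqf {K f V i T S h γ φ ξ θ T₁ T₂ i₁ i₂ A γ' S' h' χ γ''} :
      V.IsValue → NameOf f (.arrow T₁ T₂) i₁ → Typed S i₂ V T₁ → AbsVal i₂ V T₁ A γ' →
      IsRestr S h (θ ∪ A.mu) S' h' → AbsHeap S h' χ γ'' → Fresh φ A.nu χ →
      Trans (.active (K.plug (.app (.name f) V)) i T S h γ φ ξ θ) (some ⟨.P, .qf f A, S', χ⟩)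
        (.passive S h ((γ.union γ').union γ'') (φ ∪ A.nu ∪ χ.nu)
          (⟨S, K, T₂, max i₁ i₂, T, i⟩ :: ξ) χ.keys)
  | pqb {K b i T S h γ φ ξ θ Γ T₁ i₁ γ' S' h' χ γ''} {δ ρ : LSub} :
      NameOf b (.box Γ T₁) 1 → LSubTyped S i₁ δ Γ → AbsLSub i₁ δ Γ ρ γ' →
      IsRestr S h (θ ∪ ρ.mu) S' h' → AbsHeap S h' χ γ'' → Fresh φ ρ.nu χ →
      Trans (.active (K.plug (.unbox b δ.dom δ.val)) i T S h γ φ ξ θ)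
        (some ⟨.P, .qb b ρ, S', χ⟩)
        (.passive S h ((γ.union γ').union γ'') (φ ∪ ρ.nu ∪ χ.nu)
          (⟨S, K, T₁, i₁, T, i⟩ :: ξ) χ.keys)
  | oa {S h γ φ ξ θ S₀ K T₁ i₁ T₂ i₂ A S' χ} :
      A.IsAbs → Typed S' i₁ A T₁ → OHeap S h θ A.mu S' χ → Fresh φ A.nu χ →
      Trans (.passive S h γ φ (⟨S₀, K, T₁, i₁, T₂, i₂⟩ :: ξ) θ) (some ⟨.O, .ans A, S', χ⟩)
        (.active (K.plug A) i₂ T₂ (S ∪ S') (χ ∪ h) γ (φ ∪ A.nu ∪ χ.nu) ξ χ.keys)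
  | oqf {S h γ φ ξ θ f T₁ T₂ i₁ i₂ V A S' χ} :
      NameOf f (.arrow T₁ T₂) i₁ → γ f = some V → A.IsAbs → Typed S' i₂ A T₁ →
      OHeap S h θ A.mu S' χ → Fresh φ A.nu χ →
      Trans (.passive S h γ φ ξ θ) (some ⟨.O, .qf f A, S', χ⟩)
        (.active (.app V A) (max i₁ i₂) T₂ (S ∪ S') (χ ∪ h) γ (φ ∪ A.nu ∪ χ.nu) ξ χ.keys)
  | oqb {S h γ φ ξ θ b Γ T i V c S' χ} {ρ : LSub} :
      NameOf b (.box Γ T) 1 → γ b = some V → V.code = some c →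
      (∀ x, (ρ.val x).IsAbs) → ρ.DistinctNames → LSubTyped S' i ρ Γ →
      OHeap S h θ ρ.mu S' χ → Fresh φ ρ.nu χ →
      Trans (.passive S h γ φ ξ θ) (some ⟨.O, .qb b ρ, S', χ⟩)
        (.active (c.inst ρ) i T (S ∪ S') (χ ∪ h) γ (φ ∪ ρ.nu ∪ χ.nu) ξ χ.keys)

/-! ## Traces -/

/-- `C ⇒ C'` labelled by one action: silent moves followed by the action. -/
def WeakTrans (C : Config) (a : Action) (C' : Config) : Prop :=
  ∃ C'', Relation.ReflTransGen (fun D D' => Trans D none D') C C'' ∧ Trans C'' (some a) C'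

/-- `C ⇒ C'` labelled by a sequence of actions. -/
inductive Run : Config → List Action → Config → Prop
  | nil (C : Config) : Run C [] C
  | cons {C C' C'' : Config} {a : Action} {t : List Action} :
      WeakTrans C a C' → Run C' t C'' → Run C (a :: t) C''

/-- `Tr(C)`: the traces that lead to a passive configuration with an empty stack. -/
def Tr (C : Config) : Set (List Action) :=
  {t | ∃ S h γ φ θ, Run C t (.passive S h γ φ [] θ)}

/-- `C₁ | C₂ ↓^t`. -/
def SharesTrace (C₁ C₂ : Config) (t : List Action) : Prop :=
  (∃ a : Action, a.IsPA ∧ t ∈ Tr C₁ ∧ t.map Action.dual ++ [a] ∈ Tr C₂) ∨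
  (∃ a : Action, a.IsPA ∧ t ++ [a] ∈ Tr C₁ ∧ t.map Action.dual ∈ Tr C₂)

/-- The program configuration of a term of type `T` at layer `i`. -/
def progConf (M : Tm) (i : Layer) (T : Ty) (S : Store) (η : AGSub) (ρ : LSub) (χ : Heap) :
    Config :=
  .active ((M.subG η.fn).lsub ρ) i T S χ .empty (η.nu ∪ ρ.nu ∪ χ.nu) [] χ.keys

/-- The context configuration of an evaluation context
`S ⊢ K : (·; ·; T; i) → (·; ·; T'; i')`. -/
def ctxConf (S : Store) (K : ECtx) (T : Ty) (i : Layer) (T' : Ty) (i' : Layer) (h : Heap)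
    (η : AGSub) (γ : NMap) (ρ : LSub) (γ' : NMap) (χ : Heap) (γ'' : NMap) : Config :=
  .passive S h ((γ.union γ').union γ'') (η.nu ∪ ρ.nu ∪ χ.nu) [⟨S, K, T, i, T', i'⟩] χ.keys

end LMML

open LMML

namespace LMML

/-! ## Substitution: commutation lemmas -/

/-! Two interacting configurations are read as two views of one program. A name stands for a value
kept by one of the sides. Replacing each name by what it stands for, fully resolved, and each `#b^δ`
by the code of `b` instantiated with `δ`, turns the term of the active side into a term of the
composed program (`conc`). It is plugged into the frames of the two stacks, which alternate between
the sides (`Chain`). The result is a program `R`. The two heaps glue to one heap `H`, where the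
values that the passive side holds at shared locations are ignored, being possibly out of date
(`Base`). `Linked` is the invariant that relates the two configurations to `R` and `H`.

An action leaves `R` and `H` unchanged: it only moves a frame between the term and the surrounding
context, replaces a value by an abstraction with the same concretization, and swaps the roles of the
sides (`Base.exchange`, `Linked.answer`, `Linked.questionF`, `Linked.questionB`). A silent move is
one reduction of `R` (`CStep.sim`). Conversely, unless the active term is about to ask a question,
the next reduction of `R` is a silent move (`CStep.back`). Both rest on the fact that concretization
commutes with substitution (`conc_subL`, `conc_subG`). This requires well-scoped terms, because an
instantiated code absorbs a substitution only if all its free local variables have been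
instantiated.

From traces to convergence, the proof is an induction on the length of the trace
(`Linked.converges`). The sides may allocate the same location privately, so each side has a
renaming of its locations into `H`.

From convergence to traces, the actions have to be constructed. Each side allocates the location
that `R` allocates, so all renamings remain the identity (`Apart`), and the layers of answers must
match those of the frames (`Layered`). The real difficulty is termination. Since actions do not
advance `R`, an endless exchange of questions without any reduction must be excluded, for example
along names that stand for names. The indices of new names are free, and they are chosen so large
that the weight of a name exceeds the rank of its value (`NMap.Graded`). The rank of a name is its
weight, and the rank of a box is the weight of the box questions that its body asks before its first
reduction. Forwarding a question to another name then lowers the weight, running a box lowers the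
pending weight, and an answer shortens the stacks. The proof is thus an induction on the number of
reductions of `R`, with inner inductions on these measures (`Ready.meets_questionF`,
`Ready.meets_of_measure`).

Finally, the initial configurations are linked because they arise themselves from an exchange: the
context, which owns the whole heap, sends the abstractions to an empty side (`ready_initial`). -/

theorem Tm.shiftL_shiftL (M : Tm) : ∀ {c c' : ℕ}, c ≤ c' →
    (M.shiftL c).shiftL (c' + 1) = (M.shiftL c').shiftL c := by
  induction M with
  | bvar k =>
    intro c c' h
    simp only [Tm.shiftL]
    split_ifs <;> simp only [Tm.shiftL] <;> split_ifs <;> first | rfl | omega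
  | gvar u d δ ih => intro c c' h; simp only [Tm.shiftL]; congr 1; funext x; exact ih x h
  | unbox u d δ ih => intro c c' h; simp only [Tm.shiftL]; congr 1; funext x; exact ih x h
  | lam M ih => intro c c' h; simp only [Tm.shiftL]; rw [ih (by omega)]
  | recf M ih => intro c c' h; exact congrArg Tm.recf (ih (c := c + 2) (c' := c' + 2) (by omega))
  | _ => intros; simp_all [Tm.shiftL]

theorem Tm.shiftL_shiftG (M : Tm) : ∀ (c c' : ℕ),
    (M.shiftL c).shiftG c' = (M.shiftG c').shiftL c := by
  induction M with
  | bvar k => intro c c'; simp only [Tm.shiftL, Tm.shiftG]; split_ifs <;> rfl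
  | _ => intros; simp_all [Tm.shiftL, Tm.shiftG]

theorem Tm.shiftG_shiftG (M : Tm) : ∀ {c c' : ℕ}, c ≤ c' →
    (M.shiftG c).shiftG (c' + 1) = (M.shiftG c').shiftG c := by
  induction M with
  | gvar u d δ ih =>
    intro c c' h
    simp only [Tm.shiftG]
    congr 1
    · split_ifs <;> omega
    · funext x; exact ih x h
  | unbox u d δ ih => intro c c' h; simp only [Tm.shiftG]; congr 1; funext x; exact ih x h
  | letbox M N ihM ihN =>
    intro c c' h; simp only [Tm.shiftG]; rw [ihM h, ihN (by omega)]
  | _ => intros; simp_all [Tm.shiftG]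

/-- The renaming of local indices performed by `Tm.shiftL c`. -/
def skip (c k : ℕ) : ℕ := if c ≤ k then k + 1 else k

theorem upL_comp_skip (β : ℕ → Tm) (c : ℕ) :
    (fun k => upL β (skip (c + 1) k)) = upL (fun k => β (skip c k)) := by
  funext k
  cases k with
  | zero => simp [skip, upL]
  | succ k =>
    by_cases h : c ≤ k
    · simp [skip, upL, h]
    · simp [skip, upL, h]

/-- The shift is absorbed by precomposition with `skip c`. The cutoff varies in the induction, as it
grows under each local binder. -/
theorem Tm.subL_shiftL (M : Tm) : ∀ (c : ℕ) (β : ℕ → Tm) (δ : LVar → Tm),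
    (M.shiftL c).subL β δ = M.subL (fun k => β (skip c k)) δ := by
  induction M with
  | bvar k => intro c β δ; simp only [Tm.shiftL, Tm.subL, skip]; split_ifs <;> rfl
  | lam M ih => intro c β δ; simp only [Tm.shiftL, Tm.subL, ih, upL_comp_skip]
  | recf M ih => intro c β δ; simp only [Tm.shiftL, Tm.subL, ih, upL_comp_skip]
  | _ => intros; simp_all [Tm.shiftL, Tm.subL]

theorem shiftL_upL (β : ℕ → Tm) (c : ℕ) :
    (fun k => (upL β k).shiftL (c + 1)) = upL (fun k => (β k).shiftL c) := by
  funext k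
  cases k with
  | zero => simp [upL, Tm.shiftL]
  | succ k => simp only [upL]; exact Tm.shiftL_shiftL _ (Nat.zero_le _)

theorem Tm.shiftL_subL (M : Tm) : ∀ (c : ℕ) (β : ℕ → Tm) (δ : LVar → Tm),
    (M.subL β δ).shiftL c = M.subL (fun k => (β k).shiftL c) (fun x => (δ x).shiftL c) := by
  induction M with
  | lam M ih =>
    intro c β δ
    simp only [Tm.shiftL, Tm.subL, ih, shiftL_upL]
    congr 2; funext x; exact Tm.shiftL_shiftL _ (Nat.zero_le _)
  | recf M ih =>
    intro c β δ
    simp only [Tm.shiftL, Tm.subL, ih, shiftL_upL]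
    congr 2; funext x
    rw [Tm.shiftL_shiftL _ (Nat.zero_le _), Tm.shiftL_shiftL _ (Nat.zero_le _)]
  | letbox M N ihM ihN =>
    intro c β δ
    simp only [Tm.shiftL, Tm.subL, ihM, ihN, Tm.shiftL_shiftG]
  | _ => intros; simp_all [Tm.shiftL, Tm.subL]

theorem shiftG_upL (β : ℕ → Tm) (c : ℕ) :
    (fun k => (upL β k).shiftG c) = upL (fun k => (β k).shiftG c) := by
  funext k
  cases k with
  | zero => simp [upL, Tm.shiftG]
  | succ k => simp only [upL]; exact Tm.shiftL_shiftG _ _ _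

theorem Tm.shiftG_subL (M : Tm) : ∀ (c : ℕ) (β : ℕ → Tm) (δ : LVar → Tm),
    (M.subL β δ).shiftG c =
      (M.shiftG c).subL (fun k => (β k).shiftG c) (fun x => (δ x).shiftG c) := by
  induction M with
  | lam M ih => intro c β δ; simp only [Tm.shiftG, Tm.subL, ih, shiftG_upL, Tm.shiftL_shiftG]
  | recf M ih => intro c β δ; simp only [Tm.shiftG, Tm.subL, ih, shiftG_upL, Tm.shiftL_shiftG]
  | letbox M N ihM ihN =>
    intro c β δ
    simp only [Tm.shiftG, Tm.subL, ihM, ihN]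
    congr 2
    · funext k; exact Tm.shiftG_shiftG _ (Nat.zero_le _)
    · funext k; exact Tm.shiftG_shiftG _ (Nat.zero_le _)
  | _ => intros; simp_all [Tm.shiftG, Tm.subL]

theorem upL_subL (β β' : ℕ → Tm) (δ' : LVar → Tm) :
    (fun k => (upL β k).subL (upL β') (fun x => (δ' x).shiftL 0)) =
      upL (fun k => (β k).subL β' δ') := by
  funext k
  cases k with
  | zero => simp [upL, Tm.subL]
  | succ k =>
    simp only [upL]
    rw [Tm.subL_shiftL, Tm.shiftL_subL]
    rfl

theorem Tm.shiftL_subL_upL (M : Tm) (β' : ℕ → Tm) (δ' : LVar → Tm) :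
    (M.shiftL 0).subL (upL β') (fun x => (δ' x).shiftL 0) = (M.subL β' δ').shiftL 0 := by
  rw [Tm.subL_shiftL, Tm.shiftL_subL]
  rfl

/-- Local substitutions compose pointwise, for raw terms without any scoping: under a local binder
by `upL_subL`, under `letbox` because weakening of global indices commutes with local substitution.
-/
theorem Tm.subL_subL (M : Tm) : ∀ (β β' : ℕ → Tm) (δ δ' : LVar → Tm),
    (M.subL β δ).subL β' δ' =
      M.subL (fun k => (β k).subL β' δ') (fun x => (δ x).subL β' δ') := by
  induction M with
  | lam M ih => intro β β' δ δ'; simp only [Tm.subL, ih, upL_subL, Tm.shiftL_subL_upL]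
  | recf M ih =>
    intro β β' δ δ'
    simp only [Tm.subL, ih]
    -- `rec` crosses two binders: the composition law is used at `upL β`, and the composite inside
    -- it is rewritten by the law at `β`.
    have h := upL_subL (upL β) (upL β') (fun x => (δ' x).shiftL 0)
    rw [upL_subL β β' δ'] at h
    rw [h]
    congr 2; funext x
    rw [Tm.shiftL_subL_upL _ (upL β') (fun x => (δ' x).shiftL 0), Tm.shiftL_subL_upL]
  | letbox M N ihM ihN =>
    intro β β' δ δ'
    simp only [Tm.subL, ihM, ihN, Tm.shiftG_subL]
  | _ => intros; simp_all [Tm.subL]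

/-! ## Scoping -/

/-- The local variables of the code named by a box name. -/
def Name.dom : Name → Finset LVar
  | .fn _ _ _ _ => ∅
  | .bx Γ _ _ => (Γ.map Prod.fst).toFinset

/-- Well-scoped terms: `Ψ` lists the domains of the global variables, `X` are the local variables,
and there are `k` local indices. -/
def Sc : List (Finset LVar) → Set LVar → ℕ → Tm → Prop
  | _, _, _, .unit => True
  | _, _, _, .num _ => True
  | _, _, k, .bvar n => n < k
  | _, X, _, .lvar x => x ∈ X
  | Ψ, X, k, .gvar u d δ => Ψ[u]? = some d ∧ ∀ x, Sc Ψ X k (δ x)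
  | _, _, _, .loc _ => True
  | Ψ, X, k, .lam M => Sc Ψ X (k + 1) M
  | Ψ, X, k, .app M N => Sc Ψ X k M ∧ Sc Ψ X k N
  | Ψ, X, k, .recf M => Sc Ψ X (k + 2) M
  | Ψ, X, k, .arith _ M N => Sc Ψ X k M ∧ Sc Ψ X k N
  | Ψ, X, k, .ite M N P => Sc Ψ X k M ∧ Sc Ψ X k N ∧ Sc Ψ X k P
  | Ψ, X, k, .ref M => Sc Ψ X k M
  | Ψ, X, k, .deref M => Sc Ψ X k M
  | Ψ, X, k, .assign M N => Sc Ψ X k M ∧ Sc Ψ X k N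
  | Ψ, _, _, .box M => Sc Ψ Set.univ 0 M
  | Ψ, X, k, .letbox M N => Sc Ψ X k M ∧ ∃ d, Sc (d :: Ψ) X k N
  | _, _, _, .name _ => True
  | Ψ, X, k, .unbox b d δ => d = b.dom ∧ ∀ x, Sc Ψ X k (δ x)

/-- Global contexts grow at the far end of the list, so that the indices in use keep their meaning.
-/
theorem Sc.mono {M : Tm} : ∀ {Ψ Ψ' : List (Finset LVar)} {X X' : Set LVar} {k k' : ℕ},
    Sc Ψ X k M → Ψ <+: Ψ' → X ⊆ X' → k ≤ k' → Sc Ψ' X' k' M := by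
  induction M with
  | bvar n => intro Ψ Ψ' X X' k k' h hΨ hX hk; exact lt_of_lt_of_le h hk
  | lvar n => intro Ψ Ψ' X X' k k' h hΨ hX hk; exact hX h
  | gvar u d δ ih =>
    intro Ψ Ψ' X X' k k' h hΨ hX hk
    refine ⟨?_, fun x => ih x (h.2 x) hΨ hX hk⟩
    obtain ⟨t, rfl⟩ := hΨ
    have h1 := h.1
    rw [List.getElem?_append_left]
    · exact h1
    · exact (List.getElem?_eq_some_iff.1 h1).1
  | lam M ih => intro Ψ Ψ' X X' k k' h hΨ hX hk; exact ih (k' := k' + 1) h hΨ hX (by omega)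
  | recf M ih => intro Ψ Ψ' X X' k k' h hΨ hX hk; exact ih (k' := k' + 2) h hΨ hX (by omega)
  | app M N ihM ihN =>
    intro Ψ Ψ' X X' k k' h hΨ hX hk; exact ⟨ihM h.1 hΨ hX hk, ihN h.2 hΨ hX hk⟩
  | arith o M N ihM ihN =>
    intro Ψ Ψ' X X' k k' h hΨ hX hk; exact ⟨ihM h.1 hΨ hX hk, ihN h.2 hΨ hX hk⟩
  | assign M N ihM ihN =>
    intro Ψ Ψ' X X' k k' h hΨ hX hk; exact ⟨ihM h.1 hΨ hX hk, ihN h.2 hΨ hX hk⟩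
  | ite M N P ihM ihN ihP =>
    intro Ψ Ψ' X X' k k' h hΨ hX hk
    exact ⟨ihM h.1 hΨ hX hk, ihN h.2.1 hΨ hX hk, ihP h.2.2 hΨ hX hk⟩
  | ref M ih => intro Ψ Ψ' X X' k k' h hΨ hX hk; exact ih (k' := k') h hΨ hX hk
  | deref M ih => intro Ψ Ψ' X X' k k' h hΨ hX hk; exact ih (k' := k') h hΨ hX hk
  | box M ih =>
    intro Ψ Ψ' X X' k k' h hΨ hX hk; exact ih (k' := 0) h hΨ subset_rfl le_rfl
  | letbox M N ihM ihN =>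
    intro Ψ Ψ' X X' k k' h hΨ hX hk
    obtain ⟨h1, d, h2⟩ := h
    exact ⟨ihM h1 hΨ hX hk, d, ihN h2 (by simpa using hΨ) hX hk⟩
  | unbox b d δ ih =>
    intro Ψ Ψ' X X' k k' h hΨ hX hk
    exact ⟨h.1, fun x => ih x (h.2 x) hΨ hX hk⟩
  | _ => intros; trivial

theorem Sc.of_closed {M : Tm} (h : Sc [] ∅ 0 M) (Ψ : List (Finset LVar)) (X : Set LVar) (k : ℕ) :
    Sc Ψ X k M :=
  h.mono (List.nil_prefix) (Set.empty_subset _) (Nat.zero_le _)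

theorem Sc.shiftL {M : Tm} : ∀ {Ψ : List (Finset LVar)} {X : Set LVar} {k : ℕ} (c : ℕ),
    Sc Ψ X k M → Sc Ψ X (k + 1) (M.shiftL c) := by
  induction M with
  | bvar n =>
    intro Ψ X k c h
    simp only [Sc, Tm.shiftL] at *
    split_ifs <;> simp only [Sc] <;> omega
  | lam M ih => intro Ψ X k c h; exact ih (k := k + 1) _ h
  | recf M ih => intro Ψ X k c h; exact ih (k := k + 2) _ h
  | gvar u d δ ih => intro Ψ X k c h; exact ⟨h.1, fun x => ih x _ (h.2 x)⟩
  | unbox u d δ ih => intro Ψ X k c h; exact ⟨h.1, fun x => ih x _ (h.2 x)⟩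
  | app M N ihM ihN => intro Ψ X k c h; exact ⟨ihM _ h.1, ihN _ h.2⟩
  | arith o M N ihM ihN => intro Ψ X k c h; exact ⟨ihM _ h.1, ihN _ h.2⟩
  | assign M N ihM ihN => intro Ψ X k c h; exact ⟨ihM _ h.1, ihN _ h.2⟩
  | ite M N P ihM ihN ihP => intro Ψ X k c h; exact ⟨ihM _ h.1, ihN _ h.2.1, ihP _ h.2.2⟩
  | letbox M N ihM ihN => intro Ψ X k c h; exact ⟨ihM _ h.1, h.2.choose, ihN _ h.2.choose_spec⟩
  | ref M ih => intro Ψ X k c h; exact ih (k := k) _ h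
  | deref M ih => intro Ψ X k c h; exact ih (k := k) _ h
  | box M ih => intro Ψ X k c h; exact h
  | lvar x => intro Ψ X k c h; exact h
  | _ => intros; trivial

/-- Insertion of one global variable. -/
def InsertedAt (c : ℕ) {α : Type} (Ψ Ψ' : List α) : Prop :=
  ∀ u, Ψ'[if c ≤ u then u + 1 else u]? = Ψ[u]?

theorem InsertedAt.cons {α : Type} {c : ℕ} {Ψ Ψ' : List α} (h : InsertedAt c Ψ Ψ') (d : α) :
    InsertedAt (c + 1) (d :: Ψ) (d :: Ψ') := by
  intro u
  cases u with
  | zero => simp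
  | succ u =>
    have := h u
    by_cases hu : c ≤ u
    · simpa [hu] using this
    · simpa [hu] using this

theorem insertedAt_zero {α : Type} (Ψ : List α) (d : α) : InsertedAt 0 Ψ (d :: Ψ) := by
  intro u; simp

theorem Sc.shiftG {M : Tm} : ∀ {Ψ Ψ' : List (Finset LVar)} {X : Set LVar} {k : ℕ} {c : ℕ},
    Sc Ψ X k M → InsertedAt c Ψ Ψ' → Sc Ψ' X k (M.shiftG c) := by
  induction M with
  | lam M ih => intro Ψ Ψ' X k c h hi; exact ih (k := k + 1) h hi
  | recf M ih => intro Ψ Ψ' X k c h hi; exact ih (k := k + 2) h hi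
  | gvar u d δ ih =>
    intro Ψ Ψ' X k c h hi
    exact ⟨(hi u).trans h.1, fun x => ih x (h.2 x) hi⟩
  | unbox u d δ ih => intro Ψ Ψ' X k c h hi; exact ⟨h.1, fun x => ih x (h.2 x) hi⟩
  | app M N ihM ihN => intro Ψ Ψ' X k c h hi; exact ⟨ihM h.1 hi, ihN h.2 hi⟩
  | arith o M N ihM ihN => intro Ψ Ψ' X k c h hi; exact ⟨ihM h.1 hi, ihN h.2 hi⟩
  | assign M N ihM ihN => intro Ψ Ψ' X k c h hi; exact ⟨ihM h.1 hi, ihN h.2 hi⟩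
  | ite M N P ihM ihN ihP =>
    intro Ψ Ψ' X k c h hi; exact ⟨ihM h.1 hi, ihN h.2.1 hi, ihP h.2.2 hi⟩
  | letbox M N ihM ihN =>
    intro Ψ Ψ' X k c h hi
    obtain ⟨h1, d, h2⟩ := h
    exact ⟨ihM h1 hi, d, ihN h2 (hi.cons d)⟩
  | ref M ih => intro Ψ Ψ' X k c h hi; exact ih (k := k) h hi
  | deref M ih => intro Ψ Ψ' X k c h hi; exact ih (k := k) h hi
  | box M ih => intro Ψ Ψ' X k c h hi; exact ih (k := 0) h hi
  | lvar x => intro Ψ Ψ' X k c h hi; exact h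
  | bvar x => intro Ψ Ψ' X k c h hi; exact h
  | _ => intros; trivial

theorem Sc.shiftG_zero {M : Tm} {Ψ : List (Finset LVar)} {X : Set LVar} {k : ℕ} (h : Sc Ψ X k M)
    (d : Finset LVar) : Sc (d :: Ψ) X k (M.shiftG 0) :=
  h.shiftG (insertedAt_zero Ψ d)

theorem Sc.upL {Ψ : List (Finset LVar)} {X : Set LVar} {k k' : ℕ} {β : ℕ → Tm}
    (h : ∀ n < k, Sc Ψ X k' (β n)) : ∀ n < k + 1, Sc Ψ X (k' + 1) (LMML.upL β n) := by
  intro n hn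
  cases n with
  | zero => exact Nat.succ_pos _
  | succ n => exact (h n (by omega)).shiftL 0

theorem Sc.subL {M : Tm} : ∀ {Ψ : List (Finset LVar)} {X X' : Set LVar} {k k' : ℕ}
    {β : ℕ → Tm} {δ : LVar → Tm}, Sc Ψ X k M → (∀ n < k, Sc Ψ X' k' (β n)) →
    (∀ x ∈ X, Sc Ψ X' k' (δ x)) → Sc Ψ X' k' (M.subL β δ) := by
  induction M with
  | bvar n => intro Ψ X X' k k' β δ h hβ hδ; exact hβ n h
  | lvar n => intro Ψ X X' k k' β δ h hβ hδ; exact hδ n h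
  | lam M ih =>
    intro Ψ X X' k k' β δ h hβ hδ
    exact ih (k := k + 1) (k' := k' + 1) h (Sc.upL hβ) (fun x hx => (hδ x hx).shiftL 0)
  | recf M ih =>
    intro Ψ X X' k k' β δ h hβ hδ
    exact ih (k := k + 2) (k' := k' + 2) h (Sc.upL (Sc.upL hβ))
      (fun x hx => ((hδ x hx).shiftL 0).shiftL 0)
  | gvar u d δ' ih =>
    intro Ψ X X' k k' β δ h hβ hδ; exact ⟨h.1, fun x => ih x (h.2 x) hβ hδ⟩
  | unbox u d δ' ih =>
    intro Ψ X X' k k' β δ h hβ hδ; exact ⟨h.1, fun x => ih x (h.2 x) hβ hδ⟩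
  | app M N ihM ihN => intro Ψ X X' k k' β δ h hβ hδ; exact ⟨ihM h.1 hβ hδ, ihN h.2 hβ hδ⟩
  | arith o M N ihM ihN =>
    intro Ψ X X' k k' β δ h hβ hδ; exact ⟨ihM h.1 hβ hδ, ihN h.2 hβ hδ⟩
  | assign M N ihM ihN =>
    intro Ψ X X' k k' β δ h hβ hδ; exact ⟨ihM h.1 hβ hδ, ihN h.2 hβ hδ⟩
  | ite M N P ihM ihN ihP =>
    intro Ψ X X' k k' β δ h hβ hδ; exact ⟨ihM h.1 hβ hδ, ihN h.2.1 hβ hδ, ihP h.2.2 hβ hδ⟩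
  | letbox M N ihM ihN =>
    intro Ψ X X' k k' β δ h hβ hδ
    obtain ⟨h1, d, h2⟩ := h
    exact ⟨ihM h1 hβ hδ, d, ihN h2 (fun n hn => (hβ n hn).shiftG_zero d)
      (fun x hx => (hδ x hx).shiftG_zero d)⟩
  | ref M ih => intro Ψ X X' k k' β δ h hβ hδ; exact ih (k := k) (k' := k') h hβ hδ
  | deref M ih => intro Ψ X X' k k' β δ h hβ hδ; exact ih (k := k) (k' := k') h hβ hδ
  | box M ih => intro Ψ X X' k k' β δ h hβ hδ; exact h
  | _ => intros; trivial

theorem upL_congr {k : ℕ} {β β' : ℕ → Tm} (h : ∀ n < k, β n = β' n) :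
    ∀ n < k + 1, upL β n = upL β' n := by
  intro n hn
  cases n with
  | zero => rfl
  | succ n => simp only [upL]; rw [h n (by omega)]

/-- A term sees a substitution only on its scope. In particular, terms with empty local scope are
fixed by every local substitution (`Sc.subL_closed`). -/
theorem Sc.subL_congr {M : Tm} : ∀ {Ψ : List (Finset LVar)} {X : Set LVar} {k : ℕ}
    {β β' : ℕ → Tm} {δ δ' : LVar → Tm}, Sc Ψ X k M → (∀ n < k, β n = β' n) →
    (∀ x ∈ X, δ x = δ' x) → M.subL β δ = M.subL β' δ' := by
  induction M with
  | bvar n => intro Ψ X k β β' δ δ' h hβ hδ; exact hβ n h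
  | lvar n => intro Ψ X k β β' δ δ' h hβ hδ; exact hδ n h
  | lam M ih =>
    intro Ψ X k β β' δ δ' h hβ hδ
    simp only [Tm.subL]
    rw [ih (k := k + 1) h (upL_congr hβ) (fun x hx => by rw [hδ x hx])]
  | recf M ih =>
    intro Ψ X k β β' δ δ' h hβ hδ
    simp only [Tm.subL]
    rw [ih (k := k + 2) h (upL_congr (upL_congr hβ)) (fun x hx => by rw [hδ x hx])]
  | gvar u d s ih =>
    intro Ψ X k β β' δ δ' h hβ hδ
    simp only [Tm.subL]; congr 1; funext x; exact ih x (h.2 x) hβ hδ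
  | unbox u d s ih =>
    intro Ψ X k β β' δ δ' h hβ hδ
    simp only [Tm.subL]; congr 1; funext x; exact ih x (h.2 x) hβ hδ
  | app M N ihM ihN =>
    intro Ψ X k β β' δ δ' h hβ hδ; simp only [Tm.subL]; rw [ihM h.1 hβ hδ, ihN h.2 hβ hδ]
  | arith o M N ihM ihN =>
    intro Ψ X k β β' δ δ' h hβ hδ; simp only [Tm.subL]; rw [ihM h.1 hβ hδ, ihN h.2 hβ hδ]
  | assign M N ihM ihN =>
    intro Ψ X k β β' δ δ' h hβ hδ; simp only [Tm.subL]; rw [ihM h.1 hβ hδ, ihN h.2 hβ hδ]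
  | ite M N P ihM ihN ihP =>
    intro Ψ X k β β' δ δ' h hβ hδ; simp only [Tm.subL]
    rw [ihM h.1 hβ hδ, ihN h.2.1 hβ hδ, ihP h.2.2 hβ hδ]
  | letbox M N ihM ihN =>
    intro Ψ X k β β' δ δ' h hβ hδ
    simp only [Tm.subL]
    obtain ⟨h1, d, h2⟩ := h
    rw [ihM h1 hβ hδ, ihN h2 (fun n hn => by rw [hβ n hn]) (fun x hx => by rw [hδ x hx])]
  | ref M ih => intro Ψ X k β β' δ δ' h hβ hδ; simp only [Tm.subL]; rw [ih (k := k) h hβ hδ]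
  | deref M ih => intro Ψ X k β β' δ δ' h hβ hδ; simp only [Tm.subL]; rw [ih (k := k) h hβ hδ]
  | _ => intros; rfl

theorem upL_bvar : upL Tm.bvar = Tm.bvar := by
  funext k
  cases k <;> rfl

theorem Tm.subL_id (M : Tm) : M.subL .bvar .lvar = M := by
  induction M with
  | lam M ih => simp only [Tm.subL, upL_bvar]; exact congrArg _ ih
  | recf M ih => simp only [Tm.subL, upL_bvar]; exact congrArg _ ih
  | _ => simp_all [Tm.subL, Tm.shiftG]

theorem Sc.subL_closed {M : Tm} {Ψ : List (Finset LVar)} (h : Sc Ψ ∅ 0 M) (β : ℕ → Tm)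
    (δ : LVar → Tm) : M.subL β δ = M :=
  (h.subL_congr (fun _ hn => absurd hn (Nat.not_lt_zero _)) (fun _ hx => hx.elim)).trans
    M.subL_id

/-- As a substitution of variables, a local shift inherits the laws of `subL`. -/
theorem Tm.shiftL_eq_subL (M : Tm) (c : ℕ) : M.shiftL c = M.subL (fun k => .bvar (skip c k)) .lvar := by
  rw [← Tm.subL_shiftL M c .bvar .lvar, Tm.subL_id]

theorem Sc.shiftL_closed {M : Tm} {Ψ : List (Finset LVar)} (h : Sc Ψ ∅ 0 M) (c : ℕ) :
    M.shiftL c = M := by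
  rw [Tm.shiftL_eq_subL, h.subL_closed]

theorem Sc.shiftG_eq {M : Tm} : ∀ {Ψ : List (Finset LVar)} {X : Set LVar} {k c : ℕ},
    Sc Ψ X k M → Ψ.length ≤ c → M.shiftG c = M := by
  induction M with
  | lam M ih => intro Ψ X k c h hc; simp only [Tm.shiftG]; rw [ih (k := k + 1) h hc]
  | recf M ih => intro Ψ X k c h hc; simp only [Tm.shiftG]; rw [ih (k := k + 2) h hc]
  | gvar u d s ih =>
    intro Ψ X k c h hc
    have := (List.getElem?_eq_some_iff.1 h.1).1
    simp only [Tm.shiftG]; rw [if_neg (by omega)]; congr 1; funext x; exact ih x (h.2 x) hc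
  | unbox u d s ih =>
    intro Ψ X k c h hc
    simp only [Tm.shiftG]; congr 1; funext x; exact ih x (h.2 x) hc
  | app M N ihM ihN => intro Ψ X k c h hc; simp only [Tm.shiftG]; rw [ihM h.1 hc, ihN h.2 hc]
  | arith o M N ihM ihN => intro Ψ X k c h hc; simp only [Tm.shiftG]; rw [ihM h.1 hc, ihN h.2 hc]
  | assign M N ihM ihN => intro Ψ X k c h hc; simp only [Tm.shiftG]; rw [ihM h.1 hc, ihN h.2 hc]
  | ite M N P ihM ihN ihP =>
    intro Ψ X k c h hc; simp only [Tm.shiftG]; rw [ihM h.1 hc, ihN h.2.1 hc, ihP h.2.2 hc]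
  | letbox M N ihM ihN =>
    intro Ψ X k c h hc
    obtain ⟨h1, d, h2⟩ := h
    simp only [Tm.shiftG]; rw [ihM h1 hc, ihN h2 (by simpa using hc)]
  | ref M ih => intro Ψ X k c h hc; simp only [Tm.shiftG]; rw [ih (k := k) h hc]
  | deref M ih => intro Ψ X k c h hc; simp only [Tm.shiftG]; rw [ih (k := k) h hc]
  | box M ih => intro Ψ X k c h hc; simp only [Tm.shiftG]; rw [ih (k := 0) h hc]
  | _ => intros; rfl

theorem upG_var {n : ℕ} {σ : ℕ → Code} (h : ∀ u < n, σ u = .var u) :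
    ∀ u < n + 1, upG σ u = .var u := by
  intro u hu
  cases u with
  | zero => rfl
  | succ u => simp only [upG]; rw [h u (by omega)]; rfl

theorem Sc.subG_eq {M : Tm} : ∀ {Ψ : List (Finset LVar)} {X : Set LVar} {k : ℕ} {σ : ℕ → Code},
    Sc Ψ X k M → (∀ u < Ψ.length, σ u = .var u) → M.subG σ = M := by
  induction M with
  | lam M ih => intro Ψ X k c h hc; simp only [Tm.subG]; rw [ih (k := k + 1) h hc]
  | recf M ih => intro Ψ X k c h hc; simp only [Tm.subG]; rw [ih (k := k + 2) h hc]
  | gvar u d s ih =>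
    intro Ψ X k c h hc
    have := (List.getElem?_eq_some_iff.1 h.1).1
    simp only [Tm.subG]; rw [hc u this, Code.inst]; congr 1; funext x; exact ih x (h.2 x) hc
  | unbox u d s ih =>
    intro Ψ X k c h hc
    simp only [Tm.subG]; congr 1; funext x; exact ih x (h.2 x) hc
  | app M N ihM ihN => intro Ψ X k c h hc; simp only [Tm.subG]; rw [ihM h.1 hc, ihN h.2 hc]
  | arith o M N ihM ihN => intro Ψ X k c h hc; simp only [Tm.subG]; rw [ihM h.1 hc, ihN h.2 hc]
  | assign M N ihM ihN => intro Ψ X k c h hc; simp only [Tm.subG]; rw [ihM h.1 hc, ihN h.2 hc]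
  | ite M N P ihM ihN ihP =>
    intro Ψ X k c h hc; simp only [Tm.subG]; rw [ihM h.1 hc, ihN h.2.1 hc, ihP h.2.2 hc]
  | letbox M N ihM ihN =>
    intro Ψ X k c h hc
    obtain ⟨h1, d, h2⟩ := h
    simp only [Tm.subG]; rw [ihM h1 hc, ihN h2 (by simpa using upG_var hc)]
  | ref M ih => intro Ψ X k c h hc; simp only [Tm.subG]; rw [ih (k := k) h hc]
  | deref M ih => intro Ψ X k c h hc; simp only [Tm.subG]; rw [ih (k := k) h hc]
  | box M ih => intro Ψ X k c h hc; simp only [Tm.subG]; rw [ih (k := 0) h hc]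
  | _ => intros; rfl

/-! ## Instantiation of code -/

/-- The code has its free local variables in `d`. -/
def Code.Ok (d : Finset LVar) : Code → Prop
  | .var _ => True
  | .term N => ∃ Ψ, Sc Ψ (d : Set LVar) 0 N
  | .hash _ => True

theorem LSub.fn_mk_of_mem {d : Finset LVar} (s : {x // x ∈ d} → Tm) {x : LVar} (hx : x ∈ d) :
    LSub.fn ⟨d, s⟩ x = s ⟨x, hx⟩ := by
  simp [LSub.fn, hx]

theorem LSub.fn_mk_of_not_mem {d : Finset LVar} (s : {x // x ∈ d} → Tm) {x : LVar} (hx : x ∉ d) :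
    LSub.fn ⟨d, s⟩ x = .lvar x := by
  simp [LSub.fn, hx]

/-- All free local variables of the code are filled by entries of `s`, so a later substitution acts
on the entries only. It would also hit a free variable outside `d`, which is why scoping has to be
tracked. -/
theorem Code.Ok.subL_inst {d : Finset LVar} {k : Code} (hk : k.Ok d) (s : {x // x ∈ d} → Tm)
    (β : ℕ → Tm) (δ : LVar → Tm) :
    (k.inst ⟨d, s⟩).subL β δ = k.inst ⟨d, fun x => (s x).subL β δ⟩ := by
  cases k with
  | var u => rfl
  | hash b => rfl
  | term N =>
    obtain ⟨Ψ, hN⟩ := hk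
    simp only [Code.inst, Tm.lsub, Tm.subL_subL]
    refine hN.subL_congr (fun n hn => absurd hn (Nat.not_lt_zero _)) (fun x hx => ?_)
    have hx' : x ∈ d := hx
    rw [LSub.fn_mk_of_mem _ hx', LSub.fn_mk_of_mem _ hx']

theorem Code.Ok.shiftL_inst {d : Finset LVar} {k : Code} (hk : k.Ok d) (s : {x // x ∈ d} → Tm)
    (c : ℕ) : (k.inst ⟨d, s⟩).shiftL c = k.inst ⟨d, fun x => (s x).shiftL c⟩ := by
  simp only [Tm.shiftL_eq_subL]
  exact hk.subL_inst s _ _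

/-- Shift the global indices `≥ c` of a code by one. -/
def Code.shiftAt (c : ℕ) : Code → Code
  | .var u => .var (if c ≤ u then u + 1 else u)
  | .term M => .term (M.shiftG c)
  | .hash b => .hash b

theorem Code.shift_eq_shiftAt (k : Code) : k.shift = k.shiftAt 0 := by
  cases k <;> simp [Code.shift, Code.shiftAt]

theorem Code.shiftG_inst (k : Code) {d : Finset LVar} (s : {x // x ∈ d} → Tm) (c : ℕ) :
    (k.inst ⟨d, s⟩).shiftG c = (k.shiftAt c).inst ⟨d, fun x => (s x).shiftG c⟩ := by
  cases k with
  | var u => rfl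
  | hash b => rfl
  | term N =>
    simp only [Code.inst, Tm.lsub, Tm.shiftG_subL, Code.shiftAt]
    congr 1
    funext x
    by_cases hx : x ∈ d
    · rw [LSub.fn_mk_of_mem _ hx, LSub.fn_mk_of_mem _ hx]
    · rw [LSub.fn_mk_of_not_mem _ hx, LSub.fn_mk_of_not_mem _ hx]; rfl

theorem Code.shiftAt_shift (k : Code) (c : ℕ) :
    (k.shiftAt c).shift = (k.shift).shiftAt (c + 1) := by
  cases k with
  | var u => simp only [Code.shiftAt, Code.shift]; congr 1; split_ifs <;> omega
  | hash b => rfl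
  | term N => simp only [Code.shiftAt, Code.shift]; rw [Tm.shiftG_shiftG _ (Nat.zero_le _)]

theorem upG_shiftAt {c : ℕ} {σ σ' : ℕ → Code} (h : ∀ u, σ' (skip c u) = (σ u).shiftAt c) :
    ∀ u, upG σ' (skip (c + 1) u) = (upG σ u).shiftAt (c + 1) := by
  intro u
  cases u with
  | zero => simp [skip, upG, Code.shiftAt]
  | succ u =>
    have : skip (c + 1) (u + 1) = skip c u + 1 := by
      simp only [skip]; split_ifs <;> omega
    rw [this]
    simp only [upG]
    rw [h u, Code.shiftAt_shift]

/-- The relation assumed between `σ` and `σ'` is one that survives passage under `letbox`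
(`upG_shiftAt`). The case of interest is cutoff zero with `σ' = upG σ`. -/
theorem Tm.shiftG_subG_gen (M : Tm) : ∀ {c : ℕ} {σ σ' : ℕ → Code},
    (∀ u, σ' (skip c u) = (σ u).shiftAt c) → (M.shiftG c).subG σ' = (M.subG σ).shiftG c := by
  induction M with
  | gvar u d s ih =>
    intro c σ σ' h
    simp only [Tm.shiftG, Tm.subG]
    rw [Code.shiftG_inst, ← h u]
    simp only [skip]
    congr 2
    funext x; exact ih x h
  | letbox M N ihM ihN =>
    intro c σ σ' h
    simp only [Tm.shiftG, Tm.subG]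
    rw [ihM h, ihN (upG_shiftAt h)]
  | unbox b d s ih => intro c σ σ' h; simp only [Tm.shiftG, Tm.subG]; congr 1; funext x; exact ih x h
  | lam M ih => intro c σ σ' h; simp only [Tm.shiftG, Tm.subG]; rw [ih h]
  | recf M ih => intro c σ σ' h; simp only [Tm.shiftG, Tm.subG]; rw [ih h]
  | ref M ih => intro c σ σ' h; simp only [Tm.shiftG, Tm.subG]; rw [ih h]
  | deref M ih => intro c σ σ' h; simp only [Tm.shiftG, Tm.subG]; rw [ih h]
  | box M ih => intro c σ σ' h; simp only [Tm.shiftG, Tm.subG]; rw [ih h]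
  | app M N ihM ihN => intro c σ σ' h; simp only [Tm.shiftG, Tm.subG]; rw [ihM h, ihN h]
  | arith o M N ihM ihN => intro c σ σ' h; simp only [Tm.shiftG, Tm.subG]; rw [ihM h, ihN h]
  | assign M N ihM ihN => intro c σ σ' h; simp only [Tm.shiftG, Tm.subG]; rw [ihM h, ihN h]
  | ite M N P ihM ihN ihP =>
    intro c σ σ' h; simp only [Tm.shiftG, Tm.subG]; rw [ihM h, ihN h, ihP h]
  | _ => intros; rfl

theorem Tm.shiftG_subG (M : Tm) (σ : ℕ → Code) :
    (M.shiftG 0).subG (upG σ) = (M.subG σ).shiftG 0 := by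
  refine M.shiftG_subG_gen fun u => ?_
  simp only [skip, Nat.zero_le, if_true, upG, Code.shift_eq_shiftAt]

/-- The global substitution respects the domains in `Ψ`. -/
def SubOk (Ψ : List (Finset LVar)) (σ : ℕ → Code) : Prop := ∀ u d, Ψ[u]? = some d → (σ u).Ok d

theorem Code.Ok.shift {d : Finset LVar} {k : Code} (h : k.Ok d) : k.shift.Ok d := by
  cases k with
  | var u => trivial
  | hash b => trivial
  | term N => obtain ⟨Ψ, h⟩ := h; exact ⟨_, h.shiftG_zero ∅⟩

theorem SubOk.upG {Ψ : List (Finset LVar)} {σ : ℕ → Code} (h : SubOk Ψ σ) (d : Finset LVar) :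
    SubOk (d :: Ψ) (upG σ) := by
  intro u e he
  cases u with
  | zero => trivial
  | succ u => exact (h u e (by simpa using he)).shift

/-- At `u^δ`, the code put in place of `u` must have no free local index and no free variable
outside the domain of `δ`; the shift then reaches the entries of `δ` only. -/
theorem Sc.shiftL_subG {M : Tm} : ∀ {Ψ : List (Finset LVar)} {X : Set LVar} {k : ℕ}
    {σ : ℕ → Code} (c : ℕ), Sc Ψ X k M → SubOk Ψ σ →
    (M.shiftL c).subG σ = (M.subG σ).shiftL c := by
  induction M with
  | gvar u d s ih =>
    intro Ψ X k σ c h hσ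
    simp only [Tm.shiftL, Tm.subG]
    rw [(hσ u d h.1).shiftL_inst]
    congr 2; funext x; exact ih x c (h.2 x) hσ
  | letbox M N ihM ihN =>
    intro Ψ X k σ c h hσ
    obtain ⟨h1, d, h2⟩ := h
    simp only [Tm.shiftL, Tm.subG]
    rw [ihM c h1 hσ, ihN c h2 (hσ.upG d)]
  | unbox b d s ih =>
    intro Ψ X k σ c h hσ
    simp only [Tm.shiftL, Tm.subG]; congr 1; funext x; exact ih x c (h.2 x) hσ
  | bvar n => intro Ψ X k σ c h hσ; simp only [Tm.shiftL, Tm.subG]; split_ifs <;> rfl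
  | lam M ih =>
    intro Ψ X k σ c h hσ; simp only [Tm.shiftL, Tm.subG]; rw [ih (k := k + 1) _ h hσ]
  | recf M ih =>
    intro Ψ X k σ c h hσ; simp only [Tm.shiftL, Tm.subG]; rw [ih (k := k + 2) _ h hσ]
  | ref M ih => intro Ψ X k σ c h hσ; simp only [Tm.shiftL, Tm.subG]; rw [ih (k := k) _ h hσ]
  | deref M ih => intro Ψ X k σ c h hσ; simp only [Tm.shiftL, Tm.subG]; rw [ih (k := k) _ h hσ]
  | box M ih => intro Ψ X k σ c h hσ; rfl
  | app M N ihM ihN =>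
    intro Ψ X k σ c h hσ; simp only [Tm.shiftL, Tm.subG]; rw [ihM _ h.1 hσ, ihN _ h.2 hσ]
  | arith o M N ihM ihN =>
    intro Ψ X k σ c h hσ; simp only [Tm.shiftL, Tm.subG]; rw [ihM _ h.1 hσ, ihN _ h.2 hσ]
  | assign M N ihM ihN =>
    intro Ψ X k σ c h hσ; simp only [Tm.shiftL, Tm.subG]; rw [ihM _ h.1 hσ, ihN _ h.2 hσ]
  | ite M N P ihM ihN ihP =>
    intro Ψ X k σ c h hσ; simp only [Tm.shiftL, Tm.subG]
    rw [ihM _ h.1 hσ, ihN _ h.2.1 hσ, ihP _ h.2.2 hσ]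
  | _ => intros; rfl

theorem upL_subG {Ψ : List (Finset LVar)} {β : ℕ → Tm} {σ : ℕ → Code}
    (hβ : ∀ n, ∃ X k, Sc Ψ X k (β n)) (hσ : SubOk Ψ σ) :
    (fun k => (upL β k).subG σ) = upL (fun k => (β k).subG σ) := by
  funext n
  cases n with
  | zero => rfl
  | succ n => obtain ⟨X, k, h⟩ := hβ n; exact h.shiftL_subG 0 hσ

theorem Sc.exists_upL {Ψ : List (Finset LVar)} {β : ℕ → Tm}
    (hβ : ∀ n, ∃ X k, Sc Ψ X k (β n)) : ∀ n, ∃ X k, Sc Ψ X k (LMML.upL β n) := by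
  intro n
  cases n with
  | zero => exact ⟨∅, 1, Nat.one_pos⟩
  | succ n => obtain ⟨X, k, h⟩ := hβ n; exact ⟨X, k + 1, h.shiftL 0⟩

theorem Sc.exists_shiftL {ι : Type} {Ψ : List (Finset LVar)} {δ : ι → Tm}
    (hδ : ∀ n, ∃ X k, Sc Ψ X k (δ n)) : ∀ n, ∃ X k, Sc Ψ X k ((δ n).shiftL 0) :=
  fun n => let ⟨X, k, h⟩ := hδ n; ⟨X, k + 1, h.shiftL 0⟩

theorem Sc.exists_shiftG {ι : Type} {Ψ : List (Finset LVar)} {δ : ι → Tm}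
    (hδ : ∀ n, ∃ X k, Sc Ψ X k (δ n)) (d : Finset LVar) :
    ∀ n, ∃ X k, Sc (d :: Ψ) X k ((δ n).shiftG 0) :=
  fun n => let ⟨X, k, h⟩ := hδ n; ⟨X, k, h.shiftG_zero d⟩

/-- `σ` fixes every global variable of `N`, so it acts only on what is substituted into `N`. The use
is with empty `Ψ₀`, for the code of a name. -/
theorem Sc.subL_subG {N : Tm} : ∀ {Ψ₀ Ψ : List (Finset LVar)} {X : Set LVar} {k : ℕ}
    {σ : ℕ → Code} {β : ℕ → Tm} {δ : LVar → Tm}, Sc Ψ₀ X k N →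
    (∀ u < Ψ₀.length, σ u = .var u) → SubOk Ψ σ →
    (∀ n, ∃ X k, Sc Ψ X k (β n)) → (∀ x, ∃ X k, Sc Ψ X k (δ x)) →
    (N.subL β δ).subG σ = N.subL (fun n => (β n).subG σ) (fun x => (δ x).subG σ) := by
  induction N with
  | gvar u d s ih =>
    intro Ψ₀ Ψ X k σ β δ h hv hσ hβ hδ
    have := (List.getElem?_eq_some_iff.1 h.1).1
    simp only [Tm.subL, Tm.subG]; rw [hv u this, Code.inst]
    congr 1; funext x; exact ih x (h.2 x) hv hσ hβ hδ
  | letbox M N ihM ihN =>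
    intro Ψ₀ Ψ X k σ β δ h hv hσ hβ hδ
    obtain ⟨h1, d, h2⟩ := h
    simp only [Tm.subL, Tm.subG]
    rw [ihM h1 hv hσ hβ hδ, ihN (Ψ := d :: Ψ) h2 (by simpa using upG_var hv) (hσ.upG d)
      (Sc.exists_shiftG hβ d) (Sc.exists_shiftG hδ d)]
    simp only [Tm.shiftG_subG]
  | unbox b d s ih =>
    intro Ψ₀ Ψ X k σ β δ h hv hσ hβ hδ
    simp only [Tm.subL, Tm.subG]
    congr 1; funext x; exact ih x (h.2 x) hv hσ hβ hδ
  | lam M ih =>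
    intro Ψ₀ Ψ X k σ β δ h hv hσ hβ hδ
    simp only [Tm.subL, Tm.subG]
    rw [ih (k := k + 1) h hv hσ (Sc.exists_upL hβ) (Sc.exists_shiftL hδ), upL_subG hβ hσ]
    congr 2; funext x; obtain ⟨X, k, hx⟩ := hδ x; exact hx.shiftL_subG 0 hσ
  | recf M ih =>
    intro Ψ₀ Ψ X k σ β δ h hv hσ hβ hδ
    simp only [Tm.subL, Tm.subG]
    rw [ih (k := k + 2) h hv hσ (Sc.exists_upL (Sc.exists_upL hβ))
      (Sc.exists_shiftL (Sc.exists_shiftL hδ)), upL_subG (Sc.exists_upL hβ) hσ, upL_subG hβ hσ]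
    congr 2; funext x; obtain ⟨X, k, hx⟩ := hδ x
    rw [(hx.shiftL 0).shiftL_subG 0 hσ, hx.shiftL_subG 0 hσ]
  | box M ih =>
    intro Ψ₀ Ψ X k σ β δ h hv hσ hβ hδ
    exact Sc.subG_eq (M := .box M) (X := X) (k := k) h hv
  | ref M ih =>
    intro Ψ₀ Ψ X k σ β δ h hv hσ hβ hδ; simp only [Tm.subL, Tm.subG]
    rw [ih (k := k) h hv hσ hβ hδ]
  | deref M ih =>
    intro Ψ₀ Ψ X k σ β δ h hv hσ hβ hδ; simp only [Tm.subL, Tm.subG]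
    rw [ih (k := k) h hv hσ hβ hδ]
  | app M N ihM ihN =>
    intro Ψ₀ Ψ X k σ β δ h hv hσ hβ hδ; simp only [Tm.subL, Tm.subG]
    rw [ihM h.1 hv hσ hβ hδ, ihN h.2 hv hσ hβ hδ]
  | arith o M N ihM ihN =>
    intro Ψ₀ Ψ X k σ β δ h hv hσ hβ hδ; simp only [Tm.subL, Tm.subG]
    rw [ihM h.1 hv hσ hβ hδ, ihN h.2 hv hσ hβ hδ]
  | assign M N ihM ihN =>
    intro Ψ₀ Ψ X k σ β δ h hv hσ hβ hδ; simp only [Tm.subL, Tm.subG]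
    rw [ihM h.1 hv hσ hβ hδ, ihN h.2 hv hσ hβ hδ]
  | ite M N P ihM ihN ihP =>
    intro Ψ₀ Ψ X k σ β δ h hv hσ hβ hδ; simp only [Tm.subL, Tm.subG]
    rw [ihM h.1 hv hσ hβ hδ, ihN h.2.1 hv hσ hβ hδ, ihP h.2.2 hv hσ hβ hδ]
  | _ => intros; rfl

/-! ## Concretization -/

/-- The code denoted by `#b` when names stand for the values given by `c`. -/
def codeOf (c : Name → Tm) (b : Name) : Code := (c b).code.getD (.hash b)

/-- Rename the locations by `r` and replace the names by the values that they stand for. -/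
def conc (r : Loc → Loc) (c : Name → Tm) : Tm → Tm
  | .unit => .unit
  | .num n => .num n
  | .bvar k => .bvar k
  | .lvar x => .lvar x
  | .gvar u d δ => .gvar u d (fun x => conc r c (δ x))
  | .loc l => .loc (r l)
  | .lam M => .lam (conc r c M)
  | .app M N => .app (conc r c M) (conc r c N)
  | .recf M => .recf (conc r c M)
  | .arith o M N => .arith o (conc r c M) (conc r c N)
  | .ite M N P => .ite (conc r c M) (conc r c N) (conc r c P)
  | .ref M => .ref (conc r c M)
  | .deref M => .deref (conc r c M)
  | .assign M N => .assign (conc r c M) (conc r c N)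
  | .box M => .box (conc r c M)
  | .letbox M N => .letbox (conc r c M) (conc r c N)
  | .name n => c n
  | .unbox b d δ => (codeOf c b).inst ⟨d, fun x => conc r c (δ x)⟩

def concCode (r : Loc → Loc) (c : Name → Tm) : Code → Code
  | .var u => .var u
  | .term M => .term (conc r c M)
  | .hash b => codeOf c b

/-- Names stand for closed values other than names; the code named by a box name is open in the
variables of its context only. -/
structure GoodEnv (c : Name → Tm) : Prop where
  value : ∀ n, (c n).IsValue
  closed : ∀ n, Sc [] ∅ 0 (c n)
  box : ∀ n N, c n = .box N → Sc [] (n.dom : Set LVar) 0 N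
  not_name : ∀ n m, c n ≠ .name m

/-- A value other than a box makes `codeOf` fall back on its default, which leaves `#b` in place. -/
theorem GoodEnv.codeOf_cases {c : Name → Tm} (hc : GoodEnv c) (b : Name) :
    codeOf c b = .hash b ∨ ∃ N, c b = .box N ∧ codeOf c b = .term N ∧
      Sc [] (b.dom : Set LVar) 0 N := by
  unfold codeOf
  cases h : c b with
  | box N => exact Or.inr ⟨N, rfl, rfl, hc.box b N h⟩
  | name m => exact absurd h (hc.not_name b m)
  | _ => exact Or.inl rfl

theorem GoodEnv.codeOf_ok {c : Name → Tm} (hc : GoodEnv c) (b : Name) :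
    (codeOf c b).Ok b.dom := by
  rcases hc.codeOf_cases b with h | ⟨N, -, h, hN⟩ <;> rw [h]
  · trivial
  · exact ⟨_, hN⟩

theorem GoodEnv.codeOf_shiftAt {c : Name → Tm} (hc : GoodEnv c) (b : Name) (k : ℕ) :
    (codeOf c b).shiftAt k = codeOf c b := by
  rcases hc.codeOf_cases b with h | ⟨N, -, h, hN⟩ <;> rw [h]
  · rfl
  · simp only [Code.shiftAt]; rw [hN.shiftG_eq (Nat.zero_le _)]

theorem conc_isValue {r : Loc → Loc} {c : Name → Tm} (hc : GoodEnv c) {V : Tm} (h : V.IsValue) :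
    (conc r c V).IsValue := by
  cases V with
  | name n => exact hc.value n
  | _ => trivial

/-- The code of `b` may itself be a value, so `#b^δ`, which is not a value, can become one. No other
term can. -/
theorem conc_isValue_inv {r : Loc → Loc} {c : Name → Tm} {V : Tm}
    (h : (conc r c V).IsValue) : V.IsValue ∨ ∃ b d s, V = .unbox b d s := by
  cases V with
  | unbox b d s => exact Or.inr ⟨b, d, s, rfl⟩
  | _ => first | exact Or.inl trivial | exact h.elim

/-- At `#b^δ` the shift has to pass through the instantiated code. Scoping makes the domain of `δ`
the context of `b`, so that it can. -/
theorem conc_shiftL {r : Loc → Loc} {c : Name → Tm} (hc : GoodEnv c) {M : Tm} :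
    ∀ {Ψ : List (Finset LVar)} {X : Set LVar} {k : ℕ} (n : ℕ), Sc Ψ X k M →
    conc r c (M.shiftL n) = (conc r c M).shiftL n := by
  induction M with
  | bvar k => intro Ψ X k n h; simp only [Tm.shiftL, conc]; split_ifs <;> rfl
  | name m => intro Ψ X k n h; exact ((hc.closed m).shiftL_closed n).symm
  | gvar u d s ih =>
    intro Ψ X k n h
    simp only [Tm.shiftL, conc]; congr 1; funext x; exact ih x n (h.2 x)
  | unbox b d s ih =>
    intro Ψ X k n h
    obtain ⟨rfl, h⟩ := h
    simp only [Tm.shiftL, conc]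
    rw [(hc.codeOf_ok b).shiftL_inst]
    congr 2; funext x; exact ih x n (h x)
  | lam M ih => intro Ψ X k n h; simp only [Tm.shiftL, conc]; rw [ih (k := k + 1) _ h]
  | recf M ih => intro Ψ X k n h; simp only [Tm.shiftL, conc]; rw [ih (k := k + 2) _ h]
  | ref M ih => intro Ψ X k n h; simp only [Tm.shiftL, conc]; rw [ih (k := k) _ h]
  | deref M ih => intro Ψ X k n h; simp only [Tm.shiftL, conc]; rw [ih (k := k) _ h]
  | app M N ihM ihN => intro Ψ X k n h; simp only [Tm.shiftL, conc]; rw [ihM _ h.1, ihN _ h.2]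
  | arith o M N ihM ihN => intro Ψ X k n h; simp only [Tm.shiftL, conc]; rw [ihM _ h.1, ihN _ h.2]
  | assign M N ihM ihN => intro Ψ X k n h; simp only [Tm.shiftL, conc]; rw [ihM _ h.1, ihN _ h.2]
  | ite M N P ihM ihN ihP =>
    intro Ψ X k n h; simp only [Tm.shiftL, conc]; rw [ihM _ h.1, ihN _ h.2.1, ihP _ h.2.2]
  | letbox M N ihM ihN =>
    intro Ψ X k n h; simp only [Tm.shiftL, conc]; obtain ⟨h1, d, h2⟩ := h; rw [ihM _ h1, ihN _ h2]
  | _ => intros; rfl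

/-- In contrast to `conc_shiftL`, no scoping is needed: the code of a name has no global variable,
so weakening leaves it alone. -/
theorem conc_shiftG {r : Loc → Loc} {c : Name → Tm} (hc : GoodEnv c) (M : Tm) :
    ∀ (n : ℕ), conc r c (M.shiftG n) = (conc r c M).shiftG n := by
  induction M with
  | name m => intro n; exact ((hc.closed m).shiftG_eq (Nat.zero_le _)).symm
  | unbox b d s ih =>
    intro n
    simp only [Tm.shiftG, conc]
    rw [Code.shiftG_inst, hc.codeOf_shiftAt]
    congr 2; funext x; exact ih x n
  | _ => intros; simp_all [Tm.shiftG, conc]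

/-- Scoped in some contexts. -/
def SomeSc (M : Tm) : Prop := ∃ Ψ X k, Sc Ψ X k M

theorem SomeSc.shiftL {M : Tm} (h : SomeSc M) (n : ℕ) : SomeSc (M.shiftL n) :=
  let ⟨Ψ, X, k, h⟩ := h; ⟨Ψ, X, k + 1, h.shiftL n⟩

theorem SomeSc.shiftG {M : Tm} (h : SomeSc M) : SomeSc (M.shiftG 0) :=
  let ⟨Ψ, X, k, h⟩ := h; ⟨∅ :: Ψ, X, k, h.shiftG_zero ∅⟩

theorem SomeSc.upL {β : ℕ → Tm} (h : ∀ n, SomeSc (β n)) : ∀ n, SomeSc (LMML.upL β n) := by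
  intro n
  cases n with
  | zero => exact ⟨[], ∅, 1, Nat.one_pos⟩
  | succ n => exact (h n).shiftL 0

theorem conc_upL {r : Loc → Loc} {c : Name → Tm} (hc : GoodEnv c) {β : ℕ → Tm}
    (h : ∀ n, SomeSc (β n)) :
    (fun n => conc r c (upL β n)) = upL (fun n => conc r c (β n)) := by
  funext n
  cases n with
  | zero => rfl
  | succ n => obtain ⟨Ψ, X, k, h⟩ := h n; exact conc_shiftL hc 0 h

theorem conc_shiftL' {r : Loc → Loc} {c : Name → Tm} (hc : GoodEnv c) {M : Tm} (h : SomeSc M)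
    (n : ℕ) : conc r c (M.shiftL n) = (conc r c M).shiftL n :=
  let ⟨_, _, _, h⟩ := h; conc_shiftL hc n h

/-- Names stand for closed values, which substitution does not affect, and the code of a box name
absorbs the substitution into its entries (`Code.Ok.subL_inst`). Hence a `β`-step can be made before
or after concretization. The terms substituted need some scope because they are shifted under
binders. -/
theorem conc_subL {r : Loc → Loc} {c : Name → Tm} (hc : GoodEnv c) {M : Tm} :
    ∀ {Ψ : List (Finset LVar)} {X : Set LVar} {k : ℕ} {β : ℕ → Tm} {δ : LVar → Tm}, Sc Ψ X k M →
    (∀ n, SomeSc (β n)) → (∀ x, SomeSc (δ x)) →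
    conc r c (M.subL β δ) = (conc r c M).subL (fun n => conc r c (β n)) (fun x => conc r c (δ x)) := by
  induction M with
  | name m => intro Ψ X k β δ h hβ hδ; exact ((hc.closed m).subL_closed _ _).symm
  | gvar u d s ih =>
    intro Ψ X k β δ h hβ hδ
    simp only [Tm.subL, conc]; congr 1; funext x; exact ih x (h.2 x) hβ hδ
  | unbox b d s ih =>
    intro Ψ X k β δ h hβ hδ
    obtain ⟨rfl, h⟩ := h
    simp only [Tm.subL, conc]
    rw [(hc.codeOf_ok b).subL_inst]
    congr 2; funext x; exact ih x (h x) hβ hδ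
  | lam M ih =>
    intro Ψ X k β δ h hβ hδ; simp only [Tm.subL, conc]
    rw [ih (k := k + 1) h (SomeSc.upL hβ) (fun x => (hδ x).shiftL 0), conc_upL hc hβ]
    congr 2; funext x; exact conc_shiftL' hc (hδ x) 0
  | recf M ih =>
    intro Ψ X k β δ h hβ hδ; simp only [Tm.subL, conc]
    rw [ih (k := k + 2) h (SomeSc.upL (SomeSc.upL hβ)) (fun x => ((hδ x).shiftL 0).shiftL 0),
      conc_upL hc (SomeSc.upL hβ), conc_upL hc hβ]
    congr 2; funext x; rw [conc_shiftL' hc ((hδ x).shiftL 0) 0, conc_shiftL' hc (hδ x) 0]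
  | ref M ih =>
    intro Ψ X k β δ h hβ hδ; simp only [Tm.subL, conc]; rw [ih (k := k) h hβ hδ]
  | deref M ih =>
    intro Ψ X k β δ h hβ hδ; simp only [Tm.subL, conc]; rw [ih (k := k) h hβ hδ]
  | app M N ihM ihN =>
    intro Ψ X k β δ h hβ hδ; simp only [Tm.subL, conc]; rw [ihM h.1 hβ hδ, ihN h.2 hβ hδ]
  | arith o M N ihM ihN =>
    intro Ψ X k β δ h hβ hδ; simp only [Tm.subL, conc]; rw [ihM h.1 hβ hδ, ihN h.2 hβ hδ]
  | assign M N ihM ihN =>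
    intro Ψ X k β δ h hβ hδ; simp only [Tm.subL, conc]; rw [ihM h.1 hβ hδ, ihN h.2 hβ hδ]
  | ite M N P ihM ihN ihP =>
    intro Ψ X k β δ h hβ hδ; simp only [Tm.subL, conc]
    rw [ihM h.1 hβ hδ, ihN h.2.1 hβ hδ, ihP h.2.2 hβ hδ]
  | letbox M N ihM ihN =>
    intro Ψ X k β δ h hβ hδ; simp only [Tm.subL, conc]
    obtain ⟨h1, d, h2⟩ := h
    rw [ihM h1 hβ hδ, ihN h2 (fun n => (hβ n).shiftG) (fun x => (hδ x).shiftG)]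
    simp only [conc_shiftG hc]
  | _ => intros; rfl

theorem conc_fn (r : Loc → Loc) (c : Name → Tm) (δ : LSub) :
    (fun x => conc r c (δ.fn x)) = LSub.fn ⟨δ.dom, fun x => conc r c (δ.val x)⟩ := by
  funext x
  by_cases hx : x ∈ δ.dom
  · simp [LSub.fn, hx]
  · simp [LSub.fn, hx, conc]

theorem SomeSc.bvar (n : ℕ) : SomeSc (.bvar n) := ⟨[], ∅, n + 1, Nat.lt_succ_self n⟩

theorem SomeSc.lvar (x : LVar) : SomeSc (.lvar x) := ⟨[], {x}, 0, rfl⟩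

theorem SomeSc.fn {δ : LSub} (h : ∀ x, SomeSc (δ.val x)) (x : LVar) : SomeSc (δ.fn x) := by
  unfold LSub.fn
  split_ifs
  · exact h _
  · exact SomeSc.lvar x

theorem conc_lsub {r : Loc → Loc} {c : Name → Tm} (hc : GoodEnv c) {M : Tm} {δ : LSub}
    (h : SomeSc M) (hδ : ∀ x, SomeSc (δ.val x)) :
    conc r c (M.lsub δ) = (conc r c M).lsub ⟨δ.dom, fun x => conc r c (δ.val x)⟩ := by
  obtain ⟨Ψ, X, k, h⟩ := h
  unfold Tm.lsub
  rw [conc_subL hc h SomeSc.bvar (SomeSc.fn hδ), conc_fn]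
  rfl

/-- Scoped code. -/
def Code.SomeSc : Code → Prop
  | .term M => LMML.SomeSc M
  | _ => True

theorem conc_inst {r : Loc → Loc} {c : Name → Tm} (hc : GoodEnv c) {k : Code} {δ : LSub}
    (h : k.SomeSc) (hδ : ∀ x, SomeSc (δ.val x)) :
    conc r c (k.inst δ) = (concCode r c k).inst ⟨δ.dom, fun x => conc r c (δ.val x)⟩ := by
  cases k with
  | var u => rfl
  | hash b => rfl
  | term M => exact conc_lsub hc h hδ

theorem concCode_shift {r : Loc → Loc} {c : Name → Tm} (hc : GoodEnv c) (k : Code) :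
    concCode r c k.shift = (concCode r c k).shift := by
  cases k with
  | var u => rfl
  | hash b => exact ((Code.shift_eq_shiftAt _).trans (hc.codeOf_shiftAt b 0)).symm
  | term M => simp only [Code.shift, concCode]; rw [conc_shiftG hc]

theorem concCode_upG {r : Loc → Loc} {c : Name → Tm} (hc : GoodEnv c) (σ : ℕ → Code) :
    (fun u => concCode r c (upG σ u)) = upG (fun u => concCode r c (σ u)) := by
  funext u
  cases u with
  | zero => rfl
  | succ u => exact concCode_shift hc _

theorem Sc.conc {r : Loc → Loc} {c : Name → Tm} (hc : GoodEnv c) {M : Tm} :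
    ∀ {Ψ : List (Finset LVar)} {X : Set LVar} {k : ℕ}, Sc Ψ X k M → Sc Ψ X k (conc r c M) := by
  induction M with
  | name m => intro Ψ X k h; exact (hc.closed m).of_closed _ _ _
  | gvar u d s ih => intro Ψ X k h; exact ⟨h.1, fun x => ih x (h.2 x)⟩
  | unbox b d s ih =>
    intro Ψ X k h
    obtain ⟨rfl, h⟩ := h
    simp only [LMML.conc]
    rcases hc.codeOf_cases b with hb | ⟨N, -, hb, hN⟩ <;> rw [hb]
    · exact ⟨rfl, fun x => ih x (h x)⟩
    · refine Sc.subL (hN.mono (List.nil_prefix) subset_rfl le_rfl)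
        (fun n hn => absurd hn (Nat.not_lt_zero _)) (fun x hx => ?_)
      rw [LSub.fn_mk_of_mem _ hx]
      exact ih _ (h _)
  | lam M ih => intro Ψ X k h; exact ih (k := k + 1) h
  | recf M ih => intro Ψ X k h; exact ih (k := k + 2) h
  | app M N ihM ihN => intro Ψ X k h; exact ⟨ihM h.1, ihN h.2⟩
  | arith o M N ihM ihN => intro Ψ X k h; exact ⟨ihM h.1, ihN h.2⟩
  | assign M N ihM ihN => intro Ψ X k h; exact ⟨ihM h.1, ihN h.2⟩
  | ite M N P ihM ihN ihP => intro Ψ X k h; exact ⟨ihM h.1, ihN h.2.1, ihP h.2.2⟩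
  | ref M ih => intro Ψ X k h; exact ih (k := k) h
  | deref M ih => intro Ψ X k h; exact ih (k := k) h
  | box M ih => intro Ψ X k h; exact ih (k := 0) h
  | letbox M N ihM ihN => intro Ψ X k h; obtain ⟨h1, d, h2⟩ := h; exact ⟨ihM h1, d, ihN h2⟩
  | bvar n => intro Ψ X k h; exact h
  | lvar n => intro Ψ X k h; exact h
  | _ => intros; trivial

/-- Code scoped in `Ψ` whose free local variables are in `d`. -/
def Code.Sc (Ψ : List (Finset LVar)) (d : Finset LVar) : Code → Prop
  | .var u => Ψ[u]? = some d
  | .term N => LMML.Sc Ψ (d : Set LVar) 0 N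
  | .hash b => d = b.dom

theorem Code.Sc.inst {Ψ : List (Finset LVar)} {d : Finset LVar} {k : Code} (hk : k.Sc Ψ d)
    {X : Set LVar} {n : ℕ} {s : {x // x ∈ d} → Tm} (hs : ∀ x, LMML.Sc Ψ X n (s x)) :
    LMML.Sc Ψ X n (k.inst ⟨d, s⟩) := by
  cases k with
  | var u => exact ⟨hk, hs⟩
  | hash b => exact ⟨hk, hs⟩
  | term N =>
    refine LMML.Sc.subL hk (fun n hn => absurd hn (Nat.not_lt_zero _)) (fun x hx => ?_)
    rw [LSub.fn_mk_of_mem _ hx]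
    exact hs _

/-- `σ` maps the global variables in `Ψ` to code scoped in `Ψ'`. -/
def SubSc (Ψ Ψ' : List (Finset LVar)) (σ : ℕ → Code) : Prop :=
  ∀ u d, Ψ[u]? = some d → (σ u).Sc Ψ' d

theorem SubSc.upG {Ψ Ψ' : List (Finset LVar)} {σ : ℕ → Code} (h : SubSc Ψ Ψ' σ)
    (d : Finset LVar) : SubSc (d :: Ψ) (d :: Ψ') (LMML.upG σ) := by
  intro u e he
  cases u with
  | zero => exact he
  | succ u =>
    have := h u e (by simpa using he)
    simp only [LMML.upG]
    cases hu : σ u with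
    | var v => rw [hu] at this; exact (List.getElem?_cons_succ).trans this
    | hash b => rw [hu] at this; exact this
    | term N => rw [hu] at this; exact LMML.Sc.shiftG_zero this d

theorem Sc.subG {M : Tm} : ∀ {Ψ Ψ' : List (Finset LVar)} {X : Set LVar} {k : ℕ} {σ : ℕ → Code},
    Sc Ψ X k M → SubSc Ψ Ψ' σ → Sc Ψ' X k (M.subG σ) := by
  induction M with
  | gvar u d s ih =>
    intro Ψ Ψ' X k σ h hσ
    exact (hσ u d h.1).inst (fun x => ih x (h.2 x) hσ)
  | unbox b d s ih => intro Ψ Ψ' X k σ h hσ; exact ⟨h.1, fun x => ih x (h.2 x) hσ⟩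
  | lam M ih => intro Ψ Ψ' X k σ h hσ; exact ih (k := k + 1) h hσ
  | recf M ih => intro Ψ Ψ' X k σ h hσ; exact ih (k := k + 2) h hσ
  | app M N ihM ihN => intro Ψ Ψ' X k σ h hσ; exact ⟨ihM h.1 hσ, ihN h.2 hσ⟩
  | arith o M N ihM ihN => intro Ψ Ψ' X k σ h hσ; exact ⟨ihM h.1 hσ, ihN h.2 hσ⟩
  | assign M N ihM ihN => intro Ψ Ψ' X k σ h hσ; exact ⟨ihM h.1 hσ, ihN h.2 hσ⟩
  | ite M N P ihM ihN ihP =>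
    intro Ψ Ψ' X k σ h hσ; exact ⟨ihM h.1 hσ, ihN h.2.1 hσ, ihP h.2.2 hσ⟩
  | ref M ih => intro Ψ Ψ' X k σ h hσ; exact ih (k := k) h hσ
  | deref M ih => intro Ψ Ψ' X k σ h hσ; exact ih (k := k) h hσ
  | box M ih => intro Ψ Ψ' X k σ h hσ; exact ih (k := 0) h hσ
  | letbox M N ihM ihN =>
    intro Ψ Ψ' X k σ h hσ; obtain ⟨h1, d, h2⟩ := h; exact ⟨ihM h1 hσ, d, ihN h2 (hσ.upG d)⟩
  | bvar n => intro Ψ Ψ' X k σ h hσ; exact h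
  | lvar n => intro Ψ Ψ' X k σ h hσ; exact h
  | _ => intros; trivial

theorem SubSc.concCode {r : Loc → Loc} {c : Name → Tm} (hc : GoodEnv c)
    {Ψ Ψ' : List (Finset LVar)} {σ : ℕ → Code} (h : SubSc Ψ Ψ' σ) :
    SubOk Ψ (fun u => concCode r c (σ u)) := by
  intro u d hu
  have := h u d hu
  change Code.Ok d (LMML.concCode r c (σ u))
  cases hs : σ u with
  | var v => trivial
  | hash b => rw [hs] at this; cases this; exact hc.codeOf_ok b
  | term N => rw [hs] at this; exact ⟨_, LMML.Sc.conc hc this⟩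

/-- At `u^δ` this is `conc_inst`. At `#b^δ` the substitution has to pass through the code of `b`,
which is globally closed, and only reaches the entries of `δ` (`Sc.subL_subG`). -/
theorem conc_subG {r : Loc → Loc} {c : Name → Tm} (hc : GoodEnv c) {M : Tm} :
    ∀ {Ψ Ψ' : List (Finset LVar)} {X : Set LVar} {k : ℕ} {σ : ℕ → Code}, Sc Ψ X k M →
    SubSc Ψ Ψ' σ →
    conc r c (M.subG σ) = (conc r c M).subG (fun u => concCode r c (σ u)) := by
  induction M with
  | name m =>
    intro Ψ Ψ' X k σ h hσ
    exact ((hc.closed m).subG_eq (fun u hu => absurd hu (Nat.not_lt_zero _))).symm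
  | gvar u d s ih =>
    intro Ψ Ψ' X k σ h hσ
    obtain ⟨h1, h2⟩ := h
    simp only [Tm.subG, LMML.conc]
    rw [conc_inst hc]
    · congr 2; funext x; exact ih x (h2 x) hσ
    · have := hσ u d h1
      cases hu : σ u with
      | term N => rw [hu] at this; exact ⟨_, _, _, this⟩
      | _ => trivial
    · exact fun x => ⟨_, _, _, (h2 x).subG hσ⟩
  | unbox b d s ih =>
    intro Ψ Ψ' X k σ h hσ
    obtain ⟨rfl, h⟩ := h
    simp only [Tm.subG, LMML.conc]
    have hs := fun x => ih x (h x) hσ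
    simp only [hs]
    rcases hc.codeOf_cases b with hb | ⟨N, -, hb, hN⟩ <;> rw [hb]
    · rfl
    · simp only [Code.inst, Tm.lsub]
      rw [hN.subL_subG (Ψ := Ψ) (fun u hu => absurd hu (Nat.not_lt_zero _)) (hσ.concCode hc)]
      · refine hN.subL_congr (fun n hn => absurd hn (Nat.not_lt_zero _)) (fun x hx => ?_)
        rw [LSub.fn_mk_of_mem _ hx, LSub.fn_mk_of_mem _ hx]
      · exact fun n => ⟨∅, n + 1, Nat.lt_succ_self n⟩
      · intro x
        by_cases hx : x ∈ b.dom
        · rw [LSub.fn_mk_of_mem _ hx]; exact ⟨_, _, (h _).conc hc⟩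
        · rw [LSub.fn_mk_of_not_mem _ hx]; exact ⟨{x}, 0, rfl⟩
  | lam M ih =>
    intro Ψ Ψ' X k σ h hσ; simp only [Tm.subG, LMML.conc]; rw [ih (k := k + 1) h hσ]
  | recf M ih =>
    intro Ψ Ψ' X k σ h hσ; simp only [Tm.subG, LMML.conc]; rw [ih (k := k + 2) h hσ]
  | ref M ih => intro Ψ Ψ' X k σ h hσ; simp only [Tm.subG, LMML.conc]; rw [ih (k := k) h hσ]
  | deref M ih => intro Ψ Ψ' X k σ h hσ; simp only [Tm.subG, LMML.conc]; rw [ih (k := k) h hσ]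
  | box M ih => intro Ψ Ψ' X k σ h hσ; simp only [Tm.subG, LMML.conc]; rw [ih (k := 0) h hσ]
  | app M N ihM ihN =>
    intro Ψ Ψ' X k σ h hσ; simp only [Tm.subG, LMML.conc]; rw [ihM h.1 hσ, ihN h.2 hσ]
  | arith o M N ihM ihN =>
    intro Ψ Ψ' X k σ h hσ; simp only [Tm.subG, LMML.conc]; rw [ihM h.1 hσ, ihN h.2 hσ]
  | assign M N ihM ihN =>
    intro Ψ Ψ' X k σ h hσ; simp only [Tm.subG, LMML.conc]; rw [ihM h.1 hσ, ihN h.2 hσ]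
  | ite M N P ihM ihN ihP =>
    intro Ψ Ψ' X k σ h hσ; simp only [Tm.subG, LMML.conc]
    rw [ihM h.1 hσ, ihN h.2.1 hσ, ihP h.2.2 hσ]
  | letbox M N ihM ihN =>
    intro Ψ Ψ' X k σ h hσ; simp only [Tm.subG, LMML.conc]
    obtain ⟨h1, d, h2⟩ := h
    rw [ihM h1 hσ, ihN h2 (hσ.upG d), concCode_upG hc]
  | _ => intros; rfl

/-! ## Occurrences of names and locations -/

/-- The names of the term are in `PN`, the locations in `PL`. -/
def Occ (PN : Set Name) (PL : Set Loc) : Tm → Prop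
  | .unit | .num _ | .bvar _ | .lvar _ => True
  | .gvar _ _ δ => ∀ x, Occ PN PL (δ x)
  | .loc l => l ∈ PL
  | .lam M | .recf M | .ref M | .deref M | .box M => Occ PN PL M
  | .app M N | .arith _ M N | .assign M N | .letbox M N => Occ PN PL M ∧ Occ PN PL N
  | .ite M N P => Occ PN PL M ∧ Occ PN PL N ∧ Occ PN PL P
  | .name n => n ∈ PN
  | .unbox b _ δ => b ∈ PN ∧ ∀ x, Occ PN PL (δ x)

def Code.Occ (PN : Set Name) (PL : Set Loc) : Code → Prop
  | .var _ => True
  | .term M => LMML.Occ PN PL M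
  | .hash b => b ∈ PN

section

variable {PN PN' : Set Name} {PL PL' : Set Loc}

theorem Occ.mono {M : Tm} (h : Occ PN PL M) (hN : PN ⊆ PN') (hL : PL ⊆ PL') :
    Occ PN' PL' M := by
  induction M with
  | loc l => exact hL h
  | name n => exact hN h
  | unbox b d s ih => exact ⟨hN h.1, fun x => ih x (h.2 x)⟩
  | gvar u d s ih => exact fun x => ih x (h x)
  | _ => simp_all [Occ]

theorem Occ.shiftL {M : Tm} (h : Occ PN PL M) : ∀ c, Occ PN PL (M.shiftL c) := by
  induction M with
  | bvar n => intro c; simp only [Tm.shiftL]; split_ifs <;> trivial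
  | _ => intro c; simp_all [Occ, Tm.shiftL]

theorem Occ.shiftG {M : Tm} (h : Occ PN PL M) : ∀ c, Occ PN PL (M.shiftG c) := by
  induction M with
  | _ => intro c; simp_all [Occ, Tm.shiftG]

theorem Occ.upL {β : ℕ → Tm} (h : ∀ n, Occ PN PL (β n)) : ∀ n, Occ PN PL (LMML.upL β n) := by
  intro n
  cases n with
  | zero => trivial
  | succ n => exact (h n).shiftL 0

theorem Occ.subL {M : Tm} (h : Occ PN PL M) : ∀ {β : ℕ → Tm} {δ : LVar → Tm},
    (∀ n, Occ PN PL (β n)) → (∀ x, Occ PN PL (δ x)) → Occ PN PL (M.subL β δ) := by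
  induction M with
  | bvar n => intro β δ hβ hδ; exact hβ n
  | lvar n => intro β δ hβ hδ; exact hδ n
  | lam M ih => intro β δ hβ hδ; exact ih h (Occ.upL hβ) (fun x => (hδ x).shiftL 0)
  | recf M ih =>
    intro β δ hβ hδ
    exact ih h (Occ.upL (Occ.upL hβ)) (fun x => ((hδ x).shiftL 0).shiftL 0)
  | letbox M N ihM ihN =>
    intro β δ hβ hδ
    exact ⟨ihM h.1 hβ hδ, ihN h.2 (fun n => (hβ n).shiftG 0) (fun x => (hδ x).shiftG 0)⟩
  | gvar u d s ih => intro β δ hβ hδ x; exact ih x (h x) hβ hδ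
  | unbox u d s ih => intro β δ hβ hδ; exact ⟨h.1, fun x => ih x (h.2 x) hβ hδ⟩
  | _ => intros; simp_all [Occ, Tm.subL]

theorem Occ.fn {δ : LSub} (h : ∀ x, Occ PN PL (δ.val x)) (x : LVar) : Occ PN PL (δ.fn x) := by
  unfold LSub.fn
  split_ifs
  · exact h _
  · trivial

theorem Code.Occ.inst {k : Code} (hk : k.Occ PN PL) {δ : LSub}
    (h : ∀ x, LMML.Occ PN PL (δ.val x)) : LMML.Occ PN PL (k.inst δ) := by
  cases k with
  | var u => exact h
  | hash b => exact ⟨hk, h⟩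
  | term M => exact LMML.Occ.subL hk (fun _ => trivial) (LMML.Occ.fn h)

theorem Code.Occ.upG {σ : ℕ → Code} (h : ∀ u, (σ u).Occ PN PL) :
    ∀ u, (LMML.upG σ u).Occ PN PL := by
  intro u
  cases u with
  | zero => trivial
  | succ u =>
    have := h u
    simp only [LMML.upG]
    cases hu : σ u with
    | var v => trivial
    | hash b => rw [hu] at this; exact this
    | term N => rw [hu] at this; exact LMML.Occ.shiftG this 0

theorem Occ.subG {M : Tm} (h : Occ PN PL M) : ∀ {σ : ℕ → Code},
    (∀ u, (σ u).Occ PN PL) → Occ PN PL (M.subG σ) := by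
  induction M with
  | gvar u d s ih => intro σ hσ; exact (hσ u).inst (fun x => ih x (h x) hσ)
  | unbox u d s ih => intro σ hσ; exact ⟨h.1, fun x => ih x (h.2 x) hσ⟩
  | letbox M N ihM ihN => intro σ hσ; exact ⟨ihM h.1 hσ, ihN h.2 (Code.Occ.upG hσ)⟩
  | _ => intros; simp_all [Occ, Tm.subG]

/-- Only the names and locations that occur matter. Hence allocating a location or introducing a
name changes the concretization of no earlier term. -/
theorem Occ.conc_congr {M : Tm} (h : Occ PN PL M) {r r' : Loc → Loc} {c c' : Name → Tm}
    (hr : ∀ l ∈ PL, r l = r' l) (hc : ∀ n ∈ PN, c n = c' n) : conc r c M = conc r' c' M := by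
  induction M with
  | gvar u d s ih => simp only [conc]; congr 1; funext x; exact ih x (h x)
  | unbox b d s ih =>
    simp only [conc, codeOf]; rw [hc b h.1]; congr 2; funext x; exact ih x (h.2 x)
  | loc l => simp only [conc]; rw [hr l h]
  | name n => exact hc n h
  | _ => simp_all [Occ, conc]

end

theorem Tm.NameFree.conc_id {M : Tm} (h : M.NameFree) (c : Name → Tm) : conc id c M = M := by
  induction M with
  | gvar u d s ih => simp only [conc]; congr 1; funext x; exact ih x (h x)
  | _ => simp_all [Tm.NameFree, conc]

theorem Tm.NameFree.occ {M : Tm} (h : M.NameFree) {PL : Set Loc} (hl : Occ Set.univ PL M) :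
    Occ ∅ PL M := by
  induction M with
  | gvar u d s ih => exact fun x => ih x (h x) (hl x)
  | _ => simp_all [Tm.NameFree, Occ]

/-! ## Typing: weakening -/

theorem Layer.le_one (i : Layer) : i ≤ 1 := Fin.le_last i

theorem Ty.Wf.mono {i j : Layer} {T : Ty} (h : Ty.Wf i T) (hij : i ≤ j) : Ty.Wf j T := by
  induction h with
  | unit => exact .unit _
  | int => exact .int _
  | arrow _ _ ih₁ ih₂ => exact .arrow (ih₁ hij) (ih₂ hij)
  | ref _ ih => exact .ref (ih hij)
  | box h₁ h₂ h₃ =>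
    obtain rfl : j = 1 := le_antisymm (Layer.le_one j) hij
    exact .box h₁ h₂ h₃

theorem CtxWf.mono {S : Store} {Ψ : GCtx} {Γ : LCtx} {Δ : List Ty} {i j : Layer}
    (h : CtxWf S Ψ Γ Δ i) (hij : i ≤ j) : CtxWf S Ψ Γ Δ j :=
  ⟨h.1, h.2.1, ⟨h.2.2.1.1, fun p hp => (h.2.2.1.2 p hp).mono hij⟩,
    fun T hT => (h.2.2.2 T hT).mono hij⟩

theorem CtxWf.cons {S : Store} {Ψ : GCtx} {Γ : LCtx} {Δ : List Ty} {i : Layer} {T : Ty}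
    (h : CtxWf S Ψ Γ Δ i) (hT : Ty.Wf i T) : CtxWf S Ψ Γ (T :: Δ) i :=
  ⟨h.1, h.2.1, h.2.2.1, by simpa using ⟨hT, h.2.2.2⟩⟩

theorem CtxWf.tail {S : Store} {Ψ : GCtx} {Γ : LCtx} {Δ : List Ty} {i : Layer} {T : Ty}
    (h : CtxWf S Ψ Γ (T :: Δ) i) : CtxWf S Ψ Γ Δ i ∧ Ty.Wf i T :=
  ⟨⟨h.1, h.2.1, h.2.2.1, fun T hT => h.2.2.2 T (by simp [hT])⟩, h.2.2.2 T (by simp)⟩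

theorem CtxWf.gtail {S : Store} {Ψ : GCtx} {Γ : LCtx} {Δ : List Ty} {i : Layer} {p : LCtx × Ty}
    (h : CtxWf S (p :: Ψ) Γ Δ i) : CtxWf S Ψ Γ Δ i ∧ LCtx.Wf 0 p.1 ∧ Ty.Wf 0 p.2 :=
  ⟨⟨h.1, fun q hq => h.2.1 q (by simp [hq]), h.2.2⟩, h.2.1 p (by simp)⟩

theorem CtxWf.gcons {S : Store} {Ψ : GCtx} {Γ : LCtx} {Δ : List Ty} {i : Layer} {p : LCtx × Ty}
    (h : CtxWf S Ψ Γ Δ i) (hp : LCtx.Wf 0 p.1 ∧ Ty.Wf 0 p.2) : CtxWf S (p :: Ψ) Γ Δ i :=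
  ⟨h.1, by intro q hq; rcases List.mem_cons.1 hq with rfl | hq; exacts [hp, h.2.1 q hq], h.2.2⟩

theorem CtxWf.nil {S : Store} (h : Store.Wf 1 S) (i : Layer) : CtxWf S [] [] [] i :=
  ⟨h, by simp [GCtx.Wf], by simp [LCtx.Wf], by simp⟩

theorem NameOf.wf {n : Name} {T : Ty} {i : Layer} (h : NameOf n T i) : Ty.Wf i T := by
  cases h with
  | fn k h => exact h
  | bx k h => exact h

theorem NameOf.unique {n : Name} {T T' : Ty} {i j : Layer} (h : NameOf n T i)
    (h' : NameOf n T' j) : T = T' ∧ i = j := by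
  cases h <;> cases h' <;> exact ⟨rfl, rfl⟩

theorem NameOf.dom_box {b : Name} {Γ : LCtx} {T : Ty} {i : Layer} (h : NameOf b (.box Γ T) i) :
    b.dom = (Γ.map Prod.fst).toFinset := by
  cases h; rfl

theorem HasTy.ctxWf {S : Store} {Ψ : GCtx} {Γ : LCtx} {Δ : List Ty} {i : Layer} {M : Tm} {T : Ty}
    (h : HasTy S Ψ Γ Δ i M T) : CtxWf S Ψ Γ Δ i := by
  induction h with
  | lam _ ih => exact ih.tail.1
  | recf _ ih => exact ih.tail.1.tail.1
  | _ => assumption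

theorem HasTy.wf {S : Store} {Ψ : GCtx} {Γ : LCtx} {Δ : List Ty} {i : Layer} {M : Tm} {T : Ty}
    (h : HasTy S Ψ Γ Δ i M T) : Ty.Wf i T := by
  induction h with
  | unit => exact .unit _
  | num => exact .int _
  | lvar hw hx => exact hw.2.2.1.2 _ hx
  | bvar hw hk => exact hw.2.2.2 _ (List.mem_of_getElem? hk)
  | gvar hw hu => exact (hw.2.1 _ (List.mem_of_getElem? hu)).2.mono (Fin.zero_le _)
  | loc _ _ h => exact .ref h
  | lam h ih => exact .arrow h.ctxWf.tail.2 ih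
  | app _ _ ih _ => cases ih with | arrow _ h => exact h
  | recf h ih => exact .arrow h.ctxWf.tail.2 ih
  | arith => exact .int _
  | ite _ _ _ _ ih _ => exact ih
  | ref _ ih => exact .ref ih
  | deref _ ih => cases ih with | ref h => exact h
  | assign => exact .unit _
  | box hw h ih => exact .box h.ctxWf.2.2.1.1 h.ctxWf.2.2.1.2 ih
  | letbox _ _ _ ih => exact ih
  | name _ hn hij => exact hn.wf.mono hij
  | unbox _ hb => cases hb.wf with | box _ _ h => exact h.mono (Fin.zero_le _)

theorem CtxWf.store {S S' : Store} {Ψ : GCtx} {Γ : LCtx} {Δ : List Ty} {i : Layer}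
    (h : CtxWf S Ψ Γ Δ i) (h' : Store.Wf 1 S') : CtxWf S' Ψ Γ Δ i := ⟨h', h.2⟩

theorem HasTy.store {S S' : Store} {Ψ : GCtx} {Γ : LCtx} {Δ : List Ty} {i : Layer} {M : Tm}
    {T : Ty} (h : HasTy S Ψ Γ Δ i M T) (hs : MapSub S S') (h' : Store.Wf 1 S') :
    HasTy S' Ψ Γ Δ i M T := by
  induction h with
  | unit hw => exact .unit (hw.store h')
  | num n hw => exact .num n (hw.store h')
  | lvar hw hx => exact .lvar (hw.store h') hx
  | bvar hw hk => exact .bvar (hw.store h') hk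
  | gvar hw hu hd hv _ ih => exact .gvar (hw.store h') hu hd hv ih
  | loc hw hl hT => exact .loc (hw.store h') (hs _ _ hl) hT
  | lam _ ih => exact .lam ih
  | app _ _ ih ih' => exact .app ih ih'
  | recf _ ih => exact .recf ih
  | arith o _ _ ih ih' => exact .arith o ih ih'
  | ite _ _ _ ih ih' ih'' => exact .ite ih ih' ih''
  | ref _ ih => exact .ref ih
  | deref _ ih => exact .deref ih
  | assign _ _ ih ih' => exact .assign ih ih'
  | box hw _ ih => exact .box (hw.store h') ih
  | letbox _ _ ih ih' => exact .letbox ih ih'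
  | name hw hn hij => exact .name (hw.store h') hn hij
  | unbox hw hb hd hv _ ih => exact .unbox (hw.store h') hb hd hv ih

/-- A `box` or `letbox` is at the top layer already. As every typing can be raised to layer `1`, the
invariants of the interaction type terms and heaps at that layer only; finer layers reappear in
`Layered`. -/
theorem HasTy.layer {S : Store} {Ψ : GCtx} {Γ : LCtx} {Δ : List Ty} {i j : Layer} {M : Tm}
    {T : Ty} (h : HasTy S Ψ Γ Δ i M T) (hij : i ≤ j) : HasTy S Ψ Γ Δ j M T := by
  induction h with
  | unit hw => exact .unit (hw.mono hij)
  | num n hw => exact .num n (hw.mono hij)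
  | lvar hw hx => exact .lvar (hw.mono hij) hx
  | bvar hw hk => exact .bvar (hw.mono hij) hk
  | gvar hw hu hd hv _ ih => exact .gvar (hw.mono hij) hu hd hv (fun x T h => ih x T h hij)
  | loc hw hl hT => exact .loc (hw.mono hij) hl (hT.mono hij)
  | lam _ ih => exact .lam (ih hij)
  | app _ _ ih ih' => exact .app (ih hij) (ih' hij)
  | recf _ ih => exact .recf (ih hij)
  | arith o _ _ ih ih' => exact .arith o (ih hij) (ih' hij)
  | ite _ _ _ ih ih' ih'' => exact .ite (ih hij) (ih' hij) (ih'' hij)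
  | ref _ ih => exact .ref (ih hij)
  | deref _ ih => exact .deref (ih hij)
  | assign _ _ ih ih' => exact .assign (ih hij) (ih' hij)
  | box hw h ih =>
    obtain rfl : j = 1 := le_antisymm (Layer.le_one j) hij
    exact .box hw h
  | letbox h₁ h₂ ih ih' =>
    obtain rfl : j = 1 := le_antisymm (Layer.le_one j) hij
    exact .letbox h₁ h₂
  | name hw hn h => exact .name (hw.mono hij) hn (h.trans hij)
  | unbox hw hb hd hv _ ih => exact .unbox (hw.mono hij) hb hd hv (fun x T h => ih x T h hij)

theorem HasTy.one {S : Store} {Ψ : GCtx} {Γ : LCtx} {Δ : List Ty} {i : Layer} {M : Tm}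
    {T : Ty} (h : HasTy S Ψ Γ Δ i M T) : HasTy S Ψ Γ Δ 1 M T := h.layer (Layer.le_one i)

theorem Tm.IsValue.shiftL {V : Tm} (h : V.IsValue) (c : ℕ) : (V.shiftL c).IsValue := by
  cases V with
  | bvar k => simp only [Tm.shiftL]; split_ifs <;> trivial
  | _ => trivial

theorem Tm.IsValue.shiftG {V : Tm} (h : V.IsValue) (c : ℕ) : (V.shiftG c).IsValue := by
  cases V with
  | _ => trivial

theorem Tm.IsValue.subL {V : Tm} (h : V.IsValue) {β : ℕ → Tm} {δ : LVar → Tm}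
    (hβ : ∀ n, (β n).IsValue) (hδ : ∀ x, (δ x).IsValue) : (V.subL β δ).IsValue := by
  cases V with
  | bvar k => exact hβ k
  | lvar k => exact hδ k
  | _ => trivial

theorem Tm.IsValue.subG {V : Tm} (h : V.IsValue) (σ : ℕ → Code) : (V.subG σ).IsValue := by
  cases V with
  | _ => trivial

theorem isValue_upL {β : ℕ → Tm} (hβ : ∀ n, (β n).IsValue) : ∀ n, (upL β n).IsValue := by
  intro n
  cases n with
  | zero => trivial
  | succ n => exact (hβ n).shiftL 0

theorem HasTy.shiftL {S : Store} {Ψ : GCtx} {Γ : LCtx} {Δ : List Ty} {i : Layer} {M : Tm}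
    {T : Ty} (h : HasTy S Ψ Γ Δ i M T) : ∀ {c : ℕ} {Δ' : List Ty}, InsertedAt c Δ Δ' →
    CtxWf S Ψ Γ Δ' i → HasTy S Ψ Γ Δ' i (M.shiftL c) T := by
  induction h with
  | unit hw => intro c Δ' hi hw'; exact .unit hw'
  | num n hw => intro c Δ' hi hw'; exact .num n hw'
  | lvar hw hx => intro c Δ' hi hw'; exact .lvar hw' hx
  | @bvar _ _ _ _ k _ hw hk =>
    intro c Δ' hi hw'
    have : Tm.shiftL c (.bvar k) = .bvar (if c ≤ k then k + 1 else k) := by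
      simp only [Tm.shiftL]; split_ifs <;> rfl
    rw [this]
    exact .bvar hw' ((hi k).trans hk)
  | gvar hw hu hd hv _ ih =>
    intro c Δ' hi hw'
    exact .gvar hw' hu hd (fun x => (hv x).shiftL c) (fun x T h => ih x T h hi hw')
  | loc hw hl hT => intro c Δ' hi hw'; exact .loc hw' hl hT
  | lam h ih => intro c Δ' hi hw'; exact .lam (ih (hi.cons _) (hw'.cons h.ctxWf.tail.2))
  | app _ _ ih ih' => intro c Δ' hi hw'; exact .app (ih hi hw') (ih' hi hw')
  | recf h ih =>
    intro c Δ' hi hw'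
    exact .recf (ih ((hi.cons _).cons _) ((hw'.cons h.ctxWf.tail.1.tail.2).cons h.ctxWf.tail.2))
  | arith o _ _ ih ih' => intro c Δ' hi hw'; exact .arith o (ih hi hw') (ih' hi hw')
  | ite _ _ _ ih ih' ih'' =>
    intro c Δ' hi hw'; exact .ite (ih hi hw') (ih' hi hw') (ih'' hi hw')
  | ref _ ih => intro c Δ' hi hw'; exact .ref (ih hi hw')
  | deref _ ih => intro c Δ' hi hw'; exact .deref (ih hi hw')
  | assign _ _ ih ih' => intro c Δ' hi hw'; exact .assign (ih hi hw') (ih' hi hw')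
  | box hw h ih => intro c Δ' hi hw'; exact .box hw' h
  | letbox h₁ h₂ ih ih' =>
    intro c Δ' hi hw'; exact .letbox (ih hi hw') (ih' hi (hw'.gcons h₂.ctxWf.gtail.2))
  | name hw hn h => intro c Δ' hi hw'; exact .name hw' hn h
  | unbox hw hb hd hv _ ih =>
    intro c Δ' hi hw'
    exact .unbox hw' hb hd (fun x => (hv x).shiftL c) (fun x T h => ih x T h hi hw')

theorem HasTy.shiftG {S : Store} {Ψ : GCtx} {Γ : LCtx} {Δ : List Ty} {i : Layer} {M : Tm}
    {T : Ty} (h : HasTy S Ψ Γ Δ i M T) : ∀ {c : ℕ} {Ψ' : GCtx}, InsertedAt c Ψ Ψ' →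
    GCtx.Wf Ψ' → HasTy S Ψ' Γ Δ i (M.shiftG c) T := by
  induction h with
  | unit hw => intro c Ψ' hi hw'; exact .unit ⟨hw.1, hw', hw.2.2⟩
  | num n hw => intro c Ψ' hi hw'; exact .num n ⟨hw.1, hw', hw.2.2⟩
  | lvar hw hx => intro c Ψ' hi hw'; exact .lvar ⟨hw.1, hw', hw.2.2⟩ hx
  | bvar hw hk => intro c Ψ' hi hw'; exact .bvar ⟨hw.1, hw', hw.2.2⟩ hk
  | gvar hw hu hd hv _ ih =>
    intro c Ψ' hi hw'
    exact .gvar ⟨hw.1, hw', hw.2.2⟩ ((hi _).trans hu) hd (fun x => (hv x).shiftG c)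
      (fun x T h => ih x T h hi hw')
  | loc hw hl hT => intro c Ψ' hi hw'; exact .loc ⟨hw.1, hw', hw.2.2⟩ hl hT
  | lam h ih => intro c Ψ' hi hw'; exact .lam (ih hi hw')
  | app _ _ ih ih' => intro c Ψ' hi hw'; exact .app (ih hi hw') (ih' hi hw')
  | recf h ih => intro c Ψ' hi hw'; exact .recf (ih hi hw')
  | arith o _ _ ih ih' => intro c Ψ' hi hw'; exact .arith o (ih hi hw') (ih' hi hw')
  | ite _ _ _ ih ih' ih'' =>
    intro c Ψ' hi hw'; exact .ite (ih hi hw') (ih' hi hw') (ih'' hi hw')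
  | ref _ ih => intro c Ψ' hi hw'; exact .ref (ih hi hw')
  | deref _ ih => intro c Ψ' hi hw'; exact .deref (ih hi hw')
  | assign _ _ ih ih' => intro c Ψ' hi hw'; exact .assign (ih hi hw') (ih' hi hw')
  | box hw h ih => intro c Ψ' hi hw'; exact .box ⟨hw.1, hw', hw.2.2⟩ (ih hi hw')
  | letbox h₁ h₂ ih ih' =>
    intro c Ψ' hi hw'
    refine .letbox (ih hi hw') (ih' (hi.cons _) ?_)
    exact (CtxWf.gcons ⟨h₁.ctxWf.1, hw', h₁.ctxWf.2.2⟩ h₂.ctxWf.gtail.2).2.1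
  | name hw hn h => intro c Ψ' hi hw'; exact .name ⟨hw.1, hw', hw.2.2⟩ hn h
  | unbox hw hb hd hv _ ih =>
    intro c Ψ' hi hw'
    exact .unbox ⟨hw.1, hw', hw.2.2⟩ hb hd (fun x => (hv x).shiftG c)
      (fun x T h => ih x T h hi hw')

/-! ## Typing: substitution -/

theorem HasTy.upL {S : Store} {Ψ : GCtx} {Γ : LCtx} {Δ Δ' : List Ty} {i : Layer} {β : ℕ → Tm}
    (h : ∀ k T, Δ[k]? = some T → HasTy S Ψ Γ Δ' i (β k) T) {T₁ : Ty}
    (hw : CtxWf S Ψ Γ (T₁ :: Δ') i) :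
    ∀ k T, (T₁ :: Δ)[k]? = some T → HasTy S Ψ Γ (T₁ :: Δ') i (LMML.upL β k) T := by
  intro k T hk
  cases k with
  | zero => exact .bvar hw (by simpa using hk)
  | succ k => exact (h k T (by simpa using hk)).shiftL (insertedAt_zero _ _) hw

theorem HasTy.subL {S : Store} {Ψ : GCtx} {Γ : LCtx} {Δ : List Ty} {i : Layer} {M : Tm}
    {T : Ty} (h : HasTy S Ψ Γ Δ i M T) : ∀ {Γ' : LCtx} {Δ' : List Ty} {β : ℕ → Tm}
    {δ : LVar → Tm}, CtxWf S Ψ Γ' Δ' i →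
    (∀ k T, Δ[k]? = some T → HasTy S Ψ Γ' Δ' i (β k) T) → (∀ k, (β k).IsValue) →
    (∀ x T, (x, T) ∈ Γ → HasTy S Ψ Γ' Δ' i (δ x) T) → (∀ x, (δ x).IsValue) →
    HasTy S Ψ Γ' Δ' i (M.subL β δ) T := by
  induction h with
  | unit hw => intro Γ' Δ' β δ hw' hβ hβv hδ hδv; exact .unit hw'
  | num n hw => intro Γ' Δ' β δ hw' hβ hβv hδ hδv; exact .num n hw'
  | lvar hw hx => intro Γ' Δ' β δ hw' hβ hβv hδ hδv; exact hδ _ _ hx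
  | bvar hw hk => intro Γ' Δ' β δ hw' hβ hβv hδ hδv; exact hβ _ _ hk
  | gvar hw hu hd hv _ ih =>
    intro Γ' Δ' β δ hw' hβ hβv hδ hδv
    exact .gvar hw' hu hd (fun x => (hv x).subL hβv hδv)
      (fun x T h => ih x T h hw' hβ hβv hδ hδv)
  | loc hw hl hT => intro Γ' Δ' β δ hw' hβ hβv hδ hδv; exact .loc hw' hl hT
  | lam h ih =>
    intro Γ' Δ' β δ hw' hβ hβv hδ hδv
    have hw₁ := hw'.cons h.ctxWf.tail.2
    exact .lam (ih hw₁ (HasTy.upL hβ hw₁) (isValue_upL hβv)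
      (fun x T hx => (hδ x T hx).shiftL (insertedAt_zero _ _) hw₁) (fun x => (hδv x).shiftL 0))
  | app _ _ ih ih' =>
    intro Γ' Δ' β δ hw' hβ hβv hδ hδv
    exact .app (ih hw' hβ hβv hδ hδv) (ih' hw' hβ hβv hδ hδv)
  | recf h ih =>
    intro Γ' Δ' β δ hw' hβ hβv hδ hδv
    have hw₁ := hw'.cons h.ctxWf.tail.1.tail.2
    have hw₂ := hw₁.cons h.ctxWf.tail.2
    exact .recf (ih hw₂ (HasTy.upL (HasTy.upL hβ hw₁) hw₂) (isValue_upL (isValue_upL hβv))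
      (fun x T hx => ((hδ x T hx).shiftL (insertedAt_zero _ _) hw₁).shiftL
        (insertedAt_zero _ _) hw₂) (fun x => ((hδv x).shiftL 0).shiftL 0))
  | arith o _ _ ih ih' =>
    intro Γ' Δ' β δ hw' hβ hβv hδ hδv
    exact .arith o (ih hw' hβ hβv hδ hδv) (ih' hw' hβ hβv hδ hδv)
  | ite _ _ _ ih ih' ih'' =>
    intro Γ' Δ' β δ hw' hβ hβv hδ hδv
    exact .ite (ih hw' hβ hβv hδ hδv) (ih' hw' hβ hβv hδ hδv) (ih'' hw' hβ hβv hδ hδv)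
  | ref _ ih => intro Γ' Δ' β δ hw' hβ hβv hδ hδv; exact .ref (ih hw' hβ hβv hδ hδv)
  | deref _ ih => intro Γ' Δ' β δ hw' hβ hβv hδ hδv; exact .deref (ih hw' hβ hβv hδ hδv)
  | assign _ _ ih ih' =>
    intro Γ' Δ' β δ hw' hβ hβv hδ hδv
    exact .assign (ih hw' hβ hβv hδ hδv) (ih' hw' hβ hβv hδ hδv)
  | box hw h ih => intro Γ' Δ' β δ hw' hβ hβv hδ hδv; exact .box hw' h
  | letbox h₁ h₂ ih ih' =>
    intro Γ' Δ' β δ hw' hβ hβv hδ hδv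
    have hw₁ := hw'.gcons h₂.ctxWf.gtail.2
    exact .letbox (ih hw' hβ hβv hδ hδv) (ih' hw₁
      (fun k T hk => (hβ k T hk).shiftG (insertedAt_zero _ _) hw₁.2.1)
      (fun k => (hβv k).shiftG 0)
      (fun k T hk => (hδ k T hk).shiftG (insertedAt_zero _ _) hw₁.2.1)
      (fun k => (hδv k).shiftG 0))
  | name hw hn h => intro Γ' Δ' β δ hw' hβ hβv hδ hδv; exact .name hw' hn h
  | unbox hw hb hd hv _ ih =>
    intro Γ' Δ' β δ hw' hβ hβv hδ hδv
    exact .unbox hw' hb hd (fun x => (hv x).subL hβv hδv)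
      (fun x T h => ih x T h hw' hβ hβv hδ hδv)

theorem LSub.fn_isValue {δ : LSub} (h : ∀ x, (δ.val x).IsValue) (x : LVar) :
    (δ.fn x).IsValue := by
  unfold LSub.fn
  split_ifs
  · exact h _
  · trivial

/-- Code of type `p.2` open in the context `p.1`. -/
def Code.Typed (S : Store) (Ψ : GCtx) (p : LCtx × Ty) : Code → Prop
  | .var u => Ψ[u]? = some p
  | .term N => HasTy S Ψ p.1 [] 0 N p.2
  | .hash b => NameOf b (.box p.1 p.2) 1

theorem Code.Typed.inst {S : Store} {Ψ : GCtx} {p : LCtx × Ty} {k : Code} (hk : k.Typed S Ψ p)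
    {Γ : LCtx} {Δ : List Ty} {i : Layer} (hw : CtxWf S Ψ Γ Δ i) {d : Finset LVar}
    {s : {x // x ∈ d} → Tm} (hd : ∀ x, x ∈ d ↔ x ∈ p.1.map Prod.fst) (hv : ∀ x, (s x).IsValue)
    (ht : ∀ (x : {x // x ∈ d}) (T' : Ty), (x.1, T') ∈ p.1 → HasTy S Ψ Γ Δ i (s x) T') :
    HasTy S Ψ Γ Δ i (k.inst ⟨d, s⟩) p.2 := by
  cases k with
  | var u => exact .gvar hw hk hd hv ht
  | hash b => exact .unbox hw hk hd hv ht
  | term N =>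
    refine (HasTy.layer hk (Fin.zero_le i)).subL hw (by simp) (fun _ => trivial) ?_
      (LSub.fn_isValue hv)
    intro x T hx
    have hx' : x ∈ d := (hd x).2 (List.mem_map_of_mem hx)
    rw [LSub.fn_mk_of_mem _ hx']
    exact ht ⟨x, hx'⟩ T hx

theorem Code.Typed.upG {S : Store} {Ψ Ψ' : GCtx} {σ : ℕ → Code}
    (h : ∀ u p, Ψ[u]? = some p → (σ u).Typed S Ψ' p) {q : LCtx × Ty} (hq : GCtx.Wf (q :: Ψ')) :
    ∀ u p, (q :: Ψ)[u]? = some p → (LMML.upG σ u).Typed S (q :: Ψ') p := by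
  intro u p hu
  cases u with
  | zero => exact hu
  | succ u =>
    have := h u p (by simpa using hu)
    simp only [LMML.upG]
    cases hs : σ u with
    | var v => rw [hs] at this; exact (List.getElem?_cons_succ).trans this
    | hash b => rw [hs] at this; exact this
    | term N => rw [hs] at this; exact HasTy.shiftG this (insertedAt_zero _ _) hq

theorem HasTy.subG {S : Store} {Ψ : GCtx} {Γ : LCtx} {Δ : List Ty} {i : Layer} {M : Tm}
    {T : Ty} (h : HasTy S Ψ Γ Δ i M T) : ∀ {Ψ' : GCtx} {σ : ℕ → Code}, GCtx.Wf Ψ' →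
    (∀ u p, Ψ[u]? = some p → (σ u).Typed S Ψ' p) → HasTy S Ψ' Γ Δ i (M.subG σ) T := by
  induction h with
  | unit hw => intro Ψ' σ hw' hσ; exact .unit ⟨hw.1, hw', hw.2.2⟩
  | num n hw => intro Ψ' σ hw' hσ; exact .num n ⟨hw.1, hw', hw.2.2⟩
  | lvar hw hx => intro Ψ' σ hw' hσ; exact .lvar ⟨hw.1, hw', hw.2.2⟩ hx
  | bvar hw hk => intro Ψ' σ hw' hσ; exact .bvar ⟨hw.1, hw', hw.2.2⟩ hk
  | gvar hw hu hd hv _ ih =>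
    intro Ψ' σ hw' hσ
    exact (hσ _ _ hu).inst ⟨hw.1, hw', hw.2.2⟩ hd (fun x => (hv x).subG σ)
      (fun x T h => ih x T h hw' hσ)
  | loc hw hl hT => intro Ψ' σ hw' hσ; exact .loc ⟨hw.1, hw', hw.2.2⟩ hl hT
  | lam h ih => intro Ψ' σ hw' hσ; exact .lam (ih hw' hσ)
  | app _ _ ih ih' => intro Ψ' σ hw' hσ; exact .app (ih hw' hσ) (ih' hw' hσ)
  | recf h ih => intro Ψ' σ hw' hσ; exact .recf (ih hw' hσ)
  | arith o _ _ ih ih' => intro Ψ' σ hw' hσ; exact .arith o (ih hw' hσ) (ih' hw' hσ)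
  | ite _ _ _ ih ih' ih'' =>
    intro Ψ' σ hw' hσ; exact .ite (ih hw' hσ) (ih' hw' hσ) (ih'' hw' hσ)
  | ref _ ih => intro Ψ' σ hw' hσ; exact .ref (ih hw' hσ)
  | deref _ ih => intro Ψ' σ hw' hσ; exact .deref (ih hw' hσ)
  | assign _ _ ih ih' => intro Ψ' σ hw' hσ; exact .assign (ih hw' hσ) (ih' hw' hσ)
  | box hw h ih => intro Ψ' σ hw' hσ; exact .box ⟨hw.1, hw', hw.2.2⟩ (ih hw' hσ)
  | letbox h₁ h₂ ih ih' =>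
    intro Ψ' σ hw' hσ
    have hq := (CtxWf.gcons ⟨h₁.ctxWf.1, hw', h₁.ctxWf.2.2⟩ h₂.ctxWf.gtail.2).2.1
    exact .letbox (ih hw' hσ) (ih' hq (Code.Typed.upG hσ hq))
  | name hw hn h => intro Ψ' σ hw' hσ; exact .name ⟨hw.1, hw', hw.2.2⟩ hn h
  | unbox hw hb hd hv _ ih =>
    intro Ψ' σ hw' hσ
    exact .unbox ⟨hw.1, hw', hw.2.2⟩ hb hd (fun x => (hv x).subG σ)
      (fun x T h => ih x T h hw' hσ)

/-- The domain of a local context. -/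
def LCtx.dom (Γ : LCtx) : Finset LVar := (Γ.map Prod.fst).toFinset

theorem LCtx.eq_dom {Γ : LCtx} {d : Finset LVar} (h : ∀ x, x ∈ d ↔ x ∈ Γ.map Prod.fst) :
    d = Γ.dom := by
  ext x
  rw [h x, LCtx.dom, List.mem_toFinset]

/-- Every variable in the domain of a substitution is declared in the context, so each entry has a
typing derivation to which the induction applies. -/
theorem HasTy.sc {S : Store} {Ψ : GCtx} {Γ : LCtx} {Δ : List Ty} {i : Layer} {M : Tm}
    {T : Ty} (h : HasTy S Ψ Γ Δ i M T) :
    Sc (Ψ.map (fun p => LCtx.dom p.1)) (Γ.dom : Set LVar) Δ.length M := by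
  have key : ∀ {Γ : LCtx} {d : Finset LVar}, (∀ x, x ∈ d ↔ x ∈ Γ.map Prod.fst) →
      ∀ x : {x // x ∈ d}, ∃ T, (x.1, T) ∈ Γ := by
    intro Γ d hd x
    obtain ⟨p, hp, hx⟩ := List.mem_map.1 ((hd x).1 x.2)
    exact ⟨p.2, hx ▸ hp⟩
  induction h with
  | lvar hw hx =>
    simp only [Sc, LCtx.dom, List.coe_toFinset, Set.mem_ofPred_eq]
    exact List.mem_map_of_mem hx
  | bvar hw hk => exact (List.getElem?_eq_some_iff.1 hk).1
  | gvar hw hu hd hv _ ih =>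
    refine ⟨?_, fun x => ?_⟩
    · rw [List.getElem?_map, hu, LCtx.eq_dom hd]; rfl
    · obtain ⟨T, hT⟩ := key hd x; exact ih x T hT
  | lam _ ih => exact ih
  | app _ _ ih ih' => exact ⟨ih, ih'⟩
  | recf _ ih => exact ih
  | arith o _ _ ih ih' => exact ⟨ih, ih'⟩
  | ite _ _ _ ih ih' ih'' => exact ⟨ih, ih', ih''⟩
  | ref _ ih => exact ih
  | deref _ ih => exact ih
  | assign _ _ ih ih' => exact ⟨ih, ih'⟩
  | box hw _ ih => exact ih.mono (List.prefix_refl _) (Set.subset_univ _) le_rfl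
  | letbox _ _ ih ih' => exact ⟨ih, _, ih'⟩
  | unbox hw hb hd hv _ ih =>
    refine ⟨?_, fun x => ?_⟩
    · rw [hb.dom_box, LCtx.eq_dom hd]; rfl
    · obtain ⟨T, hT⟩ := key hd x; exact ih x T hT
  | _ => trivial

theorem HasTy.occ {S : Store} {Ψ : GCtx} {Γ : LCtx} {Δ : List Ty} {i : Layer} {M : Tm}
    {T : Ty} (h : HasTy S Ψ Γ Δ i M T) : Occ Set.univ {l | l ∈ S} M := by
  have key : ∀ {Γ : LCtx} {d : Finset LVar}, (∀ x, x ∈ d ↔ x ∈ Γ.map Prod.fst) →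
      ∀ x : {x // x ∈ d}, ∃ T, (x.1, T) ∈ Γ := by
    intro Γ d hd x
    obtain ⟨p, hp, hx⟩ := List.mem_map.1 ((hd x).1 x.2)
    exact ⟨p.2, hx ▸ hp⟩
  induction h with
  | gvar hw hu hd hv _ ih => intro x; obtain ⟨T, hT⟩ := key hd x; exact ih x T hT
  | unbox hw hu hd hv _ ih =>
    refine ⟨trivial, fun x => ?_⟩; obtain ⟨T, hT⟩ := key hd x; exact ih x T hT
  | loc hw hl hT => exact Finmap.mem_of_lookup_eq_some hl
  | _ => simp_all [Occ]

/-! ## Reduction in congruence style -/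

/-- Small-step reduction with one congruence rule for each form of evaluation context. -/
inductive CStep : Tm → Heap → Tm → Heap → Prop
  | beta {M V : Tm} {h : Heap} : V.IsValue →
      CStep (.app (.lam M) V) h (M.subL (betaSub V) .lvar) h
  | arith {o : Op} {m n : ℕ} {h : Heap} :
      CStep (.arith o (.num m) (.num n)) h (.num (o.eval m n)) h
  | iteTrue {n : ℕ} {M N : Tm} {h : Heap} : n ≠ 0 → CStep (.ite (.num n) M N) h M h
  | iteFalse {M N : Tm} {h : Heap} : CStep (.ite (.num 0) M N) h N h
  | ref {V : Tm} {h : Heap} {l : Loc} : V.IsValue → l ∉ h →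
      CStep (.ref V) h (.loc l) (h.insert l V)
  | deref {h : Heap} {l : Loc} {V : Tm} : h.lookup l = some V → CStep (.deref (.loc l)) h V h
  | assign {V : Tm} {h : Heap} {l : Loc} : V.IsValue → l ∈ h →
      CStep (.assign (.loc l) V) h .unit (h.insert l V)
  | recf {M V : Tm} {h : Heap} : V.IsValue →
      CStep (.app (.recf M) V) h (M.subL (recSub V (.recf M)) .lvar) h
  | letbox {M N : Tm} {h : Heap} :
      CStep (.letbox (.box M) N) h (N.subG (boxSub (.term M))) h
  | letboxName {Γ : LCtx} {T : Ty} {k : ℕ} {N : Tm} {h : Heap} :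
      CStep (.letbox (.name (.bx Γ T k)) N) h (N.subG (boxSub (.hash (.bx Γ T k)))) h
  | appL {M M' N : Tm} {h h' : Heap} : CStep M h M' h' → CStep (.app M N) h (.app M' N) h'
  | appR {V N N' : Tm} {h h' : Heap} : V.IsValue → CStep N h N' h' →
      CStep (.app V N) h (.app V N') h'
  | arithL {o : Op} {M M' N : Tm} {h h' : Heap} : CStep M h M' h' →
      CStep (.arith o M N) h (.arith o M' N) h'
  | arithR {o : Op} {V N N' : Tm} {h h' : Heap} : V.IsValue → CStep N h N' h' →
      CStep (.arith o V N) h (.arith o V N') h'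
  | iteC {M M' N P : Tm} {h h' : Heap} : CStep M h M' h' →
      CStep (.ite M N P) h (.ite M' N P) h'
  | refC {M M' : Tm} {h h' : Heap} : CStep M h M' h' → CStep (.ref M) h (.ref M') h'
  | derefC {M M' : Tm} {h h' : Heap} : CStep M h M' h' → CStep (.deref M) h (.deref M') h'
  | assignL {M M' N : Tm} {h h' : Heap} : CStep M h M' h' →
      CStep (.assign M N) h (.assign M' N) h'
  | assignR {V N N' : Tm} {h h' : Heap} : V.IsValue → CStep N h N' h' →
      CStep (.assign V N) h (.assign V N') h'
  | letboxC {M M' N : Tm} {h h' : Heap} : CStep M h M' h' →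
      CStep (.letbox M N) h (.letbox M' N) h'

theorem CStep.plug {M M' : Tm} {h h' : Heap} (K : ECtx) (hs : CStep M h M' h') :
    CStep (K.plug M) h (K.plug M') h' := by
  induction K with
  | hole => exact hs
  | appL K N ih => exact .appL ih
  | appR V hV K ih => exact .appR hV ih
  | arithL o K N ih => exact .arithL ih
  | arithR o V hV K ih => exact .arithR hV ih
  | ite K N P ih => exact .iteC ih
  | ref K ih => exact .refC ih
  | deref K ih => exact .derefC ih
  | assignL K N ih => exact .assignL ih
  | assignR V hV K ih => exact .assignR hV ih
  | letbox K N ih => exact .letboxC ih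

theorem Step.cstep {p q : Tm × Heap} (hs : Step p q) : CStep p.1 p.2 q.1 q.2 := by
  induction hs with
  | beta h => exact .beta h
  | arith => exact .arith
  | iteTrue h => exact .iteTrue h
  | iteFalse => exact .iteFalse
  | ref h h' => exact .ref h h'
  | deref h => exact .deref h
  | assign h h' => exact .assign h h'
  | recf h => exact .recf h
  | letbox => exact .letbox
  | letboxName => exact .letboxName
  | ktx K _ ih => exact ih.plug K

theorem CStep.step {M M' : Tm} {h h' : Heap} (hs : CStep M h M' h') : Step (M, h) (M', h') := by
  induction hs with
  | beta h => exact .beta h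
  | arith => exact .arith
  | iteTrue h => exact .iteTrue h
  | iteFalse => exact .iteFalse
  | ref h h' => exact .ref h h'
  | deref h => exact .deref h
  | assign h h' => exact .assign h h'
  | recf h => exact .recf h
  | letbox => exact .letbox
  | letboxName => exact .letboxName
  | @appL M M' N h h' _ ih => exact .ktx (.appL .hole N) ih
  | @appR V N N' h h' hV _ ih => exact .ktx (.appR V hV .hole) ih
  | @arithL o M M' N h h' _ ih => exact .ktx (.arithL o .hole N) ih
  | @arithR o V N N' h h' hV _ ih => exact .ktx (.arithR o V hV .hole) ih
  | @iteC M M' N P h h' _ ih => exact .ktx (.ite .hole N P) ih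
  | refC _ ih => exact .ktx (.ref .hole) ih
  | derefC _ ih => exact .ktx (.deref .hole) ih
  | @assignL M M' N h h' _ ih => exact .ktx (.assignL .hole N) ih
  | @assignR V N N' h h' hV _ ih => exact .ktx (.assignR V hV .hole) ih
  | @letboxC M M' N h h' _ ih => exact .ktx (.letbox .hole N) ih

theorem CStep.not_isValue {M M' : Tm} {h h' : Heap} (hs : CStep M h M' h') : ¬ M.IsValue := by
  cases hs <;> exact fun h => h

theorem ECtx.plug_not_isValue (K : ECtx) {M : Tm} (h : ¬ M.IsValue) : ¬ (K.plug M).IsValue := by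
  cases K with
  | hole => exact h
  | _ => exact fun h => h

/-- Every rule that consumes a subterm in evaluation position wants it to be a value. A context
around a non-value therefore takes no part in the redex. -/
theorem CStep.unplug {K : ECtx} : ∀ {M N : Tm} {h h' : Heap}, ¬ M.IsValue →
    CStep (K.plug M) h N h' → ∃ M', N = K.plug M' ∧ CStep M h M' h' := by
  induction K with
  | hole => intro M N h h' hM hs; exact ⟨N, rfl, hs⟩
  | appL K P ih =>
    intro M N h h' hM hs
    have hv := K.plug_not_isValue hM
    -- The plugged term is made opaque, so that inversion of the step can unify it with the forms of
    -- redexes; these are excluded because it is not a value.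
    generalize hX : K.plug M = X at hv
    simp only [ECtx.plug, hX] at hs
    cases hs with
    | appL hs => obtain ⟨M', rfl, h⟩ := ih hM (hX ▸ hs); exact ⟨M', rfl, h⟩
    | appR h => exact absurd h hv
    | beta => exact absurd trivial hv
    | recf => exact absurd trivial hv
  | appR V hV K ih =>
    intro M N h h' hM hs
    have hv := K.plug_not_isValue hM
    generalize hX : K.plug M = X at hv
    simp only [ECtx.plug, hX] at hs
    cases hs with
    | appL hs => exact absurd hV hs.not_isValue
    | appR h hs => obtain ⟨M', rfl, h⟩ := ih hM (hX ▸ hs); exact ⟨M', rfl, h⟩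
    | beta h => exact absurd h hv
    | recf h => exact absurd h hv
  | arithL o K P ih =>
    intro M N h h' hM hs
    have hv := K.plug_not_isValue hM
    generalize hX : K.plug M = X at hv
    simp only [ECtx.plug, hX] at hs
    cases hs with
    | arithL hs => obtain ⟨M', rfl, h⟩ := ih hM (hX ▸ hs); exact ⟨M', rfl, h⟩
    | arithR h => exact absurd h hv
    | arith => exact absurd trivial hv
  | arithR o V hV K ih =>
    intro M N h h' hM hs
    have hv := K.plug_not_isValue hM
    generalize hX : K.plug M = X at hv
    simp only [ECtx.plug, hX] at hs
    cases hs with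
    | arithL hs => exact absurd hV hs.not_isValue
    | arithR h hs => obtain ⟨M', rfl, h⟩ := ih hM (hX ▸ hs); exact ⟨M', rfl, h⟩
    | arith => exact absurd trivial hv
  | ite K P Q ih =>
    intro M N h h' hM hs
    have hv := K.plug_not_isValue hM
    generalize hX : K.plug M = X at hv
    simp only [ECtx.plug, hX] at hs
    cases hs with
    | iteC hs => obtain ⟨M', rfl, h⟩ := ih hM (hX ▸ hs); exact ⟨M', rfl, h⟩
    | iteTrue => exact absurd trivial hv
    | iteFalse => exact absurd trivial hv
  | ref K ih =>
    intro M N h h' hM hs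
    have hv := K.plug_not_isValue hM
    generalize hX : K.plug M = X at hv
    simp only [ECtx.plug, hX] at hs
    cases hs with
    | refC hs => obtain ⟨M', rfl, h⟩ := ih hM (hX ▸ hs); exact ⟨M', rfl, h⟩
    | ref h => exact absurd h hv
  | deref K ih =>
    intro M N h h' hM hs
    have hv := K.plug_not_isValue hM
    generalize hX : K.plug M = X at hv
    simp only [ECtx.plug, hX] at hs
    cases hs with
    | derefC hs => obtain ⟨M', rfl, h⟩ := ih hM (hX ▸ hs); exact ⟨M', rfl, h⟩
    | deref h => exact absurd trivial hv
  | assignL K P ih =>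
    intro M N h h' hM hs
    have hv := K.plug_not_isValue hM
    generalize hX : K.plug M = X at hv
    simp only [ECtx.plug, hX] at hs
    cases hs with
    | assignL hs => obtain ⟨M', rfl, h⟩ := ih hM (hX ▸ hs); exact ⟨M', rfl, h⟩
    | assignR h => exact absurd h hv
    | assign => exact absurd trivial hv
  | assignR V hV K ih =>
    intro M N h h' hM hs
    have hv := K.plug_not_isValue hM
    generalize hX : K.plug M = X at hv
    simp only [ECtx.plug, hX] at hs
    cases hs with
    | assignL hs => exact absurd hV hs.not_isValue
    | assignR h hs => obtain ⟨M', rfl, h⟩ := ih hM (hX ▸ hs); exact ⟨M', rfl, h⟩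
    | assign h => exact absurd h hv
  | letbox K P ih =>
    intro M N h h' hM hs
    have hv := K.plug_not_isValue hM
    generalize hX : K.plug M = X at hv
    simp only [ECtx.plug, hX] at hs
    cases hs with
    | letboxC hs => obtain ⟨M', rfl, h⟩ := ih hM (hX ▸ hs); exact ⟨M', rfl, h⟩
    | letbox => exact absurd trivial hv
    | letboxName => exact absurd trivial hv

/-! ### Occurrences of names and locations under reduction -/

/-- The locations of a heap. -/
def Heap.locs (h : Heap) : Set Loc := {l | l ∈ h}

theorem Heap.locs_insert (h : Heap) (l : Loc) (V : Tm) : h.locs ⊆ Heap.locs (h.insert l V) :=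
  fun _ hx => Finmap.mem_insert.2 (Or.inr hx)

/-- The values of the heap have their names in `PN` and their locations in the heap. -/
def Heap.Occ (PN : Set Name) (h : Heap) : Prop :=
  ∀ l V, h.lookup l = some V → LMML.Occ PN h.locs V

theorem Heap.lookup_insert_cases {α : Type} {h : Finmap (fun _ : Loc => α)} {l l' : Loc} {V W : α}
    (hl : (h.insert l V).lookup l' = some W) : (l' = l ∧ W = V) ∨ (l' ≠ l ∧ h.lookup l' = some W) := by
  by_cases e : l' = l
  · subst e
    rw [Finmap.lookup_insert] at hl
    exact Or.inl ⟨rfl, (Option.some.inj hl).symm⟩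
  · rw [Finmap.lookup_insert_of_ne _ e] at hl
    exact Or.inr ⟨e, hl⟩

theorem Heap.Occ.insert {PN : Set Name} {h : Heap} (hh : h.Occ PN) {V : Tm}
    (hV : LMML.Occ PN h.locs V) (l : Loc) : Heap.Occ PN (h.insert l V : Heap) := by
  intro l' W hl
  rcases Heap.lookup_insert_cases hl with ⟨-, rfl⟩ | ⟨-, hl⟩
  · exact hV.mono subset_rfl (h.locs_insert l W)
  · exact (hh l' W hl).mono subset_rfl (h.locs_insert l V)

theorem Occ.lvar {PN : Set Name} {PL : Set Loc} (x : LVar) : Occ PN PL (.lvar x) := trivial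

theorem Occ.betaSub {PN : Set Name} {PL : Set Loc} {V : Tm} (h : Occ PN PL V) :
    ∀ n, Occ PN PL (LMML.betaSub V n) := by
  intro n
  match n with
  | 0 => exact h
  | n + 1 => trivial

theorem Occ.recSub {PN : Set Name} {PL : Set Loc} {V W : Tm} (h : Occ PN PL V)
    (h' : Occ PN PL W) : ∀ n, Occ PN PL (LMML.recSub V W n) := by
  intro n
  match n with
  | 0 => exact h
  | 1 => exact h'
  | n + 2 => trivial

theorem Code.Occ.boxSub {PN : Set Name} {PL : Set Loc} {k : Code} (h : k.Occ PN PL) :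
    ∀ n, (LMML.boxSub k n).Occ PN PL := by
  intro n
  match n with
  | 0 => exact h
  | n + 1 => trivial

/-- No rule produces a name, and the only new location is the allocated one, which enters the heap
at once. The bound on locations is the current heap, which only grows. -/
theorem CStep.occ {PN : Set Name} {M M' : Tm} {h h' : Heap} (hs : CStep M h M' h') :
    Occ PN h.locs M → h.Occ PN → Occ PN h'.locs M' ∧ h'.Occ PN ∧ h.locs ⊆ h'.locs := by
  induction hs with
  | @beta M _ _ _ =>
    intro hM hh; exact ⟨Occ.subL (M := M) hM.1 hM.2.betaSub Occ.lvar, hh, subset_rfl⟩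
  | arith => intro hM hh; exact ⟨trivial, hh, subset_rfl⟩
  | iteTrue _ => intro hM hh; exact ⟨hM.2.1, hh, subset_rfl⟩
  | iteFalse => intro hM hh; exact ⟨hM.2.2, hh, subset_rfl⟩
  | @ref V h l hV hl =>
    intro hM hh
    exact ⟨Finmap.mem_insert.2 (Or.inl rfl), Heap.Occ.insert (V := V) hh hM l, h.locs_insert l V⟩
  | deref hl => intro hM hh; exact ⟨hh _ _ hl, hh, subset_rfl⟩
  | @assign V h l hV hl =>
    intro hM hh; exact ⟨trivial, Heap.Occ.insert hh hM.2 l, h.locs_insert l V⟩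
  | @recf M _ _ _ =>
    intro hM hh
    exact ⟨Occ.subL (M := M) hM.1 (Occ.recSub hM.2 hM.1) Occ.lvar, hh, subset_rfl⟩
  | letbox =>
    intro hM hh
    exact ⟨Occ.subG hM.2 (Code.Occ.boxSub (k := .term _) hM.1), hh, subset_rfl⟩
  | letboxName =>
    intro hM hh
    exact ⟨Occ.subG hM.2 (Code.Occ.boxSub (k := .hash _) hM.1), hh, subset_rfl⟩
  | iteC _ ih =>
    intro hM hh
    obtain ⟨h1, h2, h3⟩ := ih hM.1 hh
    exact ⟨⟨h1, hM.2.1.mono subset_rfl h3, hM.2.2.mono subset_rfl h3⟩, h2, h3⟩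
  | appL _ ih =>
    intro hM hh; obtain ⟨h1, h2, h3⟩ := ih hM.1 hh
    exact ⟨⟨h1, hM.2.mono subset_rfl h3⟩, h2, h3⟩
  | arithL _ ih =>
    intro hM hh; obtain ⟨h1, h2, h3⟩ := ih hM.1 hh
    exact ⟨⟨h1, hM.2.mono subset_rfl h3⟩, h2, h3⟩
  | assignL _ ih =>
    intro hM hh; obtain ⟨h1, h2, h3⟩ := ih hM.1 hh
    exact ⟨⟨h1, hM.2.mono subset_rfl h3⟩, h2, h3⟩
  | letboxC _ ih =>
    intro hM hh; obtain ⟨h1, h2, h3⟩ := ih hM.1 hh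
    exact ⟨⟨h1, hM.2.mono subset_rfl h3⟩, h2, h3⟩
  | appR _ _ ih =>
    intro hM hh; obtain ⟨h1, h2, h3⟩ := ih hM.2 hh
    exact ⟨⟨hM.1.mono subset_rfl h3, h1⟩, h2, h3⟩
  | arithR _ _ ih =>
    intro hM hh; obtain ⟨h1, h2, h3⟩ := ih hM.2 hh
    exact ⟨⟨hM.1.mono subset_rfl h3, h1⟩, h2, h3⟩
  | assignR _ _ ih =>
    intro hM hh; obtain ⟨h1, h2, h3⟩ := ih hM.2 hh
    exact ⟨⟨hM.1.mono subset_rfl h3, h1⟩, h2, h3⟩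
  | refC _ ih => intro hM hh; exact ih hM hh
  | derefC _ ih => intro hM hh; exact ih hM hh

/-! ## Typing of heaps, of evaluation contexts, and subject reduction -/

/-- Heaps typed at layer `1`. -/
structure HeapTy (S : Store) (h : Heap) : Prop where
  keys : ∀ l, l ∈ S ↔ l ∈ h
  value : ∀ l V, h.lookup l = some V → V.IsValue
  wf : Store.Wf 1 S
  typed : ∀ l T V, S.lookup l = some T → h.lookup l = some V → Typed S 1 V T

/-- The store context is well formed because each of its locations carries a typed value. -/
theorem HeapTyped.heapTy {S : Store} {h : Heap} (hh : HeapTyped S h) : HeapTy S h := by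
  obtain ⟨hk, hv, i, ht⟩ := hh
  have hk' : ∀ l, l ∈ S ↔ l ∈ h := fun l => by
    rw [← Finmap.mem_keys, hk, Finmap.mem_keys]
  refine ⟨hk', hv, ?_, fun l T V hl hl' => (ht l T V hl hl').one⟩
  intro l T hl
  obtain ⟨V, hV⟩ := Finmap.mem_iff.1 ((hk' l).1 (Finmap.mem_of_lookup_eq_some hl))
  exact (ht l T V hl hV).wf.mono (Layer.le_one i)

theorem HeapTy.heapTyped {S : Store} {h : Heap} (hh : HeapTy S h) : HeapTyped S h :=
  ⟨by ext l; rw [Finmap.mem_keys, Finmap.mem_keys]; exact hh.keys l, hh.value, 1, hh.typed⟩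

theorem MapSub.refl {α : Type} (s : Finmap (fun _ : Loc => α)) : MapSub s s := fun _ _ h => h

theorem MapSub.mem {α : Type} {s t : Finmap (fun _ : Loc => α)} (h : MapSub s t) {l : Loc}
    (hl : l ∈ s) : l ∈ t :=
  let ⟨_, ha⟩ := Finmap.mem_iff.1 hl; Finmap.mem_of_lookup_eq_some (h l _ ha)

theorem HasTy.betaSub {S : Store} {V : Tm} {T : Ty} {i : Layer} (h : Typed S i V T) :
    ∀ k T', [T][k]? = some T' → HasTy S [] [] [] i (LMML.betaSub V k) T' := by
  intro k T' hk
  match k with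
  | 0 => cases hk; exact h
  | k + 1 => cases hk

theorem isValue_betaSub {V : Tm} (h : V.IsValue) : ∀ k, (betaSub V k).IsValue := by
  intro k
  match k with
  | 0 => exact h
  | k + 1 => trivial

theorem HasTy.recSub {S : Store} {V W : Tm} {T T₂ : Ty} {i : Layer} (h : Typed S i V T)
    (h' : Typed S i W T₂) :
    ∀ k T', [T, T₂][k]? = some T' → HasTy S [] [] [] i (LMML.recSub V W k) T' := by
  intro k T' hk
  match k with
  | 0 => cases hk; exact h
  | 1 => cases hk; exact h'
  | k + 2 => cases hk

theorem isValue_recSub {V W : Tm} (h : V.IsValue) (h' : W.IsValue) :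
    ∀ k, (recSub V W k).IsValue := by
  intro k
  match k with
  | 0 => exact h
  | 1 => exact h'
  | k + 2 => trivial

theorem Code.Typed.boxSub {S : Store} {p : LCtx × Ty} {k : Code} (h : k.Typed S [] p) :
    ∀ u q, [p][u]? = some q → (LMML.boxSub k u).Typed S [] q := by
  intro u q hu
  match u with
  | 0 => cases hu; exact h
  | u + 1 => cases hu

theorem MapSub.insert {α : Type} {s : Finmap (fun _ : Loc => α)} {l : Loc} (hl : l ∉ s) (a : α) :
    MapSub s (s.insert l a) := by
  intro l' b hb
  have hne : l' ≠ l := by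
    rintro rfl
    exact hl (Finmap.mem_of_lookup_eq_some hb)
  rw [Finmap.lookup_insert_of_ne _ hne]
  exact hb

theorem HeapTy.assign {S : Store} {h : Heap} (hh : HeapTy S h) {l : Loc} {V : Tm} {T : Ty}
    (hl : S.lookup l = some T) (hV : V.IsValue) (ht : Typed S 1 V T) :
    HeapTy S (h.insert l V : Heap) := by
  refine ⟨fun l' => ?_, fun l' W hW => ?_, hh.wf, fun l' T' W hT hW => ?_⟩
  · rw [Finmap.mem_insert, hh.keys]
    refine ⟨Or.inr, ?_⟩
    rintro (rfl | h)
    · exact (hh.keys _).1 (Finmap.mem_of_lookup_eq_some hl)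
    · exact h
  · rcases Heap.lookup_insert_cases hW with ⟨-, rfl⟩ | ⟨-, hW⟩
    exacts [hV, hh.value _ _ hW]
  · rcases Heap.lookup_insert_cases hW with ⟨rfl, rfl⟩ | ⟨-, hW⟩
    · rw [hl] at hT; cases hT; exact ht
    · exact hh.typed _ _ _ hT hW

theorem HeapTy.alloc {S : Store} {h : Heap} (hh : HeapTy S h) {l : Loc} {V : Tm} {T : Ty}
    (hl : l ∉ h) (hV : V.IsValue) (ht : Typed S 1 V T) :
    HeapTy (S.insert l T : Store) (h.insert l V : Heap) := by
  have hS : MapSub S (S.insert l T : Store) := MapSub.insert (fun h' => hl ((hh.keys l).1 h')) T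
  have hwf : Store.Wf 1 (S.insert l T : Store) := by
    intro l' T' hT
    rcases Heap.lookup_insert_cases hT with ⟨-, rfl⟩ | ⟨-, hT⟩
    exacts [ht.wf, hh.wf _ _ hT]
  refine ⟨fun l' => ?_, fun l' W hW => ?_, hwf, fun l' T' W hT hW => ?_⟩
  · rw [Finmap.mem_insert, Finmap.mem_insert, hh.keys]
  · rcases Heap.lookup_insert_cases hW with ⟨-, rfl⟩ | ⟨-, hW⟩
    exacts [hV, hh.value _ _ hW]
  · rcases Heap.lookup_insert_cases hW with ⟨rfl, rfl⟩ | ⟨hne, hW⟩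
    · rw [Finmap.lookup_insert] at hT; cases hT; exact ht.store hS hwf
    · rw [Finmap.lookup_insert_of_ne _ hne] at hT
      exact (hh.typed _ _ _ hT hW).store hS hwf

/-- The store context grows at allocations only. Term and heap are both typed at layer `1`, so a
value read from the heap needs no change of layer. -/
theorem CStep.preservation {M M' : Tm} {h h' : Heap} (hs : CStep M h M' h') :
    ∀ {S : Store} {T : Ty}, Typed S 1 M T → HeapTy S h →
    ∃ S', MapSub S S' ∧ HeapTy S' h' ∧ Typed S' 1 M' T := by
  induction hs with
  | beta hV =>
    intro S T hM hh
    cases hM with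
    | app h₁ h₂ =>
      cases h₁ with
      | lam h₁ =>
        exact ⟨S, .refl S, hh, h₁.subL h₂.ctxWf h₂.betaSub (isValue_betaSub hV) (by simp)
          (fun _ => trivial)⟩
  | arith =>
    intro S T hM hh
    cases hM with
    | arith _ h₁ h₂ => exact ⟨S, .refl S, hh, .num _ h₁.ctxWf⟩
  | iteTrue _ => intro S T hM hh; cases hM with | ite _ h₁ h₂ => exact ⟨S, .refl S, hh, h₁⟩
  | iteFalse => intro S T hM hh; cases hM with | ite _ h₁ h₂ => exact ⟨S, .refl S, hh, h₂⟩
  | @ref V h l hV hl =>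
    intro S T hM hh
    cases hM with
    | @ref _ _ _ _ _ T hM =>
      have hh' := hh.alloc hl hV hM
      exact ⟨_, MapSub.insert (fun h' => hl ((hh.keys l).1 h')) T, hh',
        .loc (CtxWf.nil hh'.wf 1) (Finmap.lookup_insert _) hM.wf⟩
  | deref hl =>
    intro S T hM hh
    cases hM with
    | deref hM => cases hM with | loc hw hS hT => exact ⟨S, .refl S, hh, hh.typed _ _ _ hS hl⟩
  | assign hV hl =>
    intro S T hM hh
    cases hM with
    | assign hM hN =>
      cases hM with
      | loc hw hS hT => exact ⟨S, .refl S, hh.assign hS hV hN, .unit hw⟩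
  | recf hV =>
    intro S T hM hh
    cases hM with
    | app h₁ h₂ =>
      have h₁' := h₁
      cases h₁ with
      | recf h₁ =>
        exact ⟨S, .refl S, hh, h₁.subL h₂.ctxWf (h₂.recSub h₁') (isValue_recSub hV trivial)
          (by simp) (fun _ => trivial)⟩
  | letbox =>
    intro S T hM hh
    cases hM with
    | letbox h₁ h₂ =>
      cases h₁ with
      | box hw h₁ =>
        exact ⟨S, .refl S, hh, h₂.subG hw.2.1 (Code.Typed.boxSub (k := .term _) h₁)⟩
  | letboxName =>
    intro S T hM hh
    cases hM with
    | letbox h₁ h₂ =>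
      cases h₁ with
      | name hw h₁ h₃ =>
        refine ⟨S, .refl S, hh, h₂.subG hw.2.1 (Code.Typed.boxSub (k := .hash _) ?_)⟩
        cases h₁
        exact .bx _ (by assumption)
  | appL _ ih =>
    intro S T hM hh
    cases hM with
    | app h₁ h₂ =>
      obtain ⟨S', h₃, h₄, h₅⟩ := ih h₁ hh
      exact ⟨S', h₃, h₄, .app h₅ (h₂.store h₃ h₄.wf)⟩
  | appR _ _ ih =>
    intro S T hM hh
    cases hM with
    | app h₁ h₂ =>
      obtain ⟨S', h₃, h₄, h₅⟩ := ih h₂ hh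
      exact ⟨S', h₃, h₄, .app (h₁.store h₃ h₄.wf) h₅⟩
  | arithL _ ih =>
    intro S T hM hh
    cases hM with
    | arith o h₁ h₂ =>
      obtain ⟨S', h₃, h₄, h₅⟩ := ih h₁ hh
      exact ⟨S', h₃, h₄, .arith _ h₅ (h₂.store h₃ h₄.wf)⟩
  | arithR _ _ ih =>
    intro S T hM hh
    cases hM with
    | arith o h₁ h₂ =>
      obtain ⟨S', h₃, h₄, h₅⟩ := ih h₂ hh
      exact ⟨S', h₃, h₄, .arith _ (h₁.store h₃ h₄.wf) h₅⟩
  | assignL _ ih =>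
    intro S T hM hh
    cases hM with
    | assign h₁ h₂ =>
      obtain ⟨S', h₃, h₄, h₅⟩ := ih h₁ hh
      exact ⟨S', h₃, h₄, .assign h₅ (h₂.store h₃ h₄.wf)⟩
  | assignR _ _ ih =>
    intro S T hM hh
    cases hM with
    | assign h₁ h₂ =>
      obtain ⟨S', h₃, h₄, h₅⟩ := ih h₂ hh
      exact ⟨S', h₃, h₄, .assign (h₁.store h₃ h₄.wf) h₅⟩
  | iteC _ ih =>
    intro S T hM hh
    cases hM with
    | ite h₁ h₂ h₂' =>
      obtain ⟨S', h₃, h₄, h₅⟩ := ih h₁ hh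
      exact ⟨S', h₃, h₄, .ite h₅ (h₂.store h₃ h₄.wf) (h₂'.store h₃ h₄.wf)⟩
  | refC _ ih =>
    intro S T hM hh
    cases hM with
    | ref h₁ => obtain ⟨S', h₃, h₄, h₅⟩ := ih h₁ hh; exact ⟨S', h₃, h₄, .ref h₅⟩
  | derefC _ ih =>
    intro S T hM hh
    cases hM with
    | deref h₁ => obtain ⟨S', h₃, h₄, h₅⟩ := ih h₁ hh; exact ⟨S', h₃, h₄, .deref h₅⟩
  | letboxC _ ih =>
    intro S T hM hh
    cases hM with
    | letbox h₁ h₂ =>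
      obtain ⟨S', h₃, h₄, h₅⟩ := ih h₁ hh
      exact ⟨S', h₃, h₄, .letbox h₅ (h₂.store h₃ h₄.wf)⟩

theorem ECtxTyped.one {S : Store} {i₀ i : Layer} {T₀ T : Ty} {K : ECtx}
    (h : ECtxTyped S i₀ T₀ K i T) : ECtxTyped S 1 T₀ K 1 T := by
  induction h with
  | hole _ => exact .hole le_rfl
  | appL _ h ih => exact .appL ih h.one
  | appR h _ ih => exact .appR h.one ih
  | arithL o _ h ih => exact .arithL o ih h.one
  | arithR o h _ ih => exact .arithR o h.one ih
  | ite _ h h' ih => exact .ite ih h.one h'.one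
  | ref _ ih => exact .ref ih
  | deref _ ih => exact .deref ih
  | assignL _ h ih => exact .assignL ih h.one
  | assignR h _ ih => exact .assignR h.one ih
  | letbox _ h ih => exact .letbox ih h

theorem ECtxTyped.store {S S' : Store} {i₀ i : Layer} {T₀ T : Ty} {K : ECtx}
    (h : ECtxTyped S i₀ T₀ K i T) (hs : MapSub S S') (h' : Store.Wf 1 S') :
    ECtxTyped S' i₀ T₀ K i T := by
  induction h with
  | hole h => exact .hole h
  | appL _ h ih => exact .appL ih (h.store hs h')
  | appR h _ ih => exact .appR (h.store hs h') ih
  | arithL o _ h ih => exact .arithL o ih (h.store hs h')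
  | arithR o h _ ih => exact .arithR o (h.store hs h') ih
  | ite _ h h'' ih => exact .ite ih (h.store hs h') (h''.store hs h')
  | ref _ ih => exact .ref ih
  | deref _ ih => exact .deref ih
  | assignL _ h ih => exact .assignL ih (h.store hs h')
  | assignR h _ ih => exact .assignR (h.store hs h') ih
  | letbox _ h ih => exact .letbox ih (h.store hs h')

theorem ECtxTyped.plug {S : Store} {T₀ T : Ty} {i : Layer} {K : ECtx} {M : Tm}
    (h : ECtxTyped S 1 T₀ K i T) (hM : Typed S 1 M T₀) : Typed S i (K.plug M) T := by
  induction h with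
  | hole h => exact hM.layer h
  | appL _ h ih => exact .app ih h
  | appR h _ ih => exact .app h ih
  | arithL o _ h ih => exact .arith o ih h
  | arithR o h _ ih => exact .arith o h ih
  | ite _ h h' ih => exact .ite ih h h'
  | ref _ ih => exact .ref ih
  | deref _ ih => exact .deref ih
  | assignL _ h ih => exact .assign ih h
  | assignR h _ ih => exact .assign h ih
  | letbox _ h ih => exact .letbox ih h

/-- The transitions push a frame without asking for a typing of it; the typing is recovered from the
one of the whole term. -/
theorem HasTy.unplug {S : Store} {K : ECtx} : ∀ {T : Ty} {M : Tm}, Typed S 1 (K.plug M) T →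
    ∃ T₀, Typed S 1 M T₀ ∧ ECtxTyped S 1 T₀ K 1 T := by
  induction K with
  | hole => intro T M h; exact ⟨T, h, .hole le_rfl⟩
  | appL K N ih =>
    intro T M h
    cases h with | app h₁ h₂ => obtain ⟨T₀, h, h'⟩ := ih h₁; exact ⟨T₀, h, .appL h' h₂⟩
  | appR V hV K ih =>
    intro T M h
    cases h with | app h₁ h₂ => obtain ⟨T₀, h, h'⟩ := ih h₂; exact ⟨T₀, h, .appR h₁ h'⟩
  | arithL o K N ih =>
    intro T M h
    cases h with | arith _ h₁ h₂ => obtain ⟨T₀, h, h'⟩ := ih h₁; exact ⟨T₀, h, .arithL o h' h₂⟩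
  | arithR o V hV K ih =>
    intro T M h
    cases h with | arith _ h₁ h₂ => obtain ⟨T₀, h, h'⟩ := ih h₂; exact ⟨T₀, h, .arithR o h₁ h'⟩
  | ite K N P ih =>
    intro T M h
    cases h with | ite h₁ h₂ h₃ => obtain ⟨T₀, h, h'⟩ := ih h₁; exact ⟨T₀, h, .ite h' h₂ h₃⟩
  | ref K ih =>
    intro T M h
    cases h with | ref h₁ => obtain ⟨T₀, h, h'⟩ := ih h₁; exact ⟨T₀, h, .ref h'⟩
  | deref K ih =>
    intro T M h
    cases h with | deref h₁ => obtain ⟨T₀, h, h'⟩ := ih h₁; exact ⟨T₀, h, .deref h'⟩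
  | assignL K N ih =>
    intro T M h
    cases h with | assign h₁ h₂ => obtain ⟨T₀, h, h'⟩ := ih h₁; exact ⟨T₀, h, .assignL h' h₂⟩
  | assignR V hV K ih =>
    intro T M h
    cases h with | assign h₁ h₂ => obtain ⟨T₀, h, h'⟩ := ih h₂; exact ⟨T₀, h, .assignR h₁ h'⟩
  | letbox K N ih =>
    intro T M h
    cases h with | letbox h₁ h₂ => obtain ⟨T₀, h, h'⟩ := ih h₁; exact ⟨T₀, h, .letbox h' h₂⟩

/-! ## Canonical forms -/

theorem HasTy.canon_unit {S : Store} {i : Layer} {V : Tm} (h : Typed S i V .unit)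
    (hV : V.IsValue) : V = .unit := by
  cases h with
  | unit => rfl
  | lvar _ h => cases h
  | bvar _ h => cases h
  | name _ h => cases h
  | _ => exact hV.elim

theorem HasTy.canon_int {S : Store} {i : Layer} {V : Tm} (h : Typed S i V .int)
    (hV : V.IsValue) : ∃ n, V = .num n := by
  cases h with
  | num n => exact ⟨n, rfl⟩
  | lvar _ h => cases h
  | bvar _ h => cases h
  | name _ h => cases h
  | _ => exact hV.elim

theorem HasTy.canon_ref {S : Store} {i : Layer} {V : Tm} {T : Ty} (h : Typed S i V (.ref T))
    (hV : V.IsValue) : ∃ l, V = .loc l ∧ S.lookup l = some T := by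
  cases h with
  | loc _ h _ => exact ⟨_, rfl, h⟩
  | lvar _ h => cases h
  | bvar _ h => cases h
  | name _ h => cases h
  | _ => exact hV.elim

theorem HasTy.canon_arrow {S : Store} {i : Layer} {V : Tm} {T₁ T₂ : Ty}
    (h : Typed S i V (.arrow T₁ T₂)) (hV : V.IsValue) :
    (∃ M, V = .lam M) ∨ (∃ M, V = .recf M) ∨ ∃ n, V = .name n := by
  cases h with
  | lam => exact Or.inl ⟨_, rfl⟩
  | recf => exact Or.inr (Or.inl ⟨_, rfl⟩)
  | name => exact Or.inr (Or.inr ⟨_, rfl⟩)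
  | lvar _ h => cases h
  | bvar _ h => cases h
  | _ => exact hV.elim

theorem HasTy.canon_box {S : Store} {i : Layer} {V : Tm} {Γ : LCtx} {T : Ty}
    (h : Typed S i V (.box Γ T)) (hV : V.IsValue) :
    (∃ M, V = .box M ∧ HasTy S [] Γ [] 0 M T) ∨
      ∃ n, V = .name n ∧ NameOf n (.box Γ T) 1 := by
  cases h with
  | box _ h => exact Or.inl ⟨_, rfl, h⟩
  | name _ h => exact Or.inr ⟨_, rfl, by cases h; exact .bx _ (by assumption)⟩
  | lvar _ h => cases h
  | bvar _ h => cases h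
  | _ => exact hV.elim

/-! ## Concretization of redexes -/

section

variable {r : Loc → Loc} {c : Name → Tm}

theorem HasTy.someSc {S : Store} {Ψ : GCtx} {Γ : LCtx} {Δ : List Ty} {i : Layer} {M : Tm}
    {T : Ty} (h : HasTy S Ψ Γ Δ i M T) : SomeSc M := ⟨_, _, _, h.sc⟩

theorem conc_betaSub (hc : GoodEnv c) {M V : Tm} (hM : SomeSc M) (hV : SomeSc V) :
    conc r c (M.subL (betaSub V) .lvar) = (conc r c M).subL (betaSub (conc r c V)) .lvar := by
  obtain ⟨Ψ, X, k, hM⟩ := hM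
  rw [conc_subL hc hM _ SomeSc.lvar]
  · congr 1; funext n
    match n with
    | 0 => rfl
    | n + 1 => rfl
  · intro n
    match n with
    | 0 => exact hV
    | n + 1 => exact SomeSc.bvar n

theorem conc_recSub (hc : GoodEnv c) {M V W : Tm} (hM : SomeSc M) (hV : SomeSc V)
    (hW : SomeSc W) : conc r c (M.subL (recSub V W) .lvar) =
      (conc r c M).subL (recSub (conc r c V) (conc r c W)) .lvar := by
  obtain ⟨Ψ, X, k, hM⟩ := hM
  rw [conc_subL hc hM _ SomeSc.lvar]
  · congr 1; funext n
    match n with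
    | 0 => rfl
    | 1 => rfl
    | n + 2 => rfl
  · intro n
    match n with
    | 0 => exact hV
    | 1 => exact hW
    | n + 2 => exact SomeSc.bvar n

theorem Code.Typed.sc {S : Store} {Ψ : GCtx} {p : LCtx × Ty} {k : Code} (h : k.Typed S Ψ p) :
    k.Sc (Ψ.map (fun p => LCtx.dom p.1)) p.1.dom := by
  cases k with
  | var u => exact (List.getElem?_map).trans (congrArg _ h)
  | hash b => exact (NameOf.dom_box h).symm
  | term N => exact HasTy.sc h

theorem conc_boxSub (hc : GoodEnv c) {S : Store} {p : LCtx × Ty} {N : Tm} {T : Ty} {k : Code}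
    (hN : HasTy S [p] [] [] 1 N T) (hk : k.Typed S [] p) :
    conc r c (N.subG (boxSub k)) = (conc r c N).subG (boxSub (concCode r c k)) := by
  rw [conc_subG hc (Ψ' := []) hN.sc]
  · congr 1; funext n
    match n with
    | 0 => rfl
    | n + 1 => rfl
  · intro u d hu
    match u with
    | 0 => cases hu; exact hk.sc
    | u + 1 => cases hu

end

/-! ## The reductions of a term and those of its concretization -/

/-- The heap `H` contains the concretization of `h`. -/
structure HRel (r : Loc → Loc) (c : Name → Tm) (h H : Heap) : Prop where
  map : ∀ l V, h.lookup l = some V → H.lookup (r l) = some (conc r c V)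
  inj : ∀ l l', l ∈ h → l' ∈ h → r l = r l' → l = l'

/-- `(h', r', H')` is a later stage of `(h, r, H)`. -/
structure Evolves (r r' : Loc → Loc) (h h' H H' : Heap) : Prop where
  ren : ∀ l ∈ h, r' l = r l
  sub : h.locs ⊆ h'.locs
  fresh : ∀ l ∈ h', l ∈ h ∨ r' l ∉ H
  frame : ∀ L ∈ H, (∀ l ∈ h, r l ≠ L) → H'.lookup L = H.lookup L

theorem Evolves.refl (r : Loc → Loc) (h H : Heap) : Evolves r r h h H H :=
  ⟨fun _ _ => rfl, subset_rfl, fun _ h => Or.inl h, fun _ _ _ => rfl⟩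

section

variable {c : Name → Tm} {r : Loc → Loc} {h H : Heap} {PN : Set Name}

theorem HRel.mem (hr : HRel r c h H) {l : Loc} (hl : l ∈ h) : r l ∈ H :=
  let ⟨_, hV⟩ := Finmap.mem_iff.1 hl; Finmap.mem_of_lookup_eq_some (hr.map _ _ hV)

theorem HRel.lookup_inv (hr : HRel r c h H) {l : Loc} (hl : l ∈ h) {W : Tm}
    (hW : H.lookup (r l) = some W) : ∃ V, h.lookup l = some V ∧ W = conc r c V := by
  obtain ⟨V, hV⟩ := Finmap.mem_iff.1 hl
  exact ⟨V, hV, Option.some.inj (hW.symm.trans (hr.map _ _ hV))⟩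

theorem HRel.assign (hr : HRel r c h H) {l : Loc} (hl : l ∈ h) (V : Tm) :
    HRel r c (h.insert l V) (H.insert (r l) (conc r c V)) ∧
      Evolves r r h (h.insert l V) H (H.insert (r l) (conc r c V)) := by
  have hmem : ∀ l', l' ∈ (h.insert l V : Heap) → l' ∈ h := by
    intro l' hl'
    rcases Finmap.mem_insert.1 hl' with rfl | h
    exacts [hl, h]
  refine ⟨⟨fun l' W hW => ?_, fun a b ha hb => hr.inj a b (hmem a ha) (hmem b hb)⟩,
    ⟨fun _ _ => rfl, h.locs_insert l V, fun l' hl' => Or.inl (hmem l' hl'), fun L _ hne => ?_⟩⟩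
  · rcases Heap.lookup_insert_cases hW with ⟨rfl, rfl⟩ | ⟨hne, hW⟩
    · exact Finmap.lookup_insert _
    · rw [Finmap.lookup_insert_of_ne]
      · exact hr.map _ _ hW
      · exact fun e => hne (hr.inj _ _ (Finmap.mem_of_lookup_eq_some hW) hl e)
  · exact Finmap.lookup_insert_of_ne _ (fun e => hne l hl e.symm)

/-- `r'` differs from `r` at the new location at most, so old values concretize as before. Freshness
of `L` in `H` keeps the renaming injective. -/
theorem HRel.alloc (hr : HRel r c h H) (hh : h.Occ PN) {l L : Loc} (hl : l ∉ h) (hL : L ∉ H)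
    {V : Tm} (hV : Occ PN h.locs V) {r' : Loc → Loc} (hr' : ∀ x ∈ h, r' x = r x) (hl' : r' l = L) :
    HRel r' c (h.insert l V) (H.insert L (conc r c V)) ∧
      Evolves r r' h (h.insert l V) H (H.insert L (conc r c V)) := by
  subst hl'
  have hcc : ∀ W, Occ PN h.locs W → conc r' c W = conc r c W := fun W hW =>
    hW.conc_congr (fun x hx => hr' x hx) (fun _ _ => rfl)
  refine ⟨⟨fun l' W hW => ?_, fun a b ha hb e => ?_⟩,
    ⟨hr', h.locs_insert l V, fun l' hl' => ?_, fun K hK hne => ?_⟩⟩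
  · rcases Heap.lookup_insert_cases hW with ⟨rfl, rfl⟩ | ⟨hne, hW⟩
    · rw [hcc _ hV]; exact Finmap.lookup_insert _
    · have hm := Finmap.mem_of_lookup_eq_some hW
      rw [Finmap.lookup_insert_of_ne, hr' _ hm, hcc _ (hh _ _ hW)]
      · exact hr.map _ _ hW
      · intro e; rw [hr' _ hm] at e; exact hL (e ▸ hr.mem hm)
  · rcases Finmap.mem_insert.1 ha with ha' | ha' <;>
      rcases Finmap.mem_insert.1 hb with hb' | hb'
    · exact ha'.trans hb'.symm
    · rw [hr' _ hb', ha'] at e; exact absurd (hr.mem hb') (e ▸ hL)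
    · rw [hr' _ ha', hb'] at e; exact absurd (hr.mem ha') (e ▸ hL)
    · rw [hr' _ ha', hr' _ hb'] at e; exact hr.inj _ _ ha' hb' e
  · rcases Finmap.mem_insert.1 hl' with rfl | h
    exacts [Or.inr hL, Or.inl h]
  · exact Finmap.lookup_insert_of_ne _ (fun e => hL (e ▸ hK))

theorem Evolves.conc_eq {r' : Loc → Loc} {h' H' : Heap} (he : Evolves r r' h h' H H') {M : Tm}
    (hM : Occ PN h.locs M) : conc r' c M = conc r c M :=
  hM.conc_congr (fun l hl => he.ren l hl) (fun _ _ => rfl)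

theorem codeOf_of_box {b : Name} {N : Tm} (hb : c b = .box N) : codeOf c b = .term N := by
  simp [codeOf, hb, Tm.code]

/-- Every box name with an interpretation that has a box type is interpreted by a box. -/
def BoxEnv (PN : Set Name) (c : Name → Tm) : Prop :=
  ∀ (Γ : LCtx) (T : Ty) (k : ℕ), .bx Γ T k ∈ PN → ∃ N, c (.bx Γ T k) = .box N

/-- Redexes correspond rule by rule, because concretization preserves values and commutes with
substitution. The exception is allocation: the new location may be in use in `H` by the other side,
so it is given another image there, and the renaming changes. -/
theorem CStep.sim (hc : GoodEnv c) (hb : BoxEnv PN c) {M M' : Tm} {h' : Heap}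
    (hs : CStep M h M' h') :
    ∀ {S : Store} {T : Ty}, Typed S 1 M T → Occ PN h.locs M → h.Occ PN → HRel r c h H →
    ∃ r' H', CStep (conc r c M) H (conc r' c M') H' ∧ HRel r' c h' H' ∧
      Evolves r r' h h' H H' := by
  induction hs with
  | beta hV =>
    intro S T hM ho hh hr
    cases hM with
    | app h₁ h₂ =>
      cases h₁ with
      | lam h₁ =>
        refine ⟨r, H, ?_, hr, .refl _ _ _⟩
        rw [conc_betaSub hc h₁.someSc h₂.someSc]
        exact .beta (conc_isValue hc hV)
  | arith => intro S T hM ho hh hr; exact ⟨r, H, .arith, hr, .refl _ _ _⟩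
  | iteTrue hn => intro S T hM ho hh hr; exact ⟨r, H, .iteTrue hn, hr, .refl _ _ _⟩
  | iteFalse => intro S T hM ho hh hr; exact ⟨r, H, .iteFalse, hr, .refl _ _ _⟩
  | @ref V h l hV hl =>
    intro S T hM ho hh hr
    -- `l` is fresh for `h` only, whereas its image has to be fresh for the composed heap.
    obtain ⟨L, hL⟩ := Infinite.exists_notMem_finset H.keys
    rw [Finmap.mem_keys] at hL
    obtain ⟨h₁, h₂⟩ := hr.alloc (r' := Function.update r l L) (V := V) hh hl hL ho
      (fun x hx => Function.update_of_ne (by rintro rfl; exact hl hx) _ _)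
      (Function.update_self _ _ _)
    refine ⟨_, _, ?_, h₁, h₂⟩
    simp only [conc, Function.update_self]
    exact .ref (conc_isValue hc hV) hL
  | deref hl =>
    intro S T hM ho hh hr; exact ⟨r, H, .deref (hr.map _ _ hl), hr, .refl _ _ _⟩
  | @assign V h l hV hl =>
    intro S T hM ho hh hr
    obtain ⟨h₁, h₂⟩ := hr.assign hl V
    exact ⟨r, _, .assign (conc_isValue hc hV) (hr.mem hl), h₁, h₂⟩
  | recf hV =>
    intro S T hM ho hh hr
    cases hM with
    | app h₁ h₂ =>
      have h₁' := h₁.someSc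
      cases h₁ with
      | recf h₁ =>
        refine ⟨r, H, ?_, hr, .refl _ _ _⟩
        rw [conc_recSub hc h₁.someSc h₂.someSc h₁']
        exact .recf (conc_isValue hc hV)
  | letbox =>
    intro S T hM ho hh hr
    cases hM with
    | letbox h₁ h₂ =>
      cases h₁ with
      | box hw h₁ =>
        refine ⟨r, H, ?_, hr, .refl _ _ _⟩
        rw [conc_boxSub (k := .term _) hc h₂ h₁]
        exact .letbox
  | @letboxName Γ T₀ k N h =>
    intro S T hM ho hh hr
    cases hM with
    | letbox h₁ h₂ =>
      -- The name stands for a box, so the concrete `letbox` reduces by the rule for boxes, with the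
      -- code that `#b` denotes.
      obtain ⟨P, hP⟩ := hb _ _ _ ho.1
      refine ⟨r, H, ?_, hr, .refl _ _ _⟩
      rcases h₁.canon_box trivial with ⟨_, h, _⟩ | ⟨n, hn, hn'⟩
      · cases h
      · cases hn
        rw [conc_boxSub (k := .hash _) hc h₂ hn']
        simp only [conc, concCode, codeOf_of_box hP, hP]
        exact .letbox
  | appL _ ih =>
    intro S T hM ho hh hr
    cases hM with
    | app h₁ h₂ =>
      obtain ⟨r', H', h₃, h₄, h₅⟩ := ih h₁ ho.1 hh hr
      refine ⟨r', H', ?_, h₄, h₅⟩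
      simp only [conc, h₅.conc_eq ho.2]; exact .appL h₃
  | appR hV _ ih =>
    intro S T hM ho hh hr
    cases hM with
    | app h₁ h₂ =>
      obtain ⟨r', H', h₃, h₄, h₅⟩ := ih h₂ ho.2 hh hr
      refine ⟨r', H', ?_, h₄, h₅⟩
      simp only [conc, h₅.conc_eq ho.1]; exact .appR (conc_isValue hc hV) h₃
  | arithL _ ih =>
    intro S T hM ho hh hr
    cases hM with
    | arith _ h₁ h₂ =>
      obtain ⟨r', H', h₃, h₄, h₅⟩ := ih h₁ ho.1 hh hr
      refine ⟨r', H', ?_, h₄, h₅⟩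
      simp only [conc, h₅.conc_eq ho.2]; exact .arithL h₃
  | arithR hV _ ih =>
    intro S T hM ho hh hr
    cases hM with
    | arith _ h₁ h₂ =>
      obtain ⟨r', H', h₃, h₄, h₅⟩ := ih h₂ ho.2 hh hr
      refine ⟨r', H', ?_, h₄, h₅⟩
      simp only [conc, h₅.conc_eq ho.1]; exact .arithR (conc_isValue hc hV) h₃
  | assignL _ ih =>
    intro S T hM ho hh hr
    cases hM with
    | assign h₁ h₂ =>
      obtain ⟨r', H', h₃, h₄, h₅⟩ := ih h₁ ho.1 hh hr
      refine ⟨r', H', ?_, h₄, h₅⟩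
      simp only [conc, h₅.conc_eq ho.2]; exact .assignL h₃
  | assignR hV _ ih =>
    intro S T hM ho hh hr
    cases hM with
    | assign h₁ h₂ =>
      obtain ⟨r', H', h₃, h₄, h₅⟩ := ih h₂ ho.2 hh hr
      refine ⟨r', H', ?_, h₄, h₅⟩
      simp only [conc, h₅.conc_eq ho.1]; exact .assignR (conc_isValue hc hV) h₃
  | iteC _ ih =>
    intro S T hM ho hh hr
    cases hM with
    | ite h₁ h₂ =>
      obtain ⟨r', H', h₃, h₄, h₅⟩ := ih h₁ ho.1 hh hr
      refine ⟨r', H', ?_, h₄, h₅⟩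
      simp only [conc, h₅.conc_eq ho.2.1, h₅.conc_eq ho.2.2]; exact .iteC h₃
  | refC _ ih =>
    intro S T hM ho hh hr
    cases hM with
    | ref h₁ =>
      obtain ⟨r', H', h₃, h₄, h₅⟩ := ih h₁ ho hh hr
      exact ⟨r', H', .refC h₃, h₄, h₅⟩
  | derefC _ ih =>
    intro S T hM ho hh hr
    cases hM with
    | deref h₁ =>
      obtain ⟨r', H', h₃, h₄, h₅⟩ := ih h₁ ho hh hr
      exact ⟨r', H', .derefC h₃, h₄, h₅⟩
  | letboxC _ ih =>
    intro S T hM ho hh hr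
    cases hM with
    | letbox h₁ h₂ =>
      obtain ⟨r', H', h₃, h₄, h₅⟩ := ih h₁ ho.1 hh hr
      refine ⟨r', H', ?_, h₄, h₅⟩
      simp only [conc, h₅.conc_eq ho.2]; exact .letboxC h₃

end

/-! ### Terms about to ask a question -/

/-- Composition of evaluation contexts. -/
def ECtx.comp : ECtx → ECtx → ECtx
  | .hole, L => L
  | .appL K N, L => .appL (K.comp L) N
  | .appR V hV K, L => .appR V hV (K.comp L)
  | .arithL o K N, L => .arithL o (K.comp L) N
  | .arithR o V hV K, L => .arithR o V hV (K.comp L)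
  | .ite K N P, L => .ite (K.comp L) N P
  | .ref K, L => .ref (K.comp L)
  | .deref K, L => .deref (K.comp L)
  | .assignL K N, L => .assignL (K.comp L) N
  | .assignR V hV K, L => .assignR V hV (K.comp L)
  | .letbox K N, L => .letbox (K.comp L) N

theorem ECtx.plug_comp (K L : ECtx) (M : Tm) : (K.comp L).plug M = K.plug (L.plug M) := by
  induction K <;> simp_all [ECtx.comp, ECtx.plug]

/-- Terms that are about to ask a question. -/
def External (M : Tm) : Prop :=
  (∃ (K : ECtx) (f : Name) (V : Tm), V.IsValue ∧ M = K.plug (.app (.name f) V)) ∨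
    ∃ (K : ECtx) (b : Name) (d : Finset LVar) (s : {x // x ∈ d} → Tm), M = K.plug (.unbox b d s)

theorem External.plug {M : Tm} (h : External M) (K : ECtx) : External (K.plug M) := by
  rcases h with ⟨L, f, V, hV, rfl⟩ | ⟨L, b, d, s, rfl⟩
  · exact Or.inl ⟨K.comp L, f, V, hV, (ECtx.plug_comp _ _ _).symm⟩
  · exact Or.inr ⟨K.comp L, b, d, s, (ECtx.plug_comp _ _ _).symm⟩

theorem External.unbox (b : Name) (d : Finset LVar) (s : {x // x ∈ d} → Tm) :
    External (.unbox b d s) := Or.inr ⟨.hole, b, d, s, rfl⟩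

theorem conc_value_cases {r : Loc → Loc} {c : Name → Tm} {M : Tm} (h : (conc r c M).IsValue) :
    M.IsValue ∨ External M := by
  rcases conc_isValue_inv h with h | ⟨b, d, s, rfl⟩
  exacts [Or.inl h, Or.inr (.unbox b d s)]

/-! ### Reflection of the reductions of a concretization -/

section

variable {c : Name → Tm} {PN : Set Name} {h : Heap}

/-- The conclusion of `CStep.back`. -/
def Reflected (c : Name → Tm) (M : Tm) (h : Heap) (N : Tm) (H H' : Heap) : Prop :=
  ∃ M' h', CStep M h M' h' ∧ N = conc id c M' ∧ HRel id c h' H' ∧ Evolves id id h h' H H'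

/-- `f` is an elementary context and `g` its concretization. The renaming is the identity before and
after the step, so the siblings of the reduced term concretize as before. -/
theorem Reflected.ctx {M : Tm} {N : Tm} {H H' : Heap} (hx : Reflected c M h N H H')
    {f g : Tm → Tm}
    (hf : ∀ {M' h'}, CStep M h M' h' → CStep (f M) h (f M') h')
    (hg : ∀ {M' h'}, Evolves id id h h' H H' → g (conc id c M') = conc id c (f M')) :
    Reflected c (f M) h (g N) H H' := by
  obtain ⟨M', h', h₁, rfl, h₃, h₄⟩ := hx
  exact ⟨f M', h', hf h₁, hg h₄, h₃, h₄⟩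

theorem not_value_cases (c : Name → Tm) {M : Tm} (h : ¬ M.IsValue) :
    External M ∨ ¬ (conc id c M).IsValue := by
  by_cases hv : (conc id c M).IsValue
  · exact Or.inl ((conc_value_cases hv).resolve_left h)
  · exact Or.inr hv

/-- Induction on the term, in evaluation order. If the subterm to be evaluated next is not a value,
either it is about to ask a question, or its concretization is not a value either and the step takes
place in it. If the relevant subterms are values, their canonical forms determine the redex, except
when a name is applied, which is a question. -/
theorem CStep.back (hc : GoodEnv c) {M : Tm} :
    ∀ {S : Store} {T : Ty} {H H' : Heap} {N : Tm}, Typed S 1 M T → HeapTy S h →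
    Occ PN h.locs M → h.Occ PN → HRel id c h H → CStep (conc id c M) H N H' →
    External M ∨ Reflected c M h N H H' := by
  induction M with
  | app M P ihM ihP =>
    intro S T H H' N ht hS ho hh hr hs
    cases ht with
    | app h₁ h₂ =>
      by_cases hM : M.IsValue
      · by_cases hP : P.IsValue
        · rcases h₁.canon_arrow hM with ⟨B, rfl⟩ | ⟨B, rfl⟩ | ⟨n, rfl⟩
          · right
            have hP' := conc_isValue (r := id) hc hP
            have e := conc_betaSub (r := id) hc (M := B) (V := P)
              (by cases h₁ with | lam h => exact h.someSc) h₂.someSc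
            simp only [conc] at hs
            -- Concretized subterms are made opaque, so that inversion of the step does not look
            -- inside `conc`.
            generalize conc id c P = Q at hs hP' e
            cases hs with
            | beta _ => exact ⟨_, _, .beta hP, e.symm, hr, .refl _ _ _⟩
            | appL hs => exact absurd trivial hs.not_isValue
            | appR _ hs => exact absurd hP' hs.not_isValue
          · right
            have hP' := conc_isValue (r := id) hc hP
            have e := conc_recSub (r := id) hc (M := B) (V := P) (W := .recf B)
              (by cases h₁ with | recf h => exact h.someSc) h₂.someSc h₁.someSc
            simp only [conc] at hs e
            generalize conc id c P = Q at hs hP' e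
            cases hs with
            | recf _ => exact ⟨_, _, .recf hP, e.symm, hr, .refl _ _ _⟩
            | appL hs => exact absurd trivial hs.not_isValue
            | appR _ hs => exact absurd hP' hs.not_isValue
          · exact Or.inl (Or.inl ⟨.hole, n, P, hP, rfl⟩)
        · rcases not_value_cases c hP with hP | hP
          · exact Or.inl (hP.plug (.appR M hM .hole))
          · have hM' := conc_isValue (r := id) hc hM
            have ih := fun N => @ihP _ _ H H' N h₂ hS ho.2 hh hr
            simp only [conc] at hs
            generalize hX : conc id c P = X at hs hP ih
            generalize hY : conc id c M = Y at hs hM'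
            cases hs with
            | beta h => exact absurd h hP
            | recf h => exact absurd h hP
            | appL hs => exact absurd hM' hs.not_isValue
            | appR _ hs =>
              refine (ih _ hs).imp (fun h => h.plug (.appR M hM .hole)) (fun h => ?_)
              refine h.ctx (f := fun P => .app M P) (g := fun P => .app Y P)
                (fun h => .appR hM h) (fun h => ?_)
              simp only [conc]; rw [hY]
      · rcases not_value_cases c hM with hM | hM
        · exact Or.inl (hM.plug (.appL .hole P))
        · have ih := fun N => @ihM _ _ H H' N h₁ hS ho.1 hh hr
          simp only [conc] at hs
          generalize hX : conc id c M = X at hs hM ih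
          generalize hY : conc id c P = Y at hs
          cases hs with
          | beta h => exact absurd trivial hM
          | recf h => exact absurd trivial hM
          | appR h hs => exact absurd h hM
          | appL hs =>
            refine (ih _ hs).imp (fun h => h.plug (.appL .hole P)) (fun h => ?_)
            refine h.ctx (f := fun M => .app M P) (g := fun M => .app M Y)
              (fun h => .appL h) (fun h => ?_)
            simp only [conc]; rw [hY]
  | arith o M P ihM ihP =>
    intro S T H H' N ht hS ho hh hr hs
    cases ht with
    | arith _ h₁ h₂ =>
      by_cases hM : M.IsValue
      · by_cases hP : P.IsValue
        · obtain ⟨m, rfl⟩ := h₁.canon_int hM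
          obtain ⟨n, rfl⟩ := h₂.canon_int hP
          simp only [conc] at hs
          cases hs with
          | arith => exact Or.inr ⟨_, _, .arith, rfl, hr, .refl _ _ _⟩
          | arithL hs => exact absurd trivial hs.not_isValue
          | arithR _ hs => exact absurd trivial hs.not_isValue
        · rcases not_value_cases c hP with hP | hP
          · exact Or.inl (hP.plug (.arithR o M hM .hole))
          · have hM' := conc_isValue (r := id) hc hM
            have ih := fun N => @ihP _ _ H H' N h₂ hS ho.2 hh hr
            simp only [conc] at hs
            generalize hX : conc id c P = X at hs hP ih
            generalize hY : conc id c M = Y at hs hM'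
            cases hs with
            | arith => exact absurd trivial hP
            | arithL hs => exact absurd hM' hs.not_isValue
            | arithR _ hs =>
              refine (ih _ hs).imp (fun h => h.plug (.arithR o M hM .hole)) (fun h => ?_)
              refine h.ctx (f := fun P => .arith o M P) (g := fun P => .arith o Y P)
                (fun h => .arithR hM h) (fun h => ?_)
              simp only [conc]; rw [hY]
      · rcases not_value_cases c hM with hM | hM
        · exact Or.inl (hM.plug (.arithL o .hole P))
        · have ih := fun N => @ihM _ _ H H' N h₁ hS ho.1 hh hr
          simp only [conc] at hs
          generalize hX : conc id c M = X at hs hM ih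
          generalize hY : conc id c P = Y at hs
          cases hs with
          | arith => exact absurd trivial hM
          | arithR h hs => exact absurd h hM
          | arithL hs =>
            refine (ih _ hs).imp (fun h => h.plug (.arithL o .hole P)) (fun h => ?_)
            refine h.ctx (f := fun M => .arith o M P) (g := fun M => .arith o M Y)
              (fun h => .arithL h) (fun h => ?_)
            simp only [conc]; rw [hY]
  | assign M P ihM ihP =>
    intro S T H H' N ht hS ho hh hr hs
    cases ht with
    | assign h₁ h₂ =>
      by_cases hM : M.IsValue
      · obtain ⟨l, rfl, hl⟩ := h₁.canon_ref hM
        by_cases hP : P.IsValue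
        · have hP' := conc_isValue (r := id) hc hP
          have hl' : l ∈ h := (hS.keys l).1 (Finmap.mem_of_lookup_eq_some hl)
          have ha := hr.assign hl' P
          simp only [conc] at hs
          generalize conc id c P = Q at hs hP' ha
          cases hs with
          | assign _ _ => exact Or.inr ⟨_, _, .assign hP hl', rfl, ha.1, ha.2⟩
          | assignL hs => exact absurd trivial hs.not_isValue
          | assignR _ hs => exact absurd hP' hs.not_isValue
        · rcases not_value_cases c hP with hP | hP
          · exact Or.inl (hP.plug (.assignR _ hM .hole))
          · have ih := fun N => @ihP _ _ H H' N h₂ hS ho.2 hh hr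
            simp only [conc] at hs
            generalize hX : conc id c P = X at hs hP ih
            cases hs with
            | assign h => exact absurd h hP
            | assignL hs => exact absurd trivial hs.not_isValue
            | assignR _ hs =>
              refine (ih _ hs).imp (fun h => h.plug (.assignR _ hM .hole)) (fun h => ?_)
              exact h.ctx (f := fun P => .assign (.loc l) P) (g := fun P => .assign (.loc l) P)
                (fun h => .assignR hM h) (fun h => rfl)
      · rcases not_value_cases c hM with hM | hM
        · exact Or.inl (hM.plug (.assignL .hole P))
        · have ih := fun N => @ihM _ _ H H' N h₁ hS ho.1 hh hr
          simp only [conc] at hs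
          generalize hX : conc id c M = X at hs hM ih
          generalize hY : conc id c P = Y at hs
          cases hs with
          | assign => exact absurd trivial hM
          | assignR h hs => exact absurd h hM
          | assignL hs =>
            refine (ih _ hs).imp (fun h => h.plug (.assignL .hole P)) (fun h => ?_)
            refine h.ctx (f := fun M => .assign M P) (g := fun M => .assign M Y)
              (fun h => .assignL h) (fun h => ?_)
            simp only [conc]; rw [hY]
  | ite M P Q ihM ihP ihQ =>
    intro S T H H' N ht hS ho hh hr hs
    cases ht with
    | ite h₁ h₂ h₃ =>
      by_cases hM : M.IsValue
      · obtain ⟨m, rfl⟩ := h₁.canon_int hM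
        simp only [conc] at hs
        cases hs with
        | iteTrue hn => exact Or.inr ⟨_, _, .iteTrue hn, rfl, hr, .refl _ _ _⟩
        | iteFalse => exact Or.inr ⟨_, _, .iteFalse, rfl, hr, .refl _ _ _⟩
        | iteC hs => exact absurd trivial hs.not_isValue
      · rcases not_value_cases c hM with hM | hM
        · exact Or.inl (hM.plug (.ite .hole P Q))
        · have ih := fun N => @ihM _ _ H H' N h₁ hS ho.1 hh hr
          simp only [conc] at hs
          generalize hX : conc id c M = X at hs hM ih
          generalize hY : conc id c P = Y at hs
          generalize hZ : conc id c Q = Z at hs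
          cases hs with
          | iteTrue hn => exact absurd trivial hM
          | iteFalse => exact absurd trivial hM
          | iteC hs =>
            refine (ih _ hs).imp (fun h => h.plug (.ite .hole P Q)) (fun h => ?_)
            refine h.ctx (f := fun M => .ite M P Q) (g := fun M => .ite M Y Z)
              (fun h => .iteC h) (fun h => ?_)
            simp only [conc]; rw [hY, hZ]
  | ref M ihM =>
    intro S T H H' N ht hS ho hh hr hs
    cases ht with
    | ref h₁ =>
      by_cases hM : M.IsValue
      · have hM' := conc_isValue (r := id) hc hM
        -- With the identity renaming, a location fresh in `H` is fresh in `h`, so the term can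
        -- allocate the very location that its concretization allocates.
        have ha := fun {l} hl => hr.alloc (l := l) (L := l) (V := M) (r' := id) hh
          (fun h' => hl (hr.mem h')) hl ho (fun _ _ => rfl) rfl
        simp only [conc] at hs
        generalize conc id c M = Q at hs hM' ha
        cases hs with
        | ref _ hl =>
          exact Or.inr ⟨_, _, .ref hM (fun h' => hl (hr.mem h')), rfl, (ha hl).1, (ha hl).2⟩
        | refC hs => exact absurd hM' hs.not_isValue
      · rcases not_value_cases c hM with hM | hM
        · exact Or.inl (hM.plug (.ref .hole))
        · have ih := fun N => @ihM _ _ H H' N h₁ hS ho hh hr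
          simp only [conc] at hs
          generalize hX : conc id c M = X at hs hM ih
          cases hs with
          | ref hn => exact absurd hn hM
          | refC hs =>
            refine (ih _ hs).imp (fun h => h.plug (.ref .hole)) (fun h => ?_)
            exact h.ctx (f := .ref) (g := .ref) (fun h => .refC h) (fun h => rfl)
  | deref M ihM =>
    intro S T H H' N ht hS ho hh hr hs
    cases ht with
    | deref h₁ =>
      by_cases hM : M.IsValue
      · obtain ⟨l, rfl, hl⟩ := h₁.canon_ref hM
        simp only [conc] at hs
        cases hs with
        | deref hn =>
          obtain ⟨V, hV, rfl⟩ :=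
            hr.lookup_inv ((hS.keys l).1 (Finmap.mem_of_lookup_eq_some hl)) hn
          exact Or.inr ⟨_, _, .deref hV, rfl, hr, .refl _ _ _⟩
        | derefC hs => exact absurd trivial hs.not_isValue
      · rcases not_value_cases c hM with hM | hM
        · exact Or.inl (hM.plug (.deref .hole))
        · have ih := fun N => @ihM _ _ H H' N h₁ hS ho hh hr
          simp only [conc] at hs
          generalize hX : conc id c M = X at hs hM ih
          cases hs with
          | deref hn => exact absurd trivial hM
          | derefC hs =>
            refine (ih _ hs).imp (fun h => h.plug (.deref .hole)) (fun h => ?_)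
            exact h.ctx (f := .deref) (g := .deref) (fun h => .derefC h) (fun h => rfl)
  | letbox M P ihM ihP =>
    intro S T H H' N ht hS ho hh hr hs
    cases ht with
    | letbox h₁ h₂ =>
      by_cases hM : M.IsValue
      · right
        rcases h₁.canon_box hM with ⟨B, rfl, hB⟩ | ⟨n, rfl, hn⟩
        · have e := conc_boxSub (r := id) (k := .term B) hc h₂ hB
          simp only [conc] at hs
          cases hs with
          | letbox => exact ⟨_, _, .letbox, e.symm, hr, .refl _ _ _⟩
          | letboxC hs => exact absurd trivial hs.not_isValue
        · have e := conc_boxSub (r := id) (k := .hash n) hc h₂ hn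
          simp only [conc] at hs
          have hv := hc.value n
          have hnn := hc.not_name n
          generalize hX : c n = X at hs hv hnn
          cases hs with
          | letbox =>
            cases hn with
            | bx k hw =>
              refine ⟨_, _, .letboxName, ?_, hr, .refl _ _ _⟩
              rw [e]; simp only [concCode, codeOf_of_box hX]
          | letboxName => exact absurd rfl (hnn _)
          | letboxC hs => exact absurd hv hs.not_isValue
      · rcases not_value_cases c hM with hM | hM
        · exact Or.inl (hM.plug (.letbox .hole P))
        · have ih := fun N => @ihM _ _ H H' N h₁ hS ho.1 hh hr
          simp only [conc] at hs
          generalize hX : conc id c M = X at hs hM ih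
          generalize hY : conc id c P = Y at hs
          cases hs with
          | letbox => exact absurd trivial hM
          | letboxName => exact absurd trivial hM
          | letboxC hs =>
            refine (ih _ hs).imp (fun h => h.plug (.letbox .hole P)) (fun h => ?_)
            refine h.ctx (f := fun M => .letbox M P) (g := fun M => .letbox M Y)
              (fun h => .letboxC h) (fun h => ?_)
            simp only [conc]; rw [hY]
  | unbox b d s => intro S T H H' N ht hS ho hh hr hs; exact Or.inl (.unbox b d s)
  | gvar u d s =>
    intro S T H H' N ht hS ho hh hr hs
    cases ht with | gvar _ hu => cases hu
  | name n =>
    intro S T H H' N ht hS ho hh hr hs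
    exact absurd (hc.value n) hs.not_isValue
  | _ =>
    intro S T H H' N ht hS ho hh hr hs
    exact absurd trivial hs.not_isValue

end

/-! ## Evaluation contexts -/

def ECtx.Occ (PN : Set Name) (PL : Set Loc) : ECtx → Prop
  | .hole => True
  | .appL K N | .arithL _ K N | .assignL K N | .letbox K N => K.Occ PN PL ∧ LMML.Occ PN PL N
  | .appR V _ K | .arithR _ V _ K | .assignR V _ K => LMML.Occ PN PL V ∧ K.Occ PN PL
  | .ite K N P => K.Occ PN PL ∧ LMML.Occ PN PL N ∧ LMML.Occ PN PL P
  | .ref K | .deref K => K.Occ PN PL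

theorem ECtx.occ_plug {PN : Set Name} {PL : Set Loc} (K : ECtx) (M : Tm) :
    LMML.Occ PN PL (K.plug M) ↔ K.Occ PN PL ∧ LMML.Occ PN PL M := by
  induction K <;> simp_all [ECtx.plug, ECtx.Occ, LMML.Occ] <;> tauto

theorem ECtx.Occ.mono {PN PN' : Set Name} {PL PL' : Set Loc} {K : ECtx} (h : K.Occ PN PL)
    (hN : PN ⊆ PN') (hL : PL ⊆ PL') : K.Occ PN' PL' :=
  ((ECtx.occ_plug K .unit).1 (((ECtx.occ_plug K .unit).2 ⟨h, trivial⟩).mono hN hL)).1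

def concE (r : Loc → Loc) {c : Name → Tm} (hc : GoodEnv c) : ECtx → ECtx
  | .hole => .hole
  | .appL K N => .appL (concE r hc K) (conc r c N)
  | .appR V hV K => .appR (conc r c V) (conc_isValue hc hV) (concE r hc K)
  | .arithL o K N => .arithL o (concE r hc K) (conc r c N)
  | .arithR o V hV K => .arithR o (conc r c V) (conc_isValue hc hV) (concE r hc K)
  | .ite K N P => .ite (concE r hc K) (conc r c N) (conc r c P)
  | .ref K => .ref (concE r hc K)
  | .deref K => .deref (concE r hc K)
  | .assignL K N => .assignL (concE r hc K) (conc r c N)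
  | .assignR V hV K => .assignR (conc r c V) (conc_isValue hc hV) (concE r hc K)
  | .letbox K N => .letbox (concE r hc K) (conc r c N)

theorem conc_plug (r : Loc → Loc) {c : Name → Tm} (hc : GoodEnv c) (K : ECtx) (M : Tm) :
    conc r c (K.plug M) = (concE r hc K).plug (conc r c M) := by
  induction K <;> simp_all [ECtx.plug, concE, conc]

/-- The analogue of `Occ.conc_congr` for contexts: frames pushed earlier keep their meaning when
locations and names are added. -/
theorem concE_congr {PN : Set Name} {PL : Set Loc} {r r' : Loc → Loc} {c c' : Name → Tm}
    (hc : GoodEnv c) (hc' : GoodEnv c') (hr : ∀ l ∈ PL, r l = r' l) (hn : ∀ n ∈ PN, c n = c' n)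
    {K : ECtx} (h : K.Occ PN PL) : concE r hc K = concE r' hc' K := by
  have key : ∀ {M}, Occ PN PL M → conc r c M = conc r' c' M := fun hM => hM.conc_congr hr hn
  induction K with
  | hole => rfl
  | appL K N ih => simp only [concE]; rw [ih h.1, key h.2]
  | arithL o K N ih => simp only [concE]; rw [ih h.1, key h.2]
  | assignL K N ih => simp only [concE]; rw [ih h.1, key h.2]
  | letbox K N ih => simp only [concE]; rw [ih h.1, key h.2]
  | appR V hV K ih => simp only [concE]; congr 1; exacts [key h.1, ih h.2]
  | arithR o V hV K ih => simp only [concE]; congr 1; exacts [key h.1, ih h.2]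
  | assignR V hV K ih => simp only [concE]; congr 1; exacts [key h.1, ih h.2]
  | ite K N P ih => simp only [concE]; rw [ih h.1, key h.2.1, key h.2.2]
  | ref K ih => simp only [concE]; rw [ih h]
  | deref K ih => simp only [concE]; rw [ih h]

theorem concE_id {c : Name → Tm} (hc : GoodEnv c) {K : ECtx} (h : K.NameFree) :
    concE id hc K = K := by
  have key : ∀ {M : Tm}, M.NameFree → conc id c M = M := fun hM => hM.conc_id c
  induction K with
  | hole => rfl
  | appL K N ih => simp only [concE]; rw [ih h.1, key h.2]
  | arithL o K N ih => simp only [concE]; rw [ih h.1, key h.2]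
  | assignL K N ih => simp only [concE]; rw [ih h.1, key h.2]
  | letbox K N ih => simp only [concE]; rw [ih h.1, key h.2]
  | appR V hV K ih => simp only [concE]; congr 1; exacts [key h.1, ih h.2]
  | arithR o V hV K ih => simp only [concE]; congr 1; exacts [key h.1, ih h.2]
  | assignR V hV K ih => simp only [concE]; congr 1; exacts [key h.1, ih h.2]
  | ite K N P ih => simp only [concE]; rw [ih h.1, key h.2.1, key h.2.2]
  | ref K ih => simp only [concE]; rw [ih h]
  | deref K ih => simp only [concE]; rw [ih h]

/-! ## The two sides of an interaction -/

/-- One of the interacting configurations: its store context, heap and names, and the renaming of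
its locations to those of the composed program. -/
structure Side : Type where
  S : Store
  h : Heap
  γ : NMap
  r : Loc → Loc

def NMap.dom (γ : NMap) : Set Name := {n | ∃ V, γ n = some V}

/-- The names of one side, in terms of the names `PN` of the other side. -/
def NamesOk (X : Side) (PN : Set Name) (φ : Set Name) (c : Name → Tm) : Prop :=
  ∀ n V, X.γ n = some V → n ∈ φ ∧ V.IsValue ∧ Occ PN X.h.locs V ∧ c n = conc X.r c V ∧
    ∃ T i, NameOf n T i ∧ Typed X.S 1 V T

/-- The active side `A` and the passive side `P` have the heap `H` and the interpretation `c` of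
their names in common. The values that `P` holds at the shared locations are out of date. -/
structure Base (A P : Side) (c : Name → Tm) (φ : Set Name) (θ : Finset Loc) (H : Heap) : Prop where
  good : GoodEnv c
  boxA : BoxEnv A.γ.dom c
  boxP : BoxEnv P.γ.dom c
  heapA : HeapTy A.S A.h
  heapP : HeapTy P.S P.h
  occA : A.h.Occ P.γ.dom
  occP : P.h.Occ A.γ.dom
  relA : HRel A.r c A.h H
  relP : ∀ l V, P.h.lookup l = some V → l ∉ θ → H.lookup (P.r l) = some (conc P.r c V)
  injP : ∀ l l', l ∈ P.h → l' ∈ P.h → P.r l = P.r l' → l = l'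
  disj : ∀ l ∈ P.h, l ∉ θ → ∀ l' ∈ A.h, P.r l ≠ A.r l'
  shared : ∀ l ∈ θ, l ∈ A.h ∧ l ∈ P.h ∧ A.r l = P.r l
  namesA : NamesOk A P.γ.dom φ c
  namesP : NamesOk P A.γ.dom φ c

/-- `X'` is a later stage of `X`. -/
structure Side.Le (X X' : Side) : Prop where
  store : MapSub X.S X'.S
  wf : Store.Wf 1 X'.S
  locs : X.h.locs ⊆ X'.h.locs
  names : X.γ.dom ⊆ X'.γ.dom
  ren : ∀ l ∈ X.h, X'.r l = X.r l

theorem Side.Le.refl {X : Side} (h : Store.Wf 1 X.S) : X.Le X :=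
  ⟨.refl _, h, subset_rfl, subset_rfl, fun _ _ => rfl⟩

theorem NamesOk.later {X X' : Side} {PN : Set Name} {φ : Set Name} {c : Name → Tm}
    (h : NamesOk X PN φ c) (hle : X.Le X') (hγ : X'.γ = X.γ) : NamesOk X' PN φ c := by
  intro n V hn
  obtain ⟨h₁, h₂, h₃, h₄, T, i, h₅, h₆⟩ := h n V (hγ ▸ hn)
  refine ⟨h₁, h₂, h₃.mono subset_rfl hle.locs, ?_, T, i, h₅, h₆.store hle.store hle.wf⟩
  rw [h₄]
  exact h₃.conc_congr (fun l hl => (hle.ren l hl).symm) (fun _ _ => rfl)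

/-- The private locations of `P` are not images of locations of `A`, so `H` does not change there
(`Evolves.frame`). A location new to `A` is mapped outside the old `H`, which contains the private
part of `P` (`Evolves.fresh`). -/
theorem Base.step {A P : Side} {c : Name → Tm} {φ : Set Name} {θ : Finset Loc} {H : Heap}
    (hB : Base A P c φ θ H) {S' : Store} {h' H' : Heap} {r' : Loc → Loc}
    (hS : MapSub A.S S') (hh : HeapTy S' h') (ho : h'.Occ P.γ.dom) (hr : HRel r' c h' H')
    (he : Evolves A.r r' A.h h' H H') :
    Base ⟨S', h', A.γ, r'⟩ P c φ θ H' ∧ A.Le ⟨S', h', A.γ, r'⟩ := by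
  have hle : A.Le ⟨S', h', A.γ, r'⟩ := ⟨hS, hh.wf, he.sub, subset_rfl, he.ren⟩
  refine ⟨⟨hB.good, hB.boxA, hB.boxP, hh, hB.heapP, ho, hB.occP, hr, ?_, hB.injP, ?_, ?_,
    hB.namesA.later hle rfl, hB.namesP⟩, hle⟩
  · intro l V hl hθ
    have := hB.relP l V hl hθ
    rw [he.frame (P.r l) (Finmap.mem_of_lookup_eq_some this), this]
    exact fun l' hl' => (hB.disj l (Finmap.mem_of_lookup_eq_some hl) hθ l' hl').symm
  · intro l hl hθ l' hl'
    rcases he.fresh l' hl' with h | h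
    · simp only [he.ren l' h]; exact hB.disj l hl hθ l' h
    · obtain ⟨V, hV⟩ := Finmap.mem_iff.1 hl
      intro e
      change P.r l = r' l' at e
      exact h (e ▸ Finmap.mem_of_lookup_eq_some (hB.relP l V hV hθ))
  · intro l hl
    obtain ⟨h₁, h₂, h₃⟩ := hB.shared l hl
    exact ⟨he.sub h₁, h₂, (he.ren l h₁).trans h₃⟩

/-- `Chain hc P A T ξP ξA E`: the evaluation context `E` of the composed program consists of the
frames on the stacks of the passive side `P` and of the active side `A`, in turn; its hole has
type `T`. -/
inductive Chain {c : Name → Tm} (hc : GoodEnv c) :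
    Side → Side → Ty → List Frame → List Frame → ECtx → Prop
  | nil {P A T} : Chain hc P A T [] [] .hole
  | cons {P A : Side} {F : Frame} {ξP ξA : List Frame} {E : ECtx} :
      ECtxTyped P.S 1 F.Tin F.ctx 1 F.Tout → F.ctx.Occ A.γ.dom P.h.locs →
      Chain hc A P F.Tout ξA ξP E →
      Chain hc P A F.Tin (F :: ξP) ξA (E.comp (concE P.r hc F.ctx))

/-- Each frame is concretized with the renaming of its owner, so it suffices that both sides only
grow and that old names keep their interpretation. The sides swap at each frame; hence both are
generalized. -/
theorem Chain.later {c c' : Name → Tm} {hc : GoodEnv c} (hc' : GoodEnv c') {P A : Side} {T : Ty}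
    {ξP ξA : List Frame} {E : ECtx} (h : Chain hc P A T ξP ξA E) : ∀ {P' A' : Side}, P.Le P' →
    A.Le A' → (∀ n ∈ P.γ.dom, c' n = c n) → (∀ n ∈ A.γ.dom, c' n = c n) →
    Chain hc' P' A' T ξP ξA E := by
  induction h with
  | nil => intros; exact .nil
  | @cons P A F ξP ξA E h₁ h₂ _ ih =>
    intro P' A' hP hA hcP hcA
    have := ih hA hP hcA hcP
    rw [concE_congr (c' := c') (r' := P'.r) hc hc' (fun l hl => (hP.ren l hl).symm)
      (fun n hn => (hcA n hn).symm) h₂]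
    exact .cons (h₁.store hP.store hP.wf) (h₂.mono hA.names hP.locs) this

/-! ## Exchange of an action -/

/-- `B` abstracts `V`, with its name in `γ`. -/
def Abstr (γ : NMap) (i : Layer) (V : Tm) (T : Ty) (B : Tm) : Prop :=
  ∃ g, AbsVal i V T B g ∧ ∀ n W, g n = some W → γ n = some W

theorem Abstr.cases {γ : NMap} {i : Layer} {V B : Tm} {T : Ty} (h : Abstr γ i V T B) :
    (B = V ∧ (V = .unit ∨ (∃ n, V = .num n) ∨ ∃ l, V = .loc l)) ∨
      ∃ n, B = .name n ∧ γ n = some V ∧ V.IsValue ∧ NameOf n T i := by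
  obtain ⟨g, h, hg⟩ := h
  cases h with
  | unit => exact Or.inl ⟨rfl, Or.inl rfl⟩
  | num n => exact Or.inl ⟨rfl, Or.inr (Or.inl ⟨n, rfl⟩)⟩
  | loc l T => exact Or.inl ⟨rfl, Or.inr (Or.inr ⟨l, rfl⟩)⟩
  | fn hV hf => exact Or.inr ⟨_, rfl, hg _ _ (by simp [NMap.single]), hV, hf⟩
  | bx hV hi hf => subst hi; exact Or.inr ⟨_, rfl, hg _ _ (by simp [NMap.single]), hV, hf⟩

theorem NameOf.dom_eq {n m : Name} {T : Ty} {i j : Layer} (h : NameOf n T i) (h' : NameOf m T j) :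
    n.dom = m.dom := by
  cases h <;> cases h' <;> rfl

theorem HasTy.name_inv {S : Store} {i : Layer} {n : Name} {T : Ty} (h : Typed S i (.name n) T) :
    ∃ j, NameOf n T j := by
  cases h with | name _ h _ => exact ⟨_, h⟩

/-- Extend an interpretation of names. -/
def extend (r : Loc → Loc) (c : Name → Tm) (γ : NMap) (n : Name) : Tm :=
  match γ n with
  | some V => conc r c V
  | none => c n

theorem extend_some {r : Loc → Loc} {c : Name → Tm} {γ : NMap} {n : Name} {V : Tm}
    (h : γ n = some V) : extend r c γ n = conc r c V := by simp [extend, h]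

theorem extend_none {r : Loc → Loc} {c : Name → Tm} {γ : NMap} {n : Name}
    (h : γ n = none) : extend r c γ n = c n := by simp [extend, h]

/-- New values are resolved through the old interpretation. A new name that stands for an old one
thus receives the resolved value of the latter, which keeps `not_name`; the two names have the same
type, hence the same context of local variables. -/
theorem GoodEnv.extend {S : Store} {r : Loc → Loc} {c : Name → Tm} (hc : GoodEnv c) {γ : NMap}
    (h : ∀ n V, γ n = some V → V.IsValue ∧ ∃ T i, NameOf n T i ∧ Typed S 1 V T) :
    GoodEnv (extend r c γ) := by
  refine ⟨fun n => ?_, fun n => ?_, fun n N hN => ?_, fun n m => ?_⟩ <;>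
    rcases hn : γ n with _ | V
  · rw [extend_none hn]; exact hc.value n
  · rw [extend_some hn]; exact conc_isValue hc (h n V hn).1
  · rw [extend_none hn]; exact hc.closed n
  · rw [extend_some hn]
    obtain ⟨-, T, i, -, hV⟩ := h n V hn
    have := hV.sc
    simp only [LCtx.dom, List.map_nil, List.toFinset_nil, Finset.coe_empty] at this
    exact this.conc hc
  · rw [extend_none hn] at hN; exact hc.box n N hN
  · rw [extend_some hn] at hN
    obtain ⟨hv, T, i, hT, hV⟩ := h n V hn
    cases V with
    | box M =>
      cases hN
      cases hV with
      | box _ hM => rw [hT.dom_box]; exact hM.sc.conc hc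
    | name m =>
      obtain ⟨j, hj⟩ := hV.name_inv
      rw [hT.dom_eq hj]; exact hc.box m N hN
    | _ => first | cases hN | exact hv.elim
  · rw [extend_none hn]; exact hc.not_name n m
  · rw [extend_some hn]
    obtain ⟨hv, -⟩ := h n V hn
    cases V with
    | name k => exact hc.not_name k m
    | _ => first | exact hv.elim | (intro e; cases e)

theorem NMap.dom_union_left (γ γ' : NMap) : γ.dom ⊆ (γ.union γ').dom := by
  rintro n ⟨V, hV⟩; exact ⟨V, by simp [NMap.union, hV]⟩

theorem NMap.dom_union_right (γ γ' : NMap) : γ'.dom ⊆ (γ.union γ').dom := by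
  rintro n ⟨V, hV⟩
  rcases h : γ n with _ | W
  · exact ⟨V, by simp [NMap.union, h, hV]⟩
  · exact ⟨W, by simp [NMap.union, h]⟩

theorem MapSub.union_left {α : Type} (s t : Finmap (fun _ : Loc => α)) : MapSub s (s ∪ t) := by
  intro l a h
  rw [Finmap.lookup_union_left (Finmap.mem_of_lookup_eq_some h)]; exact h

theorem MapSub.union_right {s t : Store} (h : s.Agree t) : MapSub t (s ∪ t) := by
  intro l a hl
  by_cases hs : l ∈ s
  · obtain ⟨b, hb⟩ := Finmap.mem_iff.1 hs
    rw [Finmap.lookup_union_left hs, hb, h l b a hb hl]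
  · rw [Finmap.lookup_union_right hs]; exact hl

/-! ### Transfer of a heap and of names in an action -/

/-- The side that receives the heap `χ` typed by `S'` in an action. -/
def Side.receive (P : Side) (r : Loc → Loc) (S' : Store) (χ : Heap) : Side :=
  ⟨P.S ∪ S', χ ∪ P.h, P.γ, fun l => if l ∈ χ then r l else P.r l⟩

/-- The side that introduces the names in `γ` in an action. -/
def Side.intro (A : Side) (γ : NMap) : Side := ⟨A.S, A.h, A.γ.union γ, A.r⟩

/-- The heap `χ` abstracts the part `h'` of a heap typed by `S`, with names in `γ`. -/
def AbstrHeap (γ : NMap) (S : Store) (h' χ : Heap) : Prop :=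
  χ.keys = h'.keys ∧ ∀ l V, h'.lookup l = some V → ∃ i T B, S.lookup l = some T ∧
    χ.lookup l = some B ∧ Typed S 1 V T ∧ Abstr γ i V T B

/-- The values of the new names `γ`. -/
def NewNames (A : Side) (PN : Set Name) (φ φ' : Set Name) (γ : NMap) : Prop :=
  ∀ n V, γ n = some V → n ∉ φ ∧ n ∈ φ' ∧ V.IsValue ∧ Occ PN A.h.locs V ∧
    ∃ T i, NameOf n T i ∧ Typed A.S 1 V T

/-- The store contexts agree on common locations, so every value, received or old, is typed in its
own store context and then weakened to the union. -/
theorem OHeap.heapTy_receive {P : Side} {θ L : Finset Loc} {S' : Store} {χ : Heap}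
    (hO : OHeap P.S P.h θ L S' χ) (hP : HeapTy P.S P.h) (r : Loc → Loc) :
    HeapTy (P.receive r S' χ).S (P.receive r S' χ).h ∧ MapSub S' (P.receive r S' χ).S := by
  obtain ⟨-, ht, hag, -, -⟩ := hO
  have ht := ht.heapTy
  have hl := MapSub.union_left P.S S'
  have hr := MapSub.union_right hag
  have hwf : Store.Wf 1 (P.S ∪ S') := by
    intro l T hT
    by_cases h : l ∈ P.S
    · rw [Finmap.lookup_union_left h] at hT; exact hP.wf _ _ hT
    · rw [Finmap.lookup_union_right h] at hT; exact ht.wf _ _ hT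
  refine ⟨⟨fun l => ?_, fun l V hV => ?_, hwf, fun l T V hT hV => ?_⟩, hr⟩
  · simp only [Side.receive, Finmap.mem_union, hP.keys, ht.keys, or_comm]
  · simp only [Side.receive] at hV
    by_cases h : l ∈ χ
    · rw [Finmap.lookup_union_left h] at hV; exact ht.value _ _ hV
    · rw [Finmap.lookup_union_right h] at hV; exact hP.value _ _ hV
  · simp only [Side.receive] at hV hT ⊢
    by_cases h : l ∈ χ
    · rw [Finmap.lookup_union_left h] at hV
      obtain ⟨T', hT'⟩ := Finmap.mem_iff.1 ((ht.keys l).2 h)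
      have := hr _ _ hT'
      rw [hT] at this; cases this
      exact (ht.typed _ _ _ hT' hV).store hr hwf
    · rw [Finmap.lookup_union_right h] at hV
      obtain ⟨T', hT'⟩ := Finmap.mem_iff.1 ((hP.keys l).2 (Finmap.mem_of_lookup_eq_some hV))
      have := hl _ _ hT'
      rw [hT] at this; cases this
      exact (hP.typed _ _ _ hT' hV).store hl hwf

/-- The new names of `A` are interpreted by the concretizations of their values, so a value and its
abstraction concretize alike. `P` takes over the values and the renaming of `A` on `χ`. This brings
its copies of the shared locations `θ` up to date; there the renamings agreed already, and the other
locations of `χ` are new to `P`. Afterwards it is the copies of `A` on `χ` that may become out of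
date. -/
theorem Base.exchange {A P : Side} {c : Name → Tm} {φ φ' : Set Name} {θ L : Finset Loc}
    {H : Heap} (hB : Base A P c φ θ H) {γ : NMap} {S' : Store} {h' χ : Heap} (hφ : φ ⊆ φ')
    (hn : NewNames A P.γ.dom φ φ' γ) (hr : IsRestr A.S A.h (θ ∪ L) S' h')
    (hχ : AbstrHeap γ A.S h' χ) (hO : OHeap P.S P.h θ L S' χ) :
    GoodEnv (extend A.r c γ) ∧ (∀ n ∈ φ, extend A.r c γ n = c n) ∧
    Base (P.receive A.r S' χ) (A.intro γ) (extend A.r c γ) φ' χ.keys H ∧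
    P.Le (P.receive A.r S' χ) ∧ A.Le (A.intro γ) ∧
    ∀ i V T B, Abstr γ i V T B → B.mu ⊆ χ.keys → Occ P.γ.dom A.h.locs V →
      conc (P.receive A.r S' χ).r (extend A.r c γ) B = conc A.r (extend A.r c γ) V ∧
      Occ (A.intro γ).γ.dom (P.receive A.r S' χ).h.locs B := by
  have hgood : GoodEnv (extend A.r c γ) :=
    hB.good.extend (fun n V h => ⟨(hn n V h).2.2.1, (hn n V h).2.2.2.2⟩)
  have hold : ∀ n ∈ φ, extend A.r c γ n = c n := by
    intro n hnφ
    refine extend_none ?_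
    rcases h : γ n with _ | V
    · rfl
    · exact absurd hnφ (hn n V h).1
  have hAφ : A.γ.dom ⊆ φ := fun n ⟨V, hV⟩ => (hB.namesA n V hV).1
  have hPφ : P.γ.dom ⊆ φ := fun n ⟨V, hV⟩ => (hB.namesP n V hV).1
  -- Values of `A` mention names of `P` only. These are old, so the extension does not affect them.
  have hconcA : ∀ {V}, Occ P.γ.dom A.h.locs V →
      conc A.r (extend A.r c γ) V = conc A.r c V := fun hV =>
    hV.conc_congr (fun _ _ => rfl) (fun n h => hold n (hPφ h))
  have hθχ : θ ⊆ χ.keys := by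
    rw [hχ.1]; exact Finset.subset_union_left.trans hr.1.2.1
  have hχA : ∀ l ∈ χ, l ∈ A.h := by
    intro l hl
    have : l ∈ h'.keys := hχ.1 ▸ Finmap.mem_keys.2 hl
    exact hr.1.1.mem (Finmap.mem_keys.1 this)
  obtain ⟨hheap, hS'⟩ := hO.heapTy_receive hB.heapP A.r
  have hχP : ∀ l ∈ χ, l ∈ P.h → l ∈ θ := by
    intro l h₁ h₂
    rw [← hO.2.2.2.1]
    exact Finset.mem_inter.2 ⟨Finmap.mem_keys.2 h₁, Finmap.mem_keys.2 h₂⟩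
  have hren : ∀ l ∈ P.h, (P.receive A.r S' χ).r l = P.r l := by
    intro l hl
    simp only [Side.receive]
    split_ifs with h
    · exact (hB.shared l (hχP l h hl)).2.2
    · rfl
  have hleP : P.Le (P.receive A.r S' χ) :=
    ⟨MapSub.union_left _ _, hheap.wf, fun l hl => Finmap.mem_union.2 (Or.inr hl), subset_rfl, hren⟩
  have hleA : A.Le (A.intro γ) :=
    ⟨.refl _, hB.heapA.wf, subset_rfl, NMap.dom_union_left _ _, fun _ _ => rfl⟩
  have habs : ∀ i V T B, Abstr γ i V T B → B.mu ⊆ χ.keys → Occ P.γ.dom A.h.locs V →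
      conc (P.receive A.r S' χ).r (extend A.r c γ) B = conc A.r (extend A.r c γ) V ∧
      Occ (A.intro γ).γ.dom (P.receive A.r S' χ).h.locs B := by
    intro i V T B hab hmu hV
    rcases hab.cases with ⟨rfl, rfl | ⟨n, rfl⟩ | ⟨l, rfl⟩⟩ | ⟨n, rfl, hnV, -⟩
    · exact ⟨rfl, trivial⟩
    · exact ⟨rfl, trivial⟩
    · have hl : l ∈ χ := Finmap.mem_keys.1 (hmu (Finset.mem_singleton_self l))
      exact ⟨by simp [conc, Side.receive, hl], Finmap.mem_union.2 (Or.inl hl)⟩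
    · refine ⟨?_, NMap.dom_union_right _ _ ⟨V, hnV⟩⟩
      rw [hconcA hV]; exact extend_some hnV
  have hχval : ∀ l B, χ.lookup l = some B → ∃ i T V, A.h.lookup l = some V ∧ Abstr γ i V T B ∧
      B.mu ⊆ χ.keys := by
    intro l B hl
    have : l ∈ h'.keys := hχ.1 ▸ Finmap.mem_keys.2 (Finmap.mem_of_lookup_eq_some hl)
    obtain ⟨V, hV⟩ := Finmap.mem_iff.1 (Finmap.mem_keys.1 this)
    obtain ⟨i, T, B', -, hB', -, hab⟩ := hχ.2 l V hV
    rw [hl] at hB'; cases hB'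
    refine ⟨i, T, V, hr.1.1 _ _ hV, hab, ?_⟩
    -- A location stored in `χ` lies in `χ`, as `χ` is closed.
    intro l' hl'
    cases B with
    | loc k =>
      rw [Finset.mem_singleton.1 hl']
      exact Finmap.mem_keys.2 (hO.2.2.2.2.1.2.2 _ _ hl)
    | _ => simp [Tm.mu] at hl'
  refine ⟨hgood, hold, ⟨hgood, ?_, ?_, hheap, hB.heapA, ?_, ?_, ⟨?_, ?_⟩, ?_, ?_, ?_, ?_, ?_, ?_⟩,
    hleP, hleA, habs⟩
  · intro Γ T k hk
    rw [hold _ (hPφ hk)]; exact hB.boxP Γ T k hk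
  -- A new box name stands for a box or for a box name of `P`, whose interpretation is a box
  -- already.
  · rintro Γ T k ⟨V, hV⟩
    rcases h : A.γ (.bx Γ T k) with _ | W
    · have hV' : γ (.bx Γ T k) = some V := by simpa [Side.intro, NMap.union, h] using hV
      obtain ⟨-, -, h₁, h₂, T', i, h₃, h₄⟩ := hn _ _ hV'
      rw [extend_some hV']
      cases h₃ with
      | bx k hw =>
        rcases h₄.canon_box h₁ with ⟨M, rfl, -⟩ | ⟨m, rfl, hm⟩
        · exact ⟨_, rfl⟩
        · cases hm; exact hB.boxP _ _ _ h₂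
    · have hd : Name.bx Γ T k ∈ A.γ.dom := ⟨W, h⟩
      rw [hold _ (hAφ hd)]; exact hB.boxA Γ T k hd
  · intro l B hl
    simp only [Side.receive] at hl
    by_cases h : l ∈ χ
    · rw [Finmap.lookup_union_left h] at hl
      obtain ⟨i, T, V, hV, hab, hmu⟩ := hχval l B hl
      exact (habs i V T B hab hmu (hB.occA _ _ hV)).2
    · rw [Finmap.lookup_union_right h] at hl
      exact (hB.occP _ _ hl).mono hleA.names hleP.locs
  · exact fun l V hl => hB.occA l V hl
  · intro l B hl
    simp only [Side.receive] at hl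
    by_cases h : l ∈ χ
    · rw [Finmap.lookup_union_left h] at hl
      obtain ⟨i, T, V, hV, hab, hmu⟩ := hχval l B hl
      rw [(habs i V T B hab hmu (hB.occA _ _ hV)).1, hconcA (hB.occA _ _ hV)]
      have : (P.receive A.r S' χ).r l = A.r l := by simp [Side.receive, h]
      rw [this]; exact hB.relA.map _ _ hV
    · rw [Finmap.lookup_union_right h] at hl
      have hlθ : l ∉ θ := fun hθ => h (Finmap.mem_keys.1 (hθχ hθ))
      rw [hren l (Finmap.mem_of_lookup_eq_some hl), hB.relP l B hl hlθ]
      congr 1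
      exact (hB.occP _ _ hl).conc_congr (fun x hx => (hren x hx).symm)
        (fun n h => (hold n (hAφ h)).symm)
  -- A location is either visible in the action, and renamed as in `A`, or private to `P`, and
  -- renamed as before. `Base.disj` separates the images of the two kinds.
  · have hcase : ∀ l ∈ (P.receive A.r S' χ).h,
        (l ∈ χ ∧ (P.receive A.r S' χ).r l = A.r l) ∨
        (l ∈ P.h ∧ l ∉ θ ∧ (P.receive A.r S' χ).r l = P.r l) := by
      intro l hl
      by_cases h : l ∈ χ
      · exact Or.inl ⟨h, by simp [Side.receive, h]⟩
      · have hP := (Finmap.mem_union.1 hl).resolve_left h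
        exact Or.inr ⟨hP, fun hθ => h (Finmap.mem_keys.1 (hθχ hθ)), hren l hP⟩
    intro l l' hl hl' e
    rcases hcase l hl with ⟨h₁, h₂⟩ | ⟨h₁, h₁', h₂⟩ <;>
      rcases hcase l' hl' with ⟨h₃, h₄⟩ | ⟨h₃, h₃', h₄⟩ <;> rw [h₂, h₄] at e
    · exact hB.relA.inj _ _ (hχA _ h₁) (hχA _ h₃) e
    · exact absurd e.symm (hB.disj _ h₃ h₃' _ (hχA _ h₁))
    · exact absurd e (hB.disj _ h₁ h₁' _ (hχA _ h₃))
    · exact hB.injP _ _ h₁ h₃ e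
  · intro l V hl _
    rw [show (A.intro γ).r = A.r from rfl, hconcA (hB.occA _ _ hl)]
    exact hB.relA.map _ _ hl
  · exact hB.relA.inj
  · intro l hl hlχ l' hl' e
    change A.r l = _ at e
    by_cases h : l' ∈ χ
    · have : (P.receive A.r S' χ).r l' = A.r l' := by simp [Side.receive, h]
      rw [this] at e
      rw [hB.relA.inj _ _ hl (hχA _ h) e] at hlχ
      exact hlχ (Finmap.mem_keys.2 h)
    · have hP := (Finmap.mem_union.1 hl').resolve_left h
      rw [hren l' hP] at e
      exact hB.disj _ hP (fun hθ => h (Finmap.mem_keys.1 (hθχ hθ))) _ hl e.symm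
  · intro l hl
    have hl := Finmap.mem_keys.1 hl
    exact ⟨Finmap.mem_union.2 (Or.inl hl), hχA l hl, by simp [Side.receive, Side.intro, hl]⟩
  · intro n V hV
    obtain ⟨h₁, h₂, h₃, h₄, T, i, h₅, h₆⟩ := hB.namesP n V hV
    refine ⟨hφ h₁, h₂, h₃.mono hleA.names hleP.locs, ?_, T, i, h₅, h₆.store hleP.store hleP.wf⟩
    rw [hold n h₁, h₄]
    exact h₃.conc_congr (fun x hx => (hren x hx).symm) (fun n h => (hold n (hAφ h)).symm)
  · intro n V hV
    rcases h : A.γ n with _ | W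
    · have hV' : γ n = some V := by simpa [Side.intro, NMap.union, h] using hV
      obtain ⟨-, h₀, h₁, h₂, T', i, h₃, h₄⟩ := hn _ _ hV'
      refine ⟨h₀, h₁, h₂, ?_, T', i, h₃, h₄⟩
      rw [extend_some hV']; exact (hconcA h₂).symm
    · have : W = V := by simpa [Side.intro, NMap.union, h] using hV
      subst this
      obtain ⟨h₁, h₂, h₃, h₄, h₅⟩ := hB.namesA n W h
      refine ⟨hφ h₁, h₂, h₃, ?_, h₅⟩
      rw [hold n h₁, h₄]; exact (hconcA h₃).symm

/-! ## Linked configurations -/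

/-- The active configuration of `A` with the term `M : T` and the passive configuration of `P`
are two views of the program `R` with the heap `H`. -/
def Linked (A P : Side) (M : Tm) (T : Ty) (φ : Set Name) (θ : Finset Loc) (ξA ξP : List Frame)
    (R : Tm) (H : Heap) : Prop :=
  ∃ (c : Name → Tm) (E : ECtx) (hB : Base A P c φ θ H), Typed A.S 1 M T ∧
    Occ P.γ.dom A.h.locs M ∧ Chain hB.good P A T ξP ξA E ∧ R = E.plug (conc A.r c M)

/-- The step of the active term becomes a step of `R` under the evaluation context `E`, whose frames
are not affected. -/
theorem Linked.step {A P : Side} {M M' : Tm} {T : Ty} {φ : Set Name} {θ : Finset Loc}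
    {ξA ξP : List Frame} {R : Tm} {H : Heap} (hL : Linked A P M T φ θ ξA ξP R H) {S' : Store}
    {h' : Heap} (hs : CStep M A.h M' h') (hS : MapSub A.S S') (hh : HeapTy S' h')
    (ht : Typed S' 1 M' T) :
    ∃ r' R' H', Linked ⟨S', h', A.γ, r'⟩ P M' T φ θ ξA ξP R' H' ∧ Step (R, H) (R', H') := by
  obtain ⟨c, E, hB, hM, ho, hE, rfl⟩ := hL
  obtain ⟨r', H', h₁, h₂, h₃⟩ := hs.sim hB.good hB.boxP hM ho hB.occA hB.relA
  obtain ⟨h₄, h₅, h₆⟩ := hs.occ ho hB.occA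
  obtain ⟨hB', hle⟩ := hB.step hS hh h₅ h₂ h₃
  exact ⟨r', _, H', ⟨c, E, hB', ht, h₄,
    hE.later hB'.good (.refl hB.heapP.wf) hle (fun _ _ => rfl) (fun _ _ => rfl), rfl⟩,
    .ktx E h₁.step⟩

/-- The data of an action of `A`, received by `P`. -/
structure Exchange (A P : Side) (φ φ' : Set Name) (θ L : Finset Loc) (γ : NMap) (S' : Store)
    (h' χ : Heap) : Prop where
  sub : φ ⊆ φ'
  new : NewNames A P.γ.dom φ φ' γ
  restr : IsRestr A.S A.h (θ ∪ L) S' h'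
  heap : AbstrHeap γ A.S h' χ
  oheap : OHeap P.S P.h θ L S' χ

section

variable {A P : Side} {φ φ' : Set Name} {θ L : Finset Loc} {γ : NMap} {S' : Store} {h' χ : Heap}
  {ξA ξP : List Frame} {R : Tm} {H : Heap}

theorem Exchange.mu_subset (hX : Exchange A P φ φ' θ L γ S' h' χ) : L ⊆ χ.keys := by
  rw [hX.heap.1]; exact Finset.subset_union_right.trans hX.restr.1.2.1

/-- The top frame of `P` passes from `E` to the active term. As `B` and `V` concretize alike, the
composed program is the same. -/
theorem Linked.answer (hX : Exchange A P φ φ' θ L γ S' h' χ) {V B : Tm} {T : Ty} {i j : Layer}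
    {F : Frame} (hL : Linked A P V T φ θ ξA (F :: ξP) R H) (hab : Abstr γ i V T B)
    (hmu : B.mu ⊆ L) (hB : Typed S' j B F.Tin) :
    Linked (P.receive A.r S' χ) (A.intro γ) (F.ctx.plug B) F.Tout φ' χ.keys ξP ξA R H := by
  obtain ⟨c, E, hBase, hM, ho, hE, rfl⟩ := hL
  obtain ⟨hgood, hold, hB', hleP, hleA, habs⟩ :=
    hBase.exchange hX.sub hX.new hX.restr hX.heap hX.oheap
  have hE' := hE.later hgood hleP hleA (fun n ⟨V, hV⟩ => hold n (hBase.namesP n V hV).1)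
    (fun n ⟨V, hV⟩ => hold n (hBase.namesA n V hV).1)
  obtain ⟨e, hoB⟩ := habs i V T B hab (hmu.trans hX.mu_subset) ho
  have hBt := hB.one.store (hX.oheap.heapTy_receive hBase.heapP A.r).2 hB'.heapA.wf
  have ev : conc A.r (extend A.r c γ) V = conc A.r c V :=
    ho.conc_congr (fun _ _ => rfl) (fun n ⟨V, hV⟩ => hold n (hBase.namesP n V hV).1)
  cases hE' with
  | @cons _ _ _ _ _ E₁ h₁ h₂ h₃ =>
    refine ⟨_, E₁, hB', h₁.plug hBt, (ECtx.occ_plug _ _).2 ⟨h₂, hoB⟩, h₃, ?_⟩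
    rw [ECtx.plug_comp, conc_plug _ hgood, e, ev]

/-- `K` passes from the active term to `E`. What is left, `f V`, concretizes like `W B`, because `f`
is interpreted by the concretization of `W`. -/
theorem Linked.questionF (hX : Exchange A P φ φ' θ L γ S' h' χ) {K : ECtx} {f : Name} {V W B : Tm}
    {T T₁ T₂ : Ty} {i i₁ j : Layer} (l l' : Layer)
    (hL : Linked A P (K.plug (.app (.name f) V)) T φ θ ξA ξP R H)
    (hf : NameOf f (.arrow T₁ T₂) i₁) (hW : P.γ f = some W)
    (hab : Abstr γ i V T₁ B) (hmu : B.mu ⊆ L) (hB : Typed S' j B T₁) :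
    Linked (P.receive A.r S' χ) (A.intro γ) (.app W B) T₂ φ' χ.keys ξP
      (⟨A.S, K, T₂, l, T, l'⟩ :: ξA) R H := by
  obtain ⟨c, E, hBase, hM, ho, hE, rfl⟩ := hL
  obtain ⟨hgood, hold, hB', hleP, hleA, habs⟩ :=
    hBase.exchange hX.sub hX.new hX.restr hX.heap hX.oheap
  have hE' := hE.later hgood hleP hleA (fun n ⟨V, hV⟩ => hold n (hBase.namesP n V hV).1)
    (fun n ⟨V, hV⟩ => hold n (hBase.namesA n V hV).1)
  obtain ⟨hoK, hof, hoV⟩ := (ECtx.occ_plug _ _).1 ho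
  obtain ⟨e, hoB⟩ := habs i V T₁ B hab (hmu.trans hX.mu_subset) hoV
  have hBt := hB.one.store (hX.oheap.heapTy_receive hBase.heapP A.r).2 hB'.heapA.wf
  have ev : conc A.r (extend A.r c γ) (K.plug (.app (.name f) V)) =
      conc A.r c (K.plug (.app (.name f) V)) :=
    ho.conc_congr (fun _ _ => rfl) (fun n ⟨V, hV⟩ => hold n (hBase.namesP n V hV).1)
  obtain ⟨-, -, hoW, hcW, T', i', hT', hWt⟩ := hB'.namesA f W hW
  obtain ⟨rfl, rfl⟩ := hf.unique hT'
  obtain ⟨T₀, hT₀, hK⟩ := hM.unplug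
  -- The name `f` fixes its type, and thereby the type of the hole.
  have : T₀ = T₂ := by
    cases hT₀ with
    | app h₁ _ => obtain ⟨_, h⟩ := h₁.name_inv; cases (hf.unique h).1; rfl
  subst this
  refine ⟨_, _, hB', .app hWt hBt, ⟨hoW, hoB⟩,
    .cons (F := ⟨A.S, K, T₀, l, T, l'⟩) hK (hoK.mono hleP.names hleA.locs) hE', ?_⟩
  rw [ECtx.plug_comp, ← ev]
  simp only [conc, conc_plug _ hgood, e, hcW]
  rfl

theorem LSub.ext_fn {δ ρ : LSub} (hd : δ.dom = ρ.dom) (h : ∀ x ∈ δ.dom, δ.fn x = ρ.fn x) :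
    δ = ρ := by
  obtain ⟨d, s⟩ := δ
  obtain ⟨d', s'⟩ := ρ
  cases hd
  congr 1
  funext x
  have := h x.1 x.2
  rwa [LSub.fn_mk_of_mem _ x.2, LSub.fn_mk_of_mem _ x.2] at this

theorem LSub.fn_of_mem {δ : LSub} {x : LVar} (hx : x ∈ δ.dom) : δ.fn x = δ.val ⟨x, hx⟩ := by
  simp [LSub.fn, hx]

theorem LSub.mu_val_subset (ρ : LSub) (x : {x // x ∈ ρ.dom}) : (ρ.val x).mu ⊆ ρ.mu :=
  Finset.subset_biUnion_of_mem (fun x => (ρ.val x).mu) (Finset.mem_univ x)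

/-- `#b^δ` concretizes to the instantiated code of `b` from the start, so it is enough that `k`
concretizes to that code and `ρ` to the same entries as `δ`. -/
theorem Linked.questionB (hX : Exchange A P φ φ' θ L γ S' h' χ) {K : ECtx} {b : Name} {W : Tm}
    {k : Code} {δ ρ : LSub} {T T₁ : Ty} {Γ : LCtx} {i j : Layer} (l l' : Layer)
    (hL : Linked A P (K.plug (.unbox b δ.dom δ.val)) T φ θ ξA ξP R H)
    (hb : NameOf b (.box Γ T₁) 1) (hW : P.γ b = some W) (hk : W.code = some k)
    (hd : ρ.dom = δ.dom) (hab : ∀ x T, (x, T) ∈ Γ → Abstr γ i (δ.fn x) T (ρ.fn x))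
    (hmu : ρ.mu ⊆ L) (hρ : LSubTyped S' j ρ Γ) :
    Linked (P.receive A.r S' χ) (A.intro γ) (k.inst ρ) T₁ φ' χ.keys ξP
      (⟨A.S, K, T₁, l, T, l'⟩ :: ξA) R H := by
  obtain ⟨c, E, hBase, hM, ho, hE, rfl⟩ := hL
  obtain ⟨hgood, hold, hB', hleP, hleA, habs⟩ :=
    hBase.exchange hX.sub hX.new hX.restr hX.heap hX.oheap
  have hE' := hE.later hgood hleP hleA (fun n ⟨V, hV⟩ => hold n (hBase.namesP n V hV).1)
    (fun n ⟨V, hV⟩ => hold n (hBase.namesA n V hV).1)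
  obtain ⟨hoK, hob, hoδ⟩ := (ECtx.occ_plug _ _).1 ho
  have hstore := (hX.oheap.heapTy_receive hBase.heapP A.r).2
  have ev : conc A.r (extend A.r c γ) (K.plug (.unbox b δ.dom δ.val)) =
      conc A.r c (K.plug (.unbox b δ.dom δ.val)) :=
    ho.conc_congr (fun _ _ => rfl) (fun n ⟨V, hV⟩ => hold n (hBase.namesP n V hV).1)
  obtain ⟨-, hWv, hoW, hcW, T', i', hT', hWt⟩ := hB'.namesA b W hW
  obtain ⟨rfl, -⟩ := hb.unique hT'
  obtain ⟨T₀, hT₀, hK⟩ := hM.unplug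
  have : T₀ = T₁ := by
    cases hT₀ with
    | unbox _ h => cases (hb.unique h).1; rfl
  subst this
  have hΓ : ∀ x : {x // x ∈ ρ.dom}, ∃ T, (x.1, T) ∈ Γ := by
    intro x
    obtain ⟨p, hp, hx⟩ := List.mem_map.1 ((hρ.1 x).1 x.2)
    exact ⟨p.2, hx ▸ hp⟩
  have hx : ∀ x : {x // x ∈ ρ.dom},
      conc (P.receive A.r S' χ).r (extend A.r c γ) (ρ.val x) =
        conc A.r (extend A.r c γ) (δ.val ⟨x.1, hd ▸ x.2⟩) ∧
      Occ (A.intro γ).γ.dom (P.receive A.r S' χ).h.locs (ρ.val x) := by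
    intro x
    obtain ⟨T, hT⟩ := hΓ x
    have hxδ : x.1 ∈ δ.dom := hd ▸ x.2
    have := habs i (δ.fn x.1) T (ρ.fn x.1) (hab x.1 T hT)
      (by rw [LSub.fn_of_mem x.2]; exact ((ρ.mu_val_subset x).trans hmu).trans hX.mu_subset)
      (by rw [LSub.fn_of_mem hxδ]; exact hoδ _)
    rwa [LSub.fn_of_mem x.2, LSub.fn_of_mem hxδ] at this
  have hval : ∀ x : {x // x ∈ ρ.dom}, ∀ T, (x.1, T) ∈ Γ →
      Typed (P.receive A.r S' χ).S 1 (ρ.val x) T := by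
    intro x T hT
    have := (hρ.2.2 x.1 T hT).one.store hstore hB'.heapA.wf
    rwa [LSub.fn_of_mem x.2] at this
  -- If `P` represents `b` by another box name `m`, then `k` is `#m`, and `b` and `m` have the same
  -- interpretation.
  have hkt : k.Typed (P.receive A.r S' χ).S [] (Γ, T₀) ∧
      k.Occ (A.intro γ).γ.dom (P.receive A.r S' χ).h.locs ∧ k.SomeSc ∧
      concCode (P.receive A.r S' χ).r (extend A.r c γ) k = codeOf (extend A.r c γ) b := by
    rcases hWt.canon_box hWv with ⟨N, rfl, hN⟩ | ⟨m, rfl, hm⟩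
    · cases hk
      exact ⟨hN, hoW, hN.someSc, (codeOf_of_box hcW).symm⟩
    · cases hk
      refine ⟨hm, hoW, trivial, ?_⟩
      cases hm
      obtain ⟨N, hN⟩ := hB'.boxP _ _ _ hoW
      have hbN := hcW.trans hN
      simp only [concCode]
      rw [codeOf_of_box hN, codeOf_of_box hbN]
  obtain ⟨h₁, h₂, h₃, h₄⟩ := hkt
  refine ⟨_, _, hB', ?_, h₂.inst (fun x => (hx x).2),
    .cons (F := ⟨A.S, K, T₀, l, T, l'⟩) hK (hoK.mono hleP.names hleA.locs) hE', ?_⟩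
  · exact h₁.inst (p := (Γ, T₀)) (CtxWf.nil hB'.heapA.wf 1) hρ.1 hρ.2.1 hval
  · rw [ECtx.plug_comp, ← ev, conc_plug _ hgood, conc_inst hgood h₃
      (fun x => let ⟨T, hT⟩ := hΓ x; (hval x T hT).someSc), h₄]
    change _ = E.plug ((concE A.r hgood K).plug _)
    simp only [conc]
    congr 2
    obtain ⟨d, s⟩ := δ
    obtain ⟨d', s'⟩ := ρ
    cases hd
    congr 2
    funext x
    exact (hx x).1.symm

end

/-! ## Names introduced by abstractions -/

theorem AbsVal.some {i : Layer} {V A W : Tm} {T : Ty} {g : NMap} (h : AbsVal i V T A g) {n : Name}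
    (hn : g n = some W) : A = .name n ∧ W = V ∧ V.IsValue ∧ NameOf n T i := by
  cases h with
  | unit => cases hn
  | num => cases hn
  | loc => cases hn
  | fn hV hf =>
    simp only [NMap.single] at hn
    split_ifs at hn with e
    subst e; cases hn; exact ⟨rfl, rfl, hV, hf⟩
  | bx hV hi hf =>
    simp only [NMap.single] at hn
    split_ifs at hn with e
    subst e; subst hi; cases hn; exact ⟨rfl, rfl, hV, hf⟩

theorem NMap.union_assoc (γ γ' γ'' : NMap) :
    (γ.union γ').union γ'' = γ.union (γ'.union γ'') := by
  funext n; simp [NMap.union, Option.or_assoc]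

/-- The names of `γ` are in `N`; they stand for values of `A`. -/
def NewIn (A : Side) (PN N : Set Name) (γ : NMap) : Prop :=
  ∀ n W, γ n = some W → n ∈ N ∧ W.IsValue ∧ Occ PN A.h.locs W ∧
    ∃ T i, NameOf n T i ∧ Typed A.S 1 W T

theorem AbsVal.newIn {A : Side} {PN : Set Name} {i j : Layer} {V B : Tm} {T : Ty} {g : NMap}
    (h : AbsVal i V T B g) (ho : Occ PN A.h.locs V) (ht : Typed A.S j V T) :
    NewIn A PN B.nu g := by
  intro n W hn
  obtain ⟨rfl, rfl, h₁, h₂⟩ := h.some hn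
  exact ⟨rfl, h₁, ho, T, i, h₂, ht.one⟩

theorem AbsLSub.newIn {A : Side} {PN : Set Name} {i j : Layer} {δ ρ : LSub} {Γ : LCtx} {g : NMap}
    (h : AbsLSub i δ Γ ρ g) (ho : ∀ x, Occ PN A.h.locs (δ.val x)) (ht : LSubTyped A.S j δ Γ) :
    NewIn A PN ρ.nu g := by
  obtain ⟨hd, -, g', hg, hu⟩ := h
  intro n W hn
  obtain ⟨x, hx, hxW⟩ := (hu n W).1 hn
  obtain ⟨p, hp, hpx⟩ := List.mem_map.1 ((ht.1 x).1 hx)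
  subst hpx
  obtain ⟨h₀, rfl, h₁, h₂⟩ := (hg _ _ hp).some hxW
  have hx' : p.1 ∈ ρ.dom := hd ▸ hx
  refine ⟨⟨⟨_, hx'⟩, ?_⟩, h₁, ?_, p.2, i, h₂, (ht.2.2 _ _ hp).one⟩
  · rw [← LSub.fn_of_mem hx']; exact h₀
  · rw [LSub.fn_of_mem hx]; exact ho _

/-- The union of name maps prefers its left argument. Since the names of the move and those of `χ`
are disjoint by freshness, no value of `γ''` is hidden by `γ'`. -/
theorem AbsHeap.exchange {A P : Side} {φ N : Set Name} {θ L : Finset Loc} {γ' γ'' : NMap}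
    {S' : Store} {h' χ : Heap} (hoA : A.h.Occ P.γ.dom) (h : AbsHeap A.S h' χ γ'')
    (hr : IsRestr A.S A.h (θ ∪ L) S' h') (hO : OHeap P.S P.h θ L S' χ) (hf : Fresh φ N χ)
    (hγ' : NewIn A P.γ.dom N γ') :
    Exchange A P φ (φ ∪ N ∪ χ.nu) θ L (γ'.union γ'') S' h' χ := by
  obtain ⟨hk, hdist, i, g, hg, hu⟩ := h
  have hγ'' : ∀ l V T B n W, h'.lookup l = some V → χ.lookup l = some B →
      AbsVal i V T B (g l) → g l n = some W → n ∈ χ.nu ∧ γ' n = none ∧ γ'' n = some W := by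
    intro l V T B n W hl hB hab hn
    obtain ⟨rfl, rfl, h₁, h₂⟩ := hab.some hn
    have hnχ : n ∈ χ.nu := ⟨l, hB⟩
    refine ⟨hnχ, ?_, (hu n W).2 ⟨l, Finmap.mem_of_lookup_eq_some hl, hn⟩⟩
    rcases e : γ' n with _ | U
    · rfl
    · exact absurd hnχ (Set.disjoint_left.1 hf.2.2.1 (hγ' n U e).1)
  refine ⟨?_, ?_, hr, ⟨hk, ?_⟩, hO⟩
  · exact fun n hn => Or.inl (Or.inl hn)
  · intro n V hn
    rcases e : γ' n with _ | U
    · have hn : γ'' n = some V := by simpa [NMap.union, e] using hn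
      obtain ⟨l, hl, hlV⟩ := (hu n V).1 hn
      obtain ⟨U, hU⟩ := Finmap.mem_iff.1 hl
      obtain ⟨T, B, hT, hB, hUt, hab⟩ := hg l U hU
      obtain ⟨hnχ, -, -⟩ := hγ'' l U T B n V hU hB hab hlV
      obtain ⟨rfl, rfl, h₁, h₂⟩ := hab.some hlV
      exact ⟨fun hφ => Set.disjoint_left.1 hf.2.1 hφ hnχ, Or.inr hnχ, h₁,
        hoA _ _ (hr.1.1 _ _ hU), T, i, h₂, hUt.one⟩
    · have : U = V := by simpa [NMap.union, e] using hn
      subst this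
      obtain ⟨h₁, h₂, h₃, h₄⟩ := hγ' n U e
      exact ⟨fun hφ => Set.disjoint_left.1 hf.1 hφ h₁, Or.inl (Or.inr h₁), h₂, h₃, h₄⟩
  · intro l V hl
    obtain ⟨T, B, hT, hB, hVt, hab⟩ := hg l V hl
    refine ⟨i, T, B, hT, hB, hVt.one, g l, hab, fun n W hn => ?_⟩
    obtain ⟨-, h₁, h₂⟩ := hγ'' l V T B n W hl hB hab hn
    simp [NMap.union, h₁, h₂]

theorem AbsVal.abstr {i : Layer} {V B : Tm} {T : Ty} {g γ'' : NMap} (h : AbsVal i V T B g) :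
    Abstr (g.union γ'') i V T B := by
  refine ⟨g, h, fun n W hn => by simp [NMap.union, hn]⟩

theorem AbsLSub.abstr {i : Layer} {δ ρ : LSub} {Γ : LCtx} {g γ'' : NMap}
    (h : AbsLSub i δ Γ ρ g) (hd : ∀ x, x ∈ δ.dom ↔ x ∈ Γ.map Prod.fst) :
    ∀ x T, (x, T) ∈ Γ → Abstr (g.union γ'') i (δ.fn x) T (ρ.fn x) := by
  obtain ⟨-, -, g', hg, hu⟩ := h
  intro x T hx
  refine ⟨g' x, hg x T hx, fun n W hn => ?_⟩
  have : g n = some W := (hu n W).2 ⟨x, (hd x).2 (List.mem_map_of_mem hx), hn⟩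
  simp [NMap.union, this]

/-! ## Traces of linked configurations are reductions -/

theorem Action.dual_dual (a : Action) : a.dual.dual = a := by
  obtain ⟨p, m, S, χ⟩ := a
  cases p <;> rfl

/-- Needed because the two configurations swap roles after each action. -/
theorem SharesTrace.symm {C C' : Config} {t : List Action} (h : SharesTrace C C' t) :
    SharesTrace C' C (t.map Action.dual) := by
  have e : (t.map Action.dual).map Action.dual = t := by
    rw [List.map_map]
    conv_rhs => rw [← List.map_id t]
    exact List.map_congr_left fun a _ => a.dual_dual
  rcases h with ⟨a, ha, h₁, h₂⟩ | ⟨a, ha, h₁, h₂⟩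
  · exact Or.inr ⟨a, ha, h₂, by rwa [e]⟩
  · exact Or.inl ⟨a, ha, h₂, by rwa [e]⟩

section

variable {A P : Side} {M : Tm} {T : Ty} {i : Layer} {φ : Set Name} {θ : Finset Loc}
  {ξA ξP : List Frame} {R : Tm} {H : Heap}

theorem Linked.silent (hL : Linked A P M T φ θ ξA ξP R H) {C : Config}
    (hs : Relation.ReflTransGen (fun D D' => Trans D none D')
      (.active M i T A.S A.h A.γ φ ξA θ) C) :
    ∃ A' M' R' H', C = .active M' i T A'.S A'.h A'.γ φ ξA θ ∧
      Linked A' P M' T φ θ ξA ξP R' H' ∧ Relation.ReflTransGen Step (R, H) (R', H') := by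
  induction hs with
  | refl => exact ⟨A, M, R, H, rfl, hL, .refl⟩
  | tail _ h ih =>
    obtain ⟨A', M', R', H', rfl, hL', hr⟩ := ih
    cases h with
    | tau hs hS hh ht =>
      obtain ⟨j, ht⟩ := ht
      obtain ⟨r, R'', H'', hL'', hs'⟩ := hL'.step hs.cstep hS hh.heapTy ht.one
      exact ⟨_, _, R'', H'', rfl, hL'', hr.tail hs'⟩

/-- The move determines the rule used by the passive side. In a question, both sides agree on the
types because a name determines its type. -/
theorem Linked.action (hL : Linked A P M T φ θ ξA ξP R H) {a : Action} {C C' : Config}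
    (hA : Trans (.active M i T A.S A.h A.γ φ ξA θ) (some a) C)
    (hP : Trans (.passive P.S P.h P.γ φ ξP θ) (some a.dual) C') :
    ∃ A' P' M' T' i' φ' θ' ξA' ξP', C = .passive P'.S P'.h P'.γ φ' ξP' θ' ∧
      C' = .active M' i' T' A'.S A'.h A'.γ φ' ξA' θ' ∧
      Linked A' P' M' T' φ' θ' ξA' ξP' R H := by
  obtain ⟨c, E, hB, ht, ho, -⟩ := id hL
  cases hA with
  | pa hV hab hr hχ hf =>
    change Trans _ (some ⟨.O, _, _, _⟩) _ at hP
    cases hP with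
    | oa hA' hty hO hf' =>
      rw [NMap.union_assoc]
      exact ⟨_, _, _, _, _, _, _, _, _, rfl, rfl,
        hL.answer (hχ.exchange hB.occA hr hO hf (hab.newIn ho ht)) hab.abstr subset_rfl hty⟩
  | pqf hV hn hVt hab hr hχ hf =>
    change Trans _ (some ⟨.O, _, _, _⟩) _ at hP
    cases hP with
    | oqf hn' hW hA' hty hO hf' =>
      cases (hn.unique hn').1
      rw [NMap.union_assoc]
      have hoV := ((ECtx.occ_plug _ _).1 ho).2.2
      exact ⟨_, _, _, _, _, _, _, _, _, rfl, rfl,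
        hL.questionF (hχ.exchange hB.occA hr hO hf (hab.newIn hoV hVt)) _ _ hn hW hab.abstr
          subset_rfl hty⟩
  | pqb hn hδ hab hr hχ hf =>
    change Trans _ (some ⟨.O, _, _, _⟩) _ at hP
    cases hP with
    | oqb hn' hW hk hA' hd hty hO hf' =>
      cases (hn.unique hn').1
      rw [NMap.union_assoc]
      have hoδ := ((ECtx.occ_plug _ _).1 ho).2.2
      exact ⟨_, _, _, _, _, _, _, _, _, rfl, rfl,
        hL.questionB (hχ.exchange hB.occA hr hO hf (hab.newIn hoδ hδ)) _ _ hn hW hk hab.1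
          (hab.abstr hδ.1) subset_rfl hty⟩

theorem Run.passive_cons {S : Store} {h : Heap} {γ : NMap} {ξ : List Frame} {a : Action}
    {t : List Action} {C : Config} (hr : Run (.passive S h γ φ ξ θ) (a :: t) C) :
    ∃ C', Trans (.passive S h γ φ ξ θ) (some a) C' ∧ Run C' t C := by
  cases hr with
  | cons hw hr =>
    obtain ⟨D, hs, ht⟩ := hw
    rcases hs.cases_head with rfl | ⟨D', h, -⟩
    · exact ⟨_, ht, hr⟩
    · cases h

theorem Linked.run_cons (hL : Linked A P M T φ θ ξA ξP R H) {a : Action} {s t : List Action}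
    (hP : a :: s ∈ Tr (.passive P.S P.h P.γ φ ξP θ))
    (hA : a.dual :: t ∈ Tr (.active M i T A.S A.h A.γ φ ξA θ)) :
    ∃ A' P' M' T' i' φ' θ' ξA' ξP' R' H', Linked A' P' M' T' φ' θ' ξA' ξP' R' H' ∧
      Relation.ReflTransGen Step (R, H) (R', H') ∧
      s ∈ Tr (.active M' i' T' A'.S A'.h A'.γ φ' ξA' θ') ∧
      t ∈ Tr (.passive P'.S P'.h P'.γ φ' ξP' θ') := by
  obtain ⟨_, _, _, _, _, hP⟩ := hP
  obtain ⟨C, hPa, hPr⟩ := hP.passive_cons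
  obtain ⟨_, _, _, _, _, hA⟩ := hA
  cases hA with
  | cons hw hAr =>
    obtain ⟨D, hs, hAa⟩ := hw
    obtain ⟨A', M', R', H', rfl, hL', hst⟩ := hL.silent hs
    obtain ⟨A'', P'', M'', T'', i'', φ'', θ'', ξA'', ξP'', rfl, rfl, hL''⟩ :=
      hL'.action hAa (by rwa [Action.dual_dual])
    exact ⟨A'', P'', M'', T'', i'', φ'', θ'', ξA'', ξP'', R', H', hL'', hst,
      ⟨_, _, _, _, _, hPr⟩, ⟨_, _, _, _, _, hAr⟩⟩

end

theorem Converges.of_steps {R R' : Tm} {H H' : Heap}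
    (h : Relation.ReflTransGen Step (R, H) (R', H')) (h' : Converges R' H') : Converges R H := by
  obtain ⟨V, H'', hV, hs⟩ := h'
  exact ⟨V, H'', hV, h.trans hs⟩

/-- Induction on the trace: silent moves reduce `R`, actions leave it alone and swap the roles. When
only the final answer is left, the stack of the passive side is empty, so by `Chain` the surrounding
context is empty, and `R` has become the concretization of a value. -/
theorem Linked.converges (n : ℕ) : ∀ {A P : Side} {M : Tm} {T : Ty} {i : Layer} {φ : Set Name}
    {θ : Finset Loc} {ξA ξP : List Frame} {R : Tm} {H : Heap} {t : List Action}, t.length = n →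
    Linked A P M T φ θ ξA ξP R H →
    SharesTrace (.passive P.S P.h P.γ φ ξP θ) (.active M i T A.S A.h A.γ φ ξA θ) t →
    Converges R H := by
  induction n with
  | zero =>
    intro A P M T i φ θ ξA ξP R H t ht hL hs
    obtain rfl := List.length_eq_zero_iff.1 ht
    rcases hs with ⟨a, ha, h₁, h₂⟩ | ⟨a, ha, h₁, h₂⟩
    · obtain ⟨_, _, _, _, _, h₁⟩ := h₁
      cases h₁
      obtain ⟨_, _, _, _, _, h₂⟩ := h₂
      cases h₂ with
      | cons hw _ =>
        obtain ⟨D, hs, hAa⟩ := hw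
        obtain ⟨A', M', R', H', rfl, ⟨c, E, hB, hM, ho, hE, rfl⟩, hst⟩ := hL.silent hs
        cases hE
        obtain ⟨-, B, hB'⟩ := ha
        cases hAa with
        | pa hV => exact ⟨_, H', conc_isValue hB.good hV, hst⟩
        | _ => cases hB'
    -- The empty trace is not a trace of an active configuration.
    · obtain ⟨_, _, _, _, _, h₂⟩ := h₂
      cases h₂
  | succ n ih =>
    intro A P M T i φ θ ξA ξP R H t ht hL hs
    cases t with
    | nil => cases ht
    | cons a t =>
      have ht : t.length = n := Nat.succ.inj ht
      rcases hs with ⟨b, hb, h₁, h₂⟩ | ⟨b, hb, h₁, h₂⟩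
      · obtain ⟨A', P', M', T', i', φ', θ', ξA', ξP', R', H', hL', hst, h₃, h₄⟩ :=
          hL.run_cons h₁ h₂
        refine .of_steps hst (ih (by rwa [List.length_map]) hL'
          (SharesTrace.symm (Or.inl ⟨b, hb, h₃, h₄⟩)))
      · obtain ⟨A', P', M', T', i', φ', θ', ξA', ξP', R', H', hL', hst, h₃, h₄⟩ :=
          hL.run_cons h₁ h₂
        refine .of_steps hst (ih (by rwa [List.length_map]) hL'
          (SharesTrace.symm (Or.inr ⟨b, hb, h₃, h₄⟩)))

/-! ## Existence of restrictions -/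

theorem exists_finmap {α : Type} (s : Finset Loc) (f : Loc → Option α)
    (h : ∀ l, (f l).isSome ↔ l ∈ s) :
    ∃ m : Finmap (fun _ : Loc => α), m.keys = s ∧ ∀ l, m.lookup l = f l :=
  ⟨Finmap.keysLookupEquiv.symm ⟨(s, f), h⟩, by simp, by simp⟩

theorem exists_restrict {α : Type} (m : Finmap (fun _ : Loc => α)) {s : Finset Loc}
    (h : s ⊆ m.keys) : ∃ m' : Finmap (fun _ : Loc => α), MapSub m' m ∧ m'.keys = s := by
  obtain ⟨m', h₁, h₂⟩ := exists_finmap s (fun l => if l ∈ s then m.lookup l else none) (by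
    intro l
    by_cases hl : l ∈ s
    · simpa [hl, Finmap.lookup_isSome] using Finmap.mem_keys.1 (h hl)
    · simp [hl])
  refine ⟨m', fun l a hl => ?_, h₁⟩
  rw [h₂] at hl
  split_ifs at hl
  exact hl

theorem MapSub.keys_subset {α : Type} {s t : Finmap (fun _ : Loc => α)} (h : MapSub s t) :
    s.keys ⊆ t.keys := fun _ hl => Finmap.mem_keys.2 (h.mem (Finmap.mem_keys.1 hl))

theorem MapSub.lookup_eq {α : Type} {s t : Finmap (fun _ : Loc => α)} (h : MapSub s t) {l : Loc}
    (hl : l ∈ s) : s.lookup l = t.lookup l := by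
  obtain ⟨a, ha⟩ := Finmap.mem_iff.1 hl
  rw [ha, h l a ha]

/-- The domain consists of the locations that lie in every closed subheap containing `θ`; closedness
passes to this intersection. -/
theorem exists_isRestr {S : Store} {h : Heap} (hS : S.keys = h.keys) (hc : h.Closed)
    {θ : Finset Loc} (hθ : θ ⊆ h.keys) : ∃ S' h', IsRestr S h θ S' h' := by
  classical
  let P : Loc → Prop := fun l => ∀ g : Heap, MapSub g h → θ ⊆ g.keys → g.Closed → l ∈ g
  have hs : h.keys.filter P ⊆ h.keys := Finset.filter_subset _ _
  obtain ⟨h', h₁, h₂⟩ := exists_restrict h hs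
  obtain ⟨S', h₃, h₄⟩ := exists_restrict S (s := h.keys.filter P) (hS ▸ hs)
  have hP : ∀ l ∈ h', P l := by
    intro l hl
    have := Finmap.mem_keys.2 hl
    rw [h₂] at this
    exact (Finset.mem_filter.1 this).2
  refine ⟨S', h', ⟨h₁, ?_, ?_⟩, ?_, h₃, h₄.trans h₂.symm⟩
  · intro l hl
    rw [h₂]
    exact Finset.mem_filter.2 ⟨hθ hl, fun g _ hg _ => Finmap.mem_keys.1 (hg hl)⟩
  · intro l l' hl
    rw [← Finmap.mem_keys, h₂]
    refine Finset.mem_filter.2 ⟨Finmap.mem_keys.2 (hc l l' (h₁ _ _ hl)), fun g hg hg' hgc => ?_⟩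
    have hlg := hP l (Finmap.mem_of_lookup_eq_some hl) g hg hg' hgc
    refine hgc l l' ?_
    rw [hg.lookup_eq hlg]; exact h₁ _ _ hl
  · intro g hg hg' hgc l a hl
    rw [hg.lookup_eq (hP l (Finmap.mem_of_lookup_eq_some hl) g hg hg' hgc)]
    exact h₁ _ _ hl

/-! ## Existence of abstractions -/

/-- One more than the index, hence positive: a value of rank `0` lies below every name. -/
def Name.weight : Name → ℕ
  | .fn _ _ _ k => k + 1
  | .bx _ _ k => k + 1

/-- The total weight of the questions on boxes that `M` asks before its first reduction, at most. -/
def Tm.pending : Tm → ℕ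
  | .app M N | .arith _ M N | .assign M N => M.pending + N.pending
  | .ite M _ _ | .ref M | .deref M | .letbox M _ => M.pending
  | .unbox b _ _ => b.weight
  | _ => 0

/-- Bounds what is still asked once a name for this value is questioned: a name is questioned in
turn, a box has its body run, and a `λ` or `rec` counts nothing because it is reduced at once. -/
def Tm.rank : Tm → ℕ
  | .name n => n.weight
  | .box M => M.pending
  | _ => 0

/-- The values of the names in `γ` have a lower rank than the names. -/
def NMap.Graded (γ : NMap) : Prop := ∀ n V, γ n = some V → V.rank < n.weight

theorem NMap.Graded.union {γ γ' : NMap} (h : γ.Graded) (h' : γ'.Graded) :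
    (γ.union γ').Graded := by
  intro n V hn
  rcases e : γ n with _ | W
  · exact h' n V (by simpa [NMap.union, e] using hn)
  · have : W = V := by simpa [NMap.union, e] using hn
    exact h n V (this ▸ e)

theorem NMap.exists_union {ι : Type} (D : Set ι) (g : ι → NMap)
    (h : ∀ x ∈ D, ∀ y ∈ D, ∀ n V W, g x n = some V → g y n = some W → V = W) :
    ∃ γ : NMap, γ.IsUnion D g := by
  classical
  refine ⟨fun n => if hn : ∃ V, ∃ x ∈ D, g x n = some V then some hn.choose else none, ?_⟩
  intro n V
  by_cases hn : ∃ V, ∃ x ∈ D, g x n = some V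
  · obtain ⟨x, hx, hxV⟩ := hn.choose_spec
    simp only [hn, dite_true, Option.some.injEq]
    constructor
    · rintro rfl; exact ⟨x, hx, hxV⟩
    · rintro ⟨y, hy, hyV⟩; exact h x hx y hy n _ _ hxV hyV
  · change (dite _ _ _) = _ ↔ _
    rw [dif_neg hn]
    exact ⟨nofun, fun e => absurd ⟨V, e⟩ hn⟩

/-- The index of the name is a free parameter; taking it at least the rank of the value gives a
graded map. -/
theorem HasTy.exists_absVal {S : Store} {i j : Layer} {V : Tm} {T : Ty} (h : Typed S j V T)
    (hv : V.IsValue) (hT : Ty.Wf i T) {k : ℕ} (hk : V.rank ≤ k) :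
    ∃ B g, AbsVal i V T B g ∧ (∀ n ∈ B.nu, n.weight = k + 1) ∧ g.Graded := by
  cases T with
  | unit => obtain rfl := h.canon_unit hv; exact ⟨_, _, .unit, by simp [Tm.nu], nofun⟩
  | int => obtain ⟨n, rfl⟩ := h.canon_int hv; exact ⟨_, _, .num n, by simp [Tm.nu], nofun⟩
  | ref T =>
    obtain ⟨l, rfl, -⟩ := h.canon_ref hv
    exact ⟨_, _, .loc l T, by simp [Tm.nu], fun _ _ h => by cases h⟩
  | arrow T₁ T₂ =>
    have hab : AbsVal i V (.arrow T₁ T₂) _ _ := .fn hv (.fn k hT)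
    refine ⟨_, _, hab, by simp [Tm.nu, Name.weight], fun n W hn => ?_⟩
    obtain ⟨e, rfl, -⟩ := hab.some hn
    cases e; exact Nat.lt_succ_of_le hk
  | box Γ T =>
    have hT' : i = 1 ∧ Ty.Wf 1 (.box Γ T) := by cases hT; exact ⟨rfl, .box ‹_› ‹_› ‹_›⟩
    have hab : AbsVal i V (.box Γ T) _ _ := .bx hv hT'.1 (.bx k hT'.2)
    refine ⟨_, _, hab, by simp [Tm.nu, Name.weight], fun n W hn => ?_⟩
    obtain ⟨e, rfl, -⟩ := hab.some hn
    cases e; exact Nat.lt_succ_of_le hk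

theorem AbsVal.nu_of_some {i : Layer} {V B W : Tm} {T : Ty} {g : NMap} (h : AbsVal i V T B g)
    {n : Name} (hn : g n = Option.some W) : n ∈ B.nu := by
  obtain ⟨rfl, -⟩ := h.some hn; rfl

/-- A family of values, one for each number in `D`, is abstracted by distinct names of weight
above `N`. -/
theorem exists_abs_family {S : Store} {D : Set ℕ} {V : ℕ → Tm} {T : ℕ → Ty}
    (h : ∀ x ∈ D, Typed S 1 (V x) (T x) ∧ (V x).IsValue) {N : ℕ} (hN : ∀ x ∈ D, (V x).rank ≤ N) :
    ∃ (B : ℕ → Tm) (g : ℕ → NMap) (γ : NMap), (∀ x ∈ D, AbsVal 1 (V x) (T x) (B x) (g x)) ∧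
      (∀ x ∈ D, ∀ n ∈ (B x).nu, N < n.weight) ∧
      (∀ x ∈ D, ∀ y ∈ D, ∀ n, n ∈ (B x).nu → n ∈ (B y).nu → x = y) ∧
      γ.IsUnion D g ∧ γ.Graded := by
  -- The summand `x` gives different members of the family names of different weights, all above
  -- `N`. Outside `D` the choices are dummies.
  have hex : ∀ x, ∃ B g, x ∈ D → AbsVal 1 (V x) (T x) B g ∧ (∀ n ∈ B.nu, n.weight = N + x + 1) ∧
      g.Graded := by
    intro x
    by_cases hx : x ∈ D
    · obtain ⟨B, g, hB⟩ := (h x hx).1.exists_absVal (h x hx).2 (h x hx).1.wf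
        ((hN x hx).trans (Nat.le_add_right N x))
      exact ⟨B, g, fun _ => hB⟩
    · exact ⟨.unit, .empty, fun h => absurd h hx⟩
  choose B g hB using hex
  have hinj : ∀ x ∈ D, ∀ y ∈ D, ∀ n, n ∈ (B x).nu → n ∈ (B y).nu → x = y := by
    intro x hx y hy n hnx hny
    have h₁ := (hB x hx).2.1 n hnx
    have h₂ := (hB y hy).2.1 n hny
    omega
  obtain ⟨γ, hγ⟩ := NMap.exists_union D g (by
    intro x hx y hy n V W hV hW
    obtain rfl := hinj x hx y hy n ((hB x hx).1.nu_of_some hV) ((hB y hy).1.nu_of_some hW)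
    rw [hV] at hW; exact Option.some.inj hW)
  refine ⟨B, g, γ, fun x hx => (hB x hx).1, fun x hx n hn => ?_, hinj, hγ, fun n W hn => ?_⟩
  · rw [(hB x hx).2.1 n hn]; omega
  · obtain ⟨x, hx, hxn⟩ := (hγ n W).1 hn
    exact (hB x hx).2.2 n W hxn

theorem AbsVal.isAbs {i : Layer} {V B : Tm} {T : Ty} {g : NMap} (h : AbsVal i V T B g) :
    B.IsAbs := by cases h <;> trivial

theorem Tm.IsAbs.isValue {B : Tm} (h : B.IsAbs) : B.IsValue := by
  cases B <;> trivial

theorem AbsVal.mu_eq {i : Layer} {V B : Tm} {T : Ty} {g : NMap} (h : AbsVal i V T B g) {l : Loc} :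
    B = .loc l → V = .loc l := by
  cases h with
  | loc => exact id
  | _ => exact fun e => by cases e

theorem AbsVal.eq_loc {i : Layer} {l : Loc} {B : Tm} {T : Ty} {g : NMap}
    (h : AbsVal i (.loc l) (.ref T) B g) : B = .loc l := by
  cases h; rfl

theorem AbsVal.mu_subset {i : Layer} {V B : Tm} {T : Ty} {g : NMap} (h : AbsVal i V T B g)
    {PN : Set Name} {k : Heap} (ho : Occ PN k.locs V) : B.mu ⊆ k.keys := by
  cases h with
  | loc l => exact Finset.singleton_subset_iff.2 (Finmap.mem_keys.2 ho)
  | _ => exact Finset.empty_subset _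

/-- An abstract value is typable at each layer where its type is allowed, whatever the layer `j` of
the value that it abstracts. A location must belong to the smaller store context, hence the
condition on `mu`. -/
theorem AbsVal.typed {i j : Layer} {V B : Tm} {T : Ty} {g : NMap} {S S' : Store}
    (h : AbsVal i V T B g) (ht : Typed S j V T) (hT : Ty.Wf i T) (hS : MapSub S' S)
    (hw : Store.Wf 1 S') (hmu : B.mu ⊆ S'.keys) : Typed S' i B T := by
  have hw := CtxWf.nil hw i
  cases h with
  | unit => exact .unit hw
  | num n => exact .num n hw
  | loc l T =>
    cases ht with
    | loc _ hl _ =>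
      have hl' := Finmap.mem_keys.1 (Finset.singleton_subset_iff.1 hmu)
      refine .loc hw ((hS.lookup_eq hl').trans hl) ?_
      cases hT; assumption
  | fn _ hf => exact .name hw hf le_rfl
  | bx _ hi hf => subst hi; exact .name hw hf le_rfl

theorem exists_bound (s : Finset ℕ) (f : ℕ → ℕ) : ∃ N, ∀ x ∈ s, f x ≤ N :=
  ⟨s.sup f, fun _ hx => Finset.le_sup hx⟩

theorem Heap.exists_rank_bound (h : Heap) : ∃ N, ∀ l V, h.lookup l = some V → V.rank ≤ N := by
  obtain ⟨N, hN⟩ := exists_bound h.keys (fun l => ((h.lookup l).getD .unit).rank)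
  refine ⟨N, fun l V hl => ?_⟩
  have := hN l (Finmap.mem_keys.2 (Finmap.mem_of_lookup_eq_some hl))
  simpa [hl] using this

theorem exists_weight_bound {φ : Set Name} (h : φ.Finite) : ∃ N, ∀ n ∈ φ, n.weight ≤ N := by
  obtain ⟨N, hN⟩ := (h.image Name.weight).bddAbove
  exact ⟨N, fun n hn => hN (Set.mem_image_of_mem _ hn)⟩

theorem HeapTy.wf_mono {S S' : Store} {h : Heap} (hh : HeapTy S h) (hS : MapSub S' S) :
    Store.Wf 1 S' := fun l T hl => hh.wf l T (hS l T hl)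

/-- The names are taken above two bounds: the weights in `φ`, for freshness, and the ranks of the
values, for gradedness. -/
theorem HeapTy.exists_absHeap {S : Store} {h h' : Heap} (hh : HeapTy S h) (hs : MapSub h' h)
    {φ : Set Name} (hφ : φ.Finite) :
    ∃ χ γ, AbsHeap S h' χ γ ∧ Disjoint φ χ.nu ∧ γ.Graded := by
  obtain ⟨N₁, hN₁⟩ := exists_weight_bound hφ
  obtain ⟨N₂, hN₂⟩ := h'.exists_rank_bound
  let V : ℕ → Tm := fun l => (h'.lookup l).getD .unit
  let T : ℕ → Ty := fun l => (S.lookup l).getD .unit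
  have hV : ∀ l ∈ h', h'.lookup l = some (V l) := by
    intro l hl
    obtain ⟨W, hW⟩ := Finmap.mem_iff.1 hl
    simp [V, hW]
  have hT : ∀ l ∈ h', S.lookup l = some (T l) := by
    intro l hl
    obtain ⟨W, hW⟩ := Finmap.mem_iff.1 ((hh.keys l).2 (hs.mem hl))
    simp [T, hW]
  obtain ⟨B, g, γ, h₁, h₂, h₃, h₄, h₅⟩ := exists_abs_family (S := S) (D := {l | l ∈ h'}) (V := V)
    (T := T) (N := max N₁ N₂)
    (fun l hl => ⟨hh.typed l _ _ (hT l hl) (hs _ _ (hV l hl)), hh.value l _ (hs _ _ (hV l hl))⟩)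
    (fun l hl => (hN₂ l _ (hV l hl)).trans (le_max_right _ _))
  obtain ⟨χ, h₆, h₇⟩ := exists_finmap h'.keys (fun l => if l ∈ h'.keys then some (B l) else none)
    (by intro l; by_cases hl : l ∈ h'.keys <;> simp [hl])
  have hχ : ∀ l W, χ.lookup l = some W → l ∈ h' ∧ W = B l := by
    intro l W hl
    rw [h₇] at hl
    split_ifs at hl with e
    exact ⟨Finmap.mem_keys.1 e, (Option.some.inj hl).symm⟩
  refine ⟨χ, γ, ⟨h₆, ?_, 1, g, ?_, h₄⟩, ?_, h₅⟩
  · intro l l' n hl hl'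
    obtain ⟨hl, e⟩ := hχ l _ hl
    obtain ⟨hl', e'⟩ := hχ l' _ hl'
    exact h₃ l hl l' hl' n (by rw [← e]; rfl) (by rw [← e']; rfl)
  · intro l W hl
    have hm : l ∈ h' := Finmap.mem_of_lookup_eq_some hl
    have : W = V l := by have := hV l hm; rw [hl] at this; exact Option.some.inj this
    subst this
    refine ⟨T l, B l, hT l hm, ?_, hh.typed l _ _ (hT l hm) (hs _ _ hl), h₁ l hm⟩
    rw [h₇, if_pos (Finmap.mem_keys.2 hm)]
  · rw [Set.disjoint_left]
    rintro n hn ⟨l, hl⟩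
    obtain ⟨hl, e⟩ := hχ l _ hl
    have h₈ := h₂ l hl n (by rw [← e]; rfl)
    have h₉ := hN₁ n hn
    have := le_max_left N₁ N₂
    omega

theorem LSubTyped.exists_absLSub {S : Store} {δ : LSub} {Γ : LCtx} (h : LSubTyped S 1 δ Γ)
    (hΓ : (Γ.map Prod.fst).Nodup) {φ : Set Name} (hφ : φ.Finite) :
    ∃ ρ γ, AbsLSub 1 δ Γ ρ γ ∧ Disjoint φ ρ.nu ∧ γ.Graded := by
  classical
  obtain ⟨N₁, hN₁⟩ := exists_weight_bound hφ
  obtain ⟨N₂, hN₂⟩ := exists_bound δ.dom (fun x => (δ.fn x).rank)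
  have hex : ∀ x, ∃ T, x ∈ δ.dom → (x, T) ∈ Γ := by
    intro x
    by_cases hx : x ∈ δ.dom
    · obtain ⟨p, hp, rfl⟩ := List.mem_map.1 ((h.1 x).1 hx)
      exact ⟨p.2, fun _ => hp⟩
    · exact ⟨.unit, fun h => absurd h hx⟩
  choose T hT using hex
  have hu : ∀ x T', (x, T') ∈ Γ → x ∈ δ.dom ∧ T' = T x := by
    intro x T' hx
    have hd : x ∈ δ.dom := (h.1 x).2 (List.mem_map_of_mem hx)
    have := List.inj_on_of_nodup_map hΓ hx (hT x hd) rfl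
    exact ⟨hd, congrArg Prod.snd this⟩
  obtain ⟨B, g, γ, h₁, h₂, h₃, h₄, h₅⟩ := exists_abs_family (S := S) (D := {x | x ∈ δ.dom})
    (V := δ.fn) (T := T) (N := max N₁ N₂)
    (fun x hx => ⟨h.2.2 x _ (hT x hx), LSub.fn_isValue h.2.1 x⟩)
    (fun x hx => (hN₂ x hx).trans (le_max_right _ _))
  refine ⟨⟨δ.dom, fun x => B x⟩, γ, ⟨rfl, ?_, g, ?_, h₄⟩, ?_, h₅⟩
  · intro x y n hx hy
    refine Subtype.ext (h₃ x x.2 y y.2 n ?_ ?_)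
    · change B x = _ at hx; rw [hx]; rfl
    · change B y = _ at hy; rw [hy]; rfl
  · intro x T' hx
    obtain ⟨hd, rfl⟩ := hu x T' hx
    have := h₁ x hd
    rwa [show B x = LSub.fn ⟨δ.dom, fun x => B x⟩ x from (LSub.fn_mk_of_mem (fun x => B x) hd).symm] at this
  · rw [Set.disjoint_left]
    rintro n hn ⟨x, hx⟩
    change B x = _ at hx
    have h₈ := h₂ x x.2 n (by rw [hx]; rfl)
    have h₉ := hN₁ n hn
    have := le_max_left N₁ N₂
    omega

theorem Heap.nu_finite (χ : Heap) : χ.nu.Finite := by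
  refine (Set.Finite.biUnion χ.keys.finite_toSet (t := fun l => {n | χ.lookup l = some (.name n)})
    fun l _ => Set.Subsingleton.finite fun n hn m hm => ?_).subset ?_
  · have := hn.symm.trans hm; cases this; rfl
  · rintro n ⟨l, hl⟩
    exact Set.mem_biUnion (Finset.mem_coe.2 (Finmap.mem_keys.2 (Finmap.mem_of_lookup_eq_some hl))) hl

theorem LSub.nu_finite (ρ : LSub) : ρ.nu.Finite := by
  refine (Set.finite_iUnion (f := fun x => {n | ρ.val x = .name n})
    fun x => Set.Subsingleton.finite fun n hn m hm => ?_).subset ?_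
  · have := hn.symm.trans hm; cases this; rfl
  · rintro n ⟨x, hx⟩; exact Set.mem_iUnion.2 ⟨x, hx⟩

theorem Tm.nu_finite (B : Tm) : B.nu.Finite := by
  cases B <;> simp [Tm.nu]

theorem Heap.closed_of_typed {S : Store} {h : Heap} (hh : HeapTy S h) : h.Closed := by
  intro l l' hl
  obtain ⟨T, hT⟩ := Finmap.mem_iff.1 ((hh.keys l).2 (Finmap.mem_of_lookup_eq_some hl))
  cases hh.typed l T _ hT hl with
  | loc _ h _ => exact (hh.keys l').1 (Finmap.mem_of_lookup_eq_some h)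

/-- The abstraction of a part of the heap may be received by the other side. -/
theorem AbsHeap.oheap {S S₀ S' : Store} {h h₀ h' χ : Heap} {γ : NMap} {θ L : Finset Loc}
    (hχ : AbsHeap S h' χ γ) (hh : HeapTy S h) (hr : IsRestr S h (θ ∪ L) S' h')
    (hag : S₀.Agree S) (hk : h.keys ∩ h₀.keys = θ) : OHeap S₀ h₀ θ L S' χ := by
  obtain ⟨hke, -, i, g, hg, -⟩ := hχ
  obtain ⟨⟨hsub, hθ, hcl⟩, hmin, hS', hkS⟩ := hr
  have hwf : Store.Wf 1 S' := hh.wf_mono hS'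
  have key : ∀ l B, χ.lookup l = some B → ∃ V T, h'.lookup l = some V ∧ S.lookup l = some T ∧
      Typed S i V T ∧ AbsVal i V T B (g l) := by
    intro l B hl
    have hm : l ∈ h'.keys := hke ▸ Finmap.mem_keys.2 (Finmap.mem_of_lookup_eq_some hl)
    obtain ⟨V, hV⟩ := Finmap.mem_iff.1 (Finmap.mem_keys.1 hm)
    obtain ⟨T, B', hT, hB, hVt, hab⟩ := hg l V hV
    rw [hl] at hB; cases hB
    exact ⟨V, T, hV, hT, hVt, hab⟩
  have hloc : ∀ l l', χ.lookup l = some (.loc l') → h'.lookup l = some (.loc l') := by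
    intro l l' hl
    obtain ⟨V, T, hV, -, -, hab⟩ := key l _ hl
    rw [hV, hab.mu_eq rfl]
  have hχcl : χ.Closed := by
    intro l l' hl
    rw [← Finmap.mem_keys, hke, Finmap.mem_keys]
    exact hcl l l' (hloc l l' hl)
  refine ⟨fun l B hl => ?_, ⟨hkS.trans hke.symm, fun l B hl => ?_, i, fun l T B hT hl => ?_⟩, ?_, ?_,
    ⟨.refl _, hke ▸ hθ, hχcl⟩, ?_, .refl _, hkS.trans hke.symm⟩
  · obtain ⟨V, T, -, -, -, hab⟩ := key l B hl; exact hab.isAbs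
  · obtain ⟨V, T, -, -, -, hab⟩ := key l B hl; exact hab.isAbs.isValue
  · obtain ⟨V, T', hV, hT', hVt, hab⟩ := key l B hl
    rw [hS' _ _ hT] at hT'; cases hT'
    refine hab.typed hVt hVt.wf hS' hwf ?_
    intro l' hl'
    cases B with
    | loc k =>
      rw [Finset.mem_singleton.1 hl', hkS]
      exact Finmap.mem_keys.2 (hcl _ _ (hloc _ _ hl))
    | _ => simp [Tm.mu] at hl'
  · intro l T T' hT hT'
    exact hag l T T' hT (hS' _ _ hT')
  · refine Finset.Subset.antisymm ?_ (Finset.subset_inter ?_ ?_)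
    · rw [← hk, hke]; exact Finset.inter_subset_inter_right hsub.keys_subset
    · rw [hke]; exact Finset.subset_union_left.trans hθ
    · rw [← hk]; exact Finset.inter_subset_right
  · intro g' hg' hθ' hgc
    -- Abstraction keeps stored locations, so a closed part of `χ` has the same domain as a closed
    -- part of `h`, to which the minimality of `h'` applies.
    obtain ⟨k, hk₁, hk₂⟩ := exists_restrict h (s := g'.keys)
      ((hg'.keys_subset.trans hke.subset).trans hsub.keys_subset)
    have hle := hmin k hk₁ (hk₂ ▸ hθ') (by
      intro l l' hl
      have hm : l ∈ g' := by
        rw [← Finmap.mem_keys, ← hk₂]; exact Finmap.mem_keys.2 (Finmap.mem_of_lookup_eq_some hl)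
      obtain ⟨B, hB⟩ := Finmap.mem_iff.1 hm
      obtain ⟨V, T, hV, -, hVt, hab⟩ := key l B (hg' _ _ hB)
      have := hsub _ _ hV
      rw [hk₁ _ _ hl] at this; cases this
      rw [← Finmap.mem_keys, hk₂, Finmap.mem_keys]
      refine hgc l l' ?_
      rw [hB]
      cases hVt with
      | loc => rw [hab.eq_loc])
    intro l a hl
    have hm : l ∈ g' := by
      rw [← Finmap.mem_keys, ← hk₂]
      refine hle.keys_subset ?_
      rw [← hke]; exact Finmap.mem_keys.2 (Finmap.mem_of_lookup_eq_some hl)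
    rw [hg'.lookup_eq hm]; exact hl

/-! ## Configurations that can go on -/

/-- The two sides share only the locations in `θ`. -/
structure Apart (A P : Side) (φ : Set Name) (θ : Finset Loc) : Prop where
  renA : A.r = id
  renP : P.r = id
  keys : A.h.keys ∩ P.h.keys = θ
  agree : A.S.Agree P.S
  fin : φ.Finite
  gradedA : A.γ.Graded
  gradedP : P.γ.Graded

/-- `P` learns exactly the locations of `χ`, and the locations of `A` that it knew before, those in
`θ`, are among them. -/
theorem Apart.exchange {A P : Side} {φ φ' : Set Name} {θ L : Finset Loc} (h : Apart A P φ θ)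
    {S' : Store} {h' χ : Heap} {γ : NMap} (hr : IsRestr A.S A.h (θ ∪ L) S' h')
    (hk : χ.keys = h'.keys) (hγ : γ.Graded) (hφ : φ'.Finite) :
    Apart (P.receive A.r S' χ) (A.intro γ) φ' χ.keys := by
  refine ⟨?_, h.renA, ?_, ?_, hφ, h.gradedP, h.gradedA.union hγ⟩
  · funext l
    simp [Side.receive, h.renA, h.renP]
  · ext l
    have h₁ : l ∈ χ.keys → l ∈ A.h.keys := fun hl => hr.1.1.keys_subset (hk ▸ hl)
    have h₂ : l ∈ A.h.keys → l ∈ P.h.keys → l ∈ χ.keys := fun ha hp => by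
      rw [hk]
      refine hr.1.2.1 (Finset.mem_union_left _ ?_)
      rw [← h.keys]; exact Finset.mem_inter.2 ⟨ha, hp⟩
    simp only [Side.receive, Side.intro, Finset.mem_inter, Finmap.mem_keys, Finmap.mem_union]
      at h₁ h₂ ⊢
    tauto
  · intro l T T' hT hT'
    by_cases hl : l ∈ P.S
    · simp only [Side.receive] at hT
      rw [Finmap.lookup_union_left hl] at hT
      exact (h.agree l T' T hT' hT).symm
    · simp only [Side.receive] at hT
      rw [Finmap.lookup_union_right hl] at hT
      exact Option.some.inj ((hr.2.2.1 _ _ hT).symm.trans hT')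

/-- The hole of every frame has the layer and the type of the result of the frame above it, and
the hole of the first one has layer `i` and type `T`. -/
inductive Layered : Layer → Ty → List Frame → List Frame → Prop
  | nil {i T} : Ty.Wf i T → Layered i T [] []
  | cons {F : Frame} {ξ ξ' : List Frame} : Ty.Wf F.iin F.Tin → Layered F.iout F.Tout ξ' ξ →
      Layered F.iin F.Tin (F :: ξ) ξ'

theorem Layered.wf {i : Layer} {T : Ty} {ξ ξ' : List Frame} (h : Layered i T ξ ξ') :
    Ty.Wf i T := by
  cases h <;> assumption

/-- Besides the invariant `linked`, this contains what is needed to construct the next action: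
identity renamings, finitely many graded names, and matching layers. -/
structure Ready (A P : Side) (M : Tm) (T : Ty) (i : Layer) (φ : Set Name) (θ : Finset Loc)
    (ξA ξP : List Frame) (R : Tm) (H : Heap) : Prop where
  linked : Linked A P M T φ θ ξA ξP R H
  apart : Apart A P φ θ
  layered : Layered i T ξP ξA

def Meets (A P : Side) (M : Tm) (T : Ty) (i : Layer) (φ : Set Name) (θ : Finset Loc)
    (ξA ξP : List Frame) : Prop :=
  ∃ t, SharesTrace (.passive P.S P.h P.γ φ ξP θ) (.active M i T A.S A.h A.γ φ ξA θ) t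

/-- The action is put in front of the common trace, and the roles are swapped back by dualizing. -/
theorem Meets.of_action {A P A' P' : Side} {M M' : Tm} {T T' : Ty} {i i' : Layer}
    {φ φ' : Set Name} {θ θ' : Finset Loc} {ξA ξP ξA' ξP' : List Frame} {a : Action}
    (h : Meets A' P' M' T' i' φ' θ' ξA' ξP')
    (hA : Trans (.active M i T A.S A.h A.γ φ ξA θ) (some a)
      (.passive P'.S P'.h P'.γ φ' ξP' θ'))
    (hP : Trans (.passive P.S P.h P.γ φ ξP θ) (some a.dual)
      (.active M' i' T' A'.S A'.h A'.γ φ' ξA' θ')) : Meets A P M T i φ θ ξA ξP := by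
  have hcons : ∀ {C C' : Config} {b : Action} {s : List Action}, Trans C (some b) C' → s ∈ Tr C' →
      b :: s ∈ Tr C := by
    rintro C C' b s hb ⟨_, _, _, _, _, hs⟩
    exact ⟨_, _, _, _, _, .cons ⟨_, .refl, hb⟩ hs⟩
  obtain ⟨t, ht⟩ := h
  refine ⟨_, SharesTrace.symm (t := a :: t) ?_⟩
  rcases ht with ⟨b, hb, h₁, h₂⟩ | ⟨b, hb, h₁, h₂⟩
  · exact Or.inl ⟨b, hb, hcons hA h₁, hcons hP h₂⟩
  · exact Or.inr ⟨b, hb, hcons hA h₁, hcons hP h₂⟩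

theorem Meets.of_tau {A P A' : Side} {M M' : Tm} {T : Ty} {i : Layer} {φ : Set Name}
    {θ : Finset Loc} {ξA ξP : List Frame} (h : Meets A' P M' T i φ θ ξA ξP)
    (hA : Trans (.active M i T A.S A.h A.γ φ ξA θ) none
      (.active M' i T A'.S A'.h A'.γ φ ξA θ)) : Meets A P M T i φ θ ξA ξP := by
  have key : ∀ s ∈ Tr (.active M' i T A'.S A'.h A'.γ φ ξA θ),
      s ∈ Tr (.active M i T A.S A.h A.γ φ ξA θ) := by
    rintro s ⟨_, _, _, _, _, hs⟩
    cases hs with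
    | cons hw hr =>
      obtain ⟨D, hd, hD⟩ := hw
      exact ⟨_, _, _, _, _, .cons ⟨D, .head hA hd, hD⟩ hr⟩
  obtain ⟨t, ⟨b, hb, h₁, h₂⟩ | ⟨b, hb, h₁, h₂⟩⟩ := h
  · exact ⟨t, Or.inl ⟨b, hb, h₁, key _ h₂⟩⟩
  · exact ⟨t, Or.inr ⟨b, hb, h₁, key _ h₂⟩⟩

/-! ### Construction of the next action -/

section

variable {A P : Side} {M V : Tm} {T : Ty} {i : Layer} {φ : Set Name} {θ : Finset Loc}
  {ξA ξP : List Frame} {R : Tm} {H : Heap}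

/-- Provides all of an action but its move: the visible part of the heap, its abstraction by fresh
names, and the conditions for both sides. `N` and `L` are the names and locations of the move. -/
theorem exists_exchange {c : Name → Tm} (hB : Base A P c φ θ H) (hap : Apart A P φ θ)
    {N : Set Name} (hN : Disjoint φ N) (hNf : N.Finite) {γ' : NMap}
    (hγ' : NewIn A P.γ.dom N γ') (hg : γ'.Graded) {L : Finset Loc} (hL : L ⊆ A.h.keys) :
    ∃ S' h' χ γ'', IsRestr A.S A.h (θ ∪ L) S' h' ∧ AbsHeap A.S h' χ γ'' ∧ Fresh φ N χ ∧
      OHeap P.S P.h θ L S' χ ∧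
      Exchange A P φ (φ ∪ N ∪ χ.nu) θ L (γ'.union γ'') S' h' χ ∧
      Apart (P.receive A.r S' χ) (A.intro (γ'.union γ'')) (φ ∪ N ∪ χ.nu) χ.keys ∧
      MapSub S' A.S ∧ L ⊆ S'.keys := by
  have hθ : θ ⊆ A.h.keys := by rw [← hap.keys]; exact Finset.inter_subset_left
  have hkS : A.S.keys = A.h.keys := hB.heapA.heapTyped.1
  obtain ⟨S', h', hr⟩ := exists_isRestr hkS (Heap.closed_of_typed hB.heapA)
    (Finset.union_subset hθ hL)
  obtain ⟨χ, γ'', hχ, hd, hg''⟩ := hB.heapA.exists_absHeap hr.1.1 (hap.fin.union hNf)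
  have hag : P.S.Agree A.S := fun l T T' h₁ h₂ => (hap.agree l T' T h₂ h₁).symm
  have hO := hχ.oheap hB.heapA hr hag hap.keys
  rw [Set.disjoint_union_left] at hd
  have hf : Fresh φ N χ := ⟨hN, hd.1, hd.2, hχ.2.1⟩
  refine ⟨S', h', χ, γ'', hr, hχ, hf, hO, hχ.exchange hB.occA hr hO hf hγ',
    hap.exchange hr hχ.1 (hg.union hg'') ((hap.fin.union hNf).union χ.nu_finite), hr.2.2.1, ?_⟩
  rw [hr.2.2.2]; exact Finset.subset_union_right.trans hr.1.2.1

theorem exists_fresh_absVal (hφ : φ.Finite) {S : Store} {j : Layer} (h : Typed S j V T)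
    (hv : V.IsValue) (hT : Ty.Wf i T) :
    ∃ B g, AbsVal i V T B g ∧ Disjoint φ B.nu ∧ g.Graded := by
  obtain ⟨N, hN⟩ := exists_weight_bound hφ
  obtain ⟨B, g, h₁, h₂, h₃⟩ := h.exists_absVal hv hT (le_max_right N V.rank)
  refine ⟨B, g, h₁, Set.disjoint_left.2 fun n hn hB => ?_, h₃⟩
  have := h₂ n hB
  have := hN n hn
  have := le_max_left N V.rank
  omega

/-- The passive stack is empty, so the empty trace is shared, and the answer is the additional final
action. -/
theorem Ready.meets_final (hR : Ready A P V T i φ θ ξA [] R H) (hV : V.IsValue) :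
    Meets A P V T i φ θ ξA [] := by
  obtain ⟨c, E, hB, ht, ho, hE, -⟩ := hR.linked
  cases hE
  obtain ⟨B, g, hab, hd, hg⟩ := exists_fresh_absVal hR.apart.fin ht hV hR.layered.wf
  obtain ⟨S', h', χ, γ'', hr, hχ, hf, -⟩ := exists_exchange hB hR.apart hd B.nu_finite
    (hab.newIn ho ht) hg (hab.mu_subset ho)
  exact ⟨[], Or.inl ⟨⟨.P, .ans B, S', χ⟩, ⟨rfl, B, rfl⟩, ⟨_, _, _, _, _, .nil _⟩,
    ⟨_, _, _, _, _, .cons ⟨_, .refl, .pa hV hab hr hχ hf⟩ (.nil _)⟩⟩⟩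

/-- By `Layered` the hole of the frame has layer `i`, so an abstraction chosen at layer `i` is
accepted there. -/
theorem Ready.answer {F : Frame} (hR : Ready A P V T i φ θ ξA (F :: ξP) R H) (hV : V.IsValue) :
    ∃ A' P' φ' θ' B, B.IsValue ∧
      Ready A' P' (F.ctx.plug B) F.Tout F.iout φ' θ' ξP ξA R H ∧
      (Meets A' P' (F.ctx.plug B) F.Tout F.iout φ' θ' ξP ξA →
        Meets A P V T i φ θ ξA (F :: ξP)) := by
  obtain ⟨c, E, hB, ht, ho, -, -⟩ := hR.linked
  have hwf := hR.layered.wf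
  obtain ⟨B, g, hab, hd, hg⟩ := exists_fresh_absVal hR.apart.fin ht hV hwf
  obtain ⟨S', h', χ, γ'', hr, hχ, hf, hO, hX, hap, hS', hL⟩ := exists_exchange hB hR.apart hd
    B.nu_finite (hab.newIn ho ht) hg (hab.mu_subset ho)
  have hBt := hab.typed ht hwf hS' (hB.heapA.wf_mono hS') hL
  have hl := hR.layered
  cases hl with
  | cons _ hl =>
    refine ⟨_, _, _, _, B, hab.isAbs.isValue, ⟨hR.linked.answer hX hab.abstr subset_rfl hBt, hap, hl⟩,
      fun hm => hm.of_action (a := ⟨.P, .ans B, S', χ⟩) ?_ ?_⟩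
    · have := Trans.pa (i := F.iin) (γ := A.γ) (ξ := ξA) hV hab hr hχ hf
      rwa [NMap.union_assoc] at this
    · exact .oa hab.isAbs hBt hO hf

/-- The bound on `W` is gradedness. The argument is abstracted at layer `1`, where it is known to be
typed. -/
theorem Ready.questionF {K : ECtx} {f : Name}
    (hR : Ready A P (K.plug (.app (.name f) V)) T i φ θ ξA ξP R H) (hV : V.IsValue) :
    ∃ A' P' φ' θ' W B T' j F, W.IsValue ∧ B.IsValue ∧ W.rank < f.weight ∧
      Ready A' P' (.app W B) T' j φ' θ' ξP (F :: ξA) R H ∧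
      (Meets A' P' (.app W B) T' j φ' θ' ξP (F :: ξA) →
        Meets A P (K.plug (.app (.name f) V)) T i φ θ ξA ξP) := by
  obtain ⟨c, E, hB, ht, ho, -, -⟩ := hR.linked
  obtain ⟨hoK, ⟨W, hW⟩, hoV⟩ := (ECtx.occ_plug _ _).1 ho
  obtain ⟨T', hM, -⟩ := ht.unplug
  obtain ⟨-, hWv, -⟩ := hB.namesP f W hW
  cases hM with
  | @app _ _ _ _ _ _ T₁ _ hf' hVt =>
    obtain ⟨i₁, hn⟩ := hf'.name_inv
    obtain ⟨B, g, hab, hd, hg⟩ := exists_fresh_absVal hR.apart.fin hVt hV hVt.wf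
    obtain ⟨S', h', χ, γ'', hr, hχ, hf, hO, hX, hap, hS', hL⟩ := exists_exchange hB hR.apart hd
      B.nu_finite (hab.newIn hoV hVt) hg (hab.mu_subset hoV)
    have hBt := hab.typed hVt hVt.wf hS' (hB.heapA.wf_mono hS') hL
    refine ⟨_, _, _, _, W, B, T', max i₁ 1, ⟨A.S, K, T', max i₁ 1, T, i⟩, hWv, hab.isAbs.isValue,
      hR.apart.gradedP f W hW,
      ⟨hR.linked.questionF hX _ _ hn hW hab.abstr subset_rfl hBt, hap,
        .cons (F := ⟨A.S, K, T', max i₁ 1, T, i⟩) ?_ hR.layered⟩,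
      fun hm => hm.of_action (a := ⟨.P, .qf f B, S', χ⟩) ?_ ?_⟩
    · have := hn.wf
      cases this with
      | arrow _ h => exact h.mono (le_max_left _ _)
    · have := Trans.pqf (i := i) (K := K) (T := T) (γ := A.γ) (ξ := ξA) hV hn hVt hab hr hχ hf
      rwa [NMap.union_assoc] at this
    · exact .oqf hn hW hab.isAbs hBt hO hf

theorem isValue_pending {V : Tm} (h : V.IsValue) : V.pending = 0 := by
  cases V <;> first | rfl | exact h.elim

/-- Substituting values keeps the evaluation positions, and values have nothing pending. -/
theorem Tm.pending_subL {M : Tm} : ∀ {β : ℕ → Tm} {δ : LVar → Tm}, (∀ n, (β n).IsValue) →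
    (∀ x, (δ x).IsValue) → (M.subL β δ).pending = M.pending := by
  induction M with
  | bvar n => intro β δ hβ hδ; exact isValue_pending (hβ n)
  | lvar x => intro β δ hβ hδ; exact isValue_pending (hδ x)
  | app M N ihM ihN =>
    intro β δ hβ hδ; simp only [Tm.subL, Tm.pending, ihM hβ hδ, ihN hβ hδ]
  | arith o M N ihM ihN =>
    intro β δ hβ hδ; simp only [Tm.subL, Tm.pending, ihM hβ hδ, ihN hβ hδ]
  | assign M N ihM ihN =>
    intro β δ hβ hδ; simp only [Tm.subL, Tm.pending, ihM hβ hδ, ihN hβ hδ]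
  | ite M N L ihM _ _ => intro β δ hβ hδ; exact ihM hβ hδ
  | letbox M N ihM _ => intro β δ hβ hδ; exact ihM hβ hδ
  | ref M ih => intro β δ hβ hδ; exact ih hβ hδ
  | deref M ih => intro β δ hβ hδ; exact ih hβ hδ
  | _ => intros; rfl

theorem Code.pending_inst {W : Tm} {k : Code} (hk : W.code = some k) {ρ : LSub}
    (hρ : ∀ x, (ρ.val x).IsValue) : (k.inst ρ).pending = W.rank := by
  cases W with
  | box N => cases hk; exact Tm.pending_subL (fun _ => trivial) (LSub.fn_isValue hρ)
  | name n => cases hk; rfl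
  | _ => cases hk

theorem LSub.mu_subset {ρ : LSub} {s : Finset Loc} (h : ∀ x, (ρ.val x).mu ⊆ s) : ρ.mu ⊆ s :=
  Finset.biUnion_subset.2 fun x _ => h x

/-- The bound on `M'` comes from gradedness, since instantiating code with values keeps its pending
weight (`Code.pending_inst`). -/
theorem Ready.questionB {K : ECtx} {b : Name} {d : Finset LVar} {s : {x // x ∈ d} → Tm}
    (hR : Ready A P (K.plug (.unbox b d s)) T i φ θ ξA ξP R H) :
    ∃ A' P' φ' θ' M' T' j F, F.ctx = K ∧ M'.pending < b.weight ∧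
      Ready A' P' M' T' j φ' θ' ξP (F :: ξA) R H ∧
      (Meets A' P' M' T' j φ' θ' ξP (F :: ξA) →
        Meets A P (K.plug (.unbox b d s)) T i φ θ ξA ξP) := by
  obtain ⟨c, E, hB, ht, ho, -, -⟩ := hR.linked
  obtain ⟨hoK, ⟨W, hW⟩, hos⟩ := (ECtx.occ_plug _ _).1 ho
  obtain ⟨T', hM, -⟩ := ht.unplug
  obtain ⟨-, hWv, -, -, T₀, i₀, hT₀, hWt⟩ := hB.namesP b W hW
  cases hM with
  | @unbox _ _ _ _ _ _ _ Γ _ hw hn hd hsv hst =>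
    obtain ⟨rfl, -⟩ := hn.unique hT₀
    have hΓ : (Γ.map Prod.fst).Nodup ∧ (∀ p ∈ Γ, Ty.Wf 0 p.2) ∧ Ty.Wf 0 T' := by
      have := hn.wf
      cases this with | box h₁ h₂ h₃ => exact ⟨h₁, h₂, h₃⟩
    have hδ : LSubTyped A.S 1 ⟨d, s⟩ Γ := by
      refine ⟨hd, hsv, fun x T hx => ?_⟩
      have hxd : x ∈ d := (hd x).2 (List.mem_map_of_mem hx)
      rw [LSub.fn_mk_of_mem _ hxd]; exact hst ⟨x, hxd⟩ T hx
    obtain ⟨ρ, g, hab, hdis, hg⟩ := hδ.exists_absLSub hΓ.1 hR.apart.fin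
    have hρd : ∀ x ∈ ρ.dom, x ∈ d := fun x hx => hab.1.subset hx
    have hval : ∀ x : {x // x ∈ ρ.dom}, ∃ T g', AbsVal 1 (s ⟨x.1, hρd x.1 x.2⟩) T (ρ.val x) g' := by
      intro x
      have hxd : x.1 ∈ d := hρd x.1 x.2
      obtain ⟨p, hp, hx⟩ := List.mem_map.1 ((hd x.1).1 hxd)
      obtain ⟨-, -, g', h₁, -⟩ := hab
      have := h₁ p.1 p.2 hp
      rw [hx, LSub.fn_mk_of_mem _ hxd, LSub.fn_of_mem x.2] at this
      exact ⟨p.2, _, this⟩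
    have hmu : ρ.mu ⊆ A.h.keys := LSub.mu_subset fun x =>
      let ⟨_, _, h⟩ := hval x; h.mu_subset (hos _)
    obtain ⟨S', h', χ, γ'', hr, hχ, hf, hO, hX, hap, hS', hL⟩ := exists_exchange hB hR.apart hdis
      ρ.nu_finite (hab.newIn hos hδ) hg hmu
    have hρ : LSubTyped S' 1 ρ Γ := by
      refine ⟨fun x => by rw [hab.1]; exact hd x, fun x => ?_, fun x T hx => ?_⟩
      · obtain ⟨_, _, h⟩ := hval x; exact h.isAbs.isValue
      · have hxρ : x ∈ ρ.dom := hab.1 ▸ (hd x).2 (List.mem_map_of_mem hx)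
        obtain ⟨-, -, g', h₁, -⟩ := hab
        refine (h₁ x T hx).typed (hδ.2.2 x T hx) (hδ.2.2 x T hx).wf hS' (hB.heapA.wf_mono hS') ?_
        rw [LSub.fn_of_mem hxρ]; exact (ρ.mu_val_subset _).trans hL
    obtain ⟨k, hk⟩ : ∃ k, W.code = some k := by
      rcases hWt.canon_box hWv with ⟨N, rfl, -⟩ | ⟨m, rfl, -⟩
      exacts [⟨_, rfl⟩, ⟨_, rfl⟩]
    refine ⟨_, _, _, _, k.inst ρ, T', 1, ⟨A.S, K, T', 1, T, i⟩, rfl, ?_,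
      ⟨hR.linked.questionB (δ := ⟨d, s⟩) hX _ _ hn hW hk hab.1 (hab.abstr hd) subset_rfl hρ, hap,
        .cons (F := ⟨A.S, K, T', 1, T, i⟩) (hΓ.2.2.mono (Layer.le_one 0)) hR.layered⟩,
      fun hm => hm.of_action (a := ⟨.P, .qb b ρ, S', χ⟩) ?_ ?_⟩
    · rw [Code.pending_inst hk hρ.2.1]; exact hR.apart.gradedP b W hW
    · have := Trans.pqb (i := i) (K := K) (T := T) (γ := A.γ) (ξ := ξA) hn hδ hab hr hχ hf
      rwa [NMap.union_assoc] at this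
    · exact .oqb hn hW hk (fun x => let ⟨_, _, h⟩ := hval x; h.isAbs) hab.2.1 hρ hO hf

end

/-! ## Reductions are traces of linked configurations -/

/-- `(M, h)` reduces to a value in `n` steps. -/
def ConvergesIn : ℕ → Tm → Heap → Prop
  | 0, M, _ => M.IsValue
  | n + 1, M, h => ∃ M' h', Step (M, h) (M', h') ∧ ConvergesIn n M' h'

theorem Converges.convergesIn {M : Tm} {h : Heap} (hc : Converges M h) :
    ∃ n, ConvergesIn n M h := by
  obtain ⟨V, h', hV, hs⟩ := hc
  have key : ∀ p q, Relation.ReflTransGen Step p q → q.1.IsValue → ∃ n, ConvergesIn n p.1 p.2 := by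
    intro p q hs hq
    induction hs using Relation.ReflTransGen.head_induction_on with
    | refl => exact ⟨0, hq⟩
    | head h _ ih => obtain ⟨n, hn⟩ := ih; exact ⟨n + 1, _, _, h, hn⟩
  exact key _ _ hs hV

/-- The weight of the questions on boxes that remain when the hole is filled with a value. -/
def ECtx.pending : ECtx → ℕ
  | .hole => 0
  | .appL K M | .arithL _ K M | .assignL K M => K.pending + M.pending
  | .appR _ _ K | .arithR _ _ _ K | .assignR _ _ K | .ref K | .deref K => K.pending
  | .ite K _ _ | .letbox K _ => K.pending

/-- The values to the left of the hole contribute nothing. -/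
theorem ECtx.pending_plug (K : ECtx) (M : Tm) :
    (K.plug M).pending = K.pending + M.pending := by
  induction K with
  | hole => exact (Nat.zero_add _).symm
  | appL K N ih | arithL o K N ih | assignL K N ih =>
    simp only [ECtx.plug, Tm.pending, ECtx.pending, ih]; omega
  | appR V hV K ih | arithR o V hV K ih | assignR V hV K ih =>
    simp only [ECtx.plug, Tm.pending, ECtx.pending, ih, isValue_pending hV]; omega
  | ite K N L ih => exact ih
  | letbox K N ih => exact ih
  | ref K ih => exact ih
  | deref K ih => exact ih

def stackPending (ξ : List Frame) : ℕ := (ξ.map fun F => F.ctx.pending).sum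

/-- Both parts are values, so a non-value in evaluation position can only be the whole term. -/
theorem not_external_app {W B : Tm} (hW : W.IsValue) (hn : ∀ n, W ≠ .name n) (hB : B.IsValue) :
    ¬ External (.app W B) := by
  have key : ∀ (K : ECtx) (M : Tm), ¬ M.IsValue → .app W B = K.plug M → M = .app W B := by
    intro K M hM e
    cases K with
    | hole => exact e.symm
    | appL K N => cases e; exact absurd hW (K.plug_not_isValue hM)
    | appR V hV K => cases e; exact absurd hB (K.plug_not_isValue hM)
    | _ => cases e
  rintro (⟨K, f, V, hV, e⟩ | ⟨K, b, d, s, e⟩)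
  · have := key K _ id e
    cases this; exact hn f rfl
  · have := key K _ id e
    cases this

section

variable {A P : Side} {M V : Tm} {T : Ty} {i : Layer} {φ : Set Name} {θ : Finset Loc}
  {ξA ξP : List Frame} {R : Tm} {H : Heap}

/-- The concretization of `M` is not a value, so the next reduction of `R` takes place in it
(`CStep.unplug`) and is reflected by `CStep.back`. The side allocates the same location as `R`,
which keeps the renaming the identity. -/
theorem Ready.internal {n : ℕ} (hR : Ready A P M T i φ θ ξA ξP R H) (hM : ¬ M.IsValue)
    (hx : ¬ External M) (hc : ConvergesIn n R H) :
    ∃ m A' M' R' H', m < n ∧ Ready A' P M' T i φ θ ξA ξP R' H' ∧ ConvergesIn m R' H' ∧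
      (Meets A' P M' T i φ θ ξA ξP → Meets A P M T i φ θ ξA ξP) := by
  obtain ⟨⟨c, E, hB, ht, ho, hE, rfl⟩, hap, hl⟩ := hR
  have hv : ¬ (conc A.r c M).IsValue := by
    rw [hap.renA]; exact (not_value_cases c hM).resolve_left hx
  cases n with
  | zero => exact absurd hc (E.plug_not_isValue hv)
  | succ n =>
    obtain ⟨R', H', hs, hc⟩ := hc
    obtain ⟨N, rfl, hs⟩ := hs.cstep.unplug hv
    obtain ⟨S, h, γ, r⟩ := A
    obtain rfl : r = id := hap.renA
    obtain ⟨M', h', hs', rfl, hr', he⟩ :=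
      (CStep.back hB.good ht hB.heapA ho hB.occA hB.relA hs).resolve_left hx
    obtain ⟨S', hS, hh', ht'⟩ := hs'.preservation ht hB.heapA
    obtain ⟨h₄, h₅, -⟩ := hs'.occ ho hB.occA
    obtain ⟨hB', hle⟩ := hB.step hS hh' h₅ hr' he
    -- A location new to `A` is fresh in `H`, which contains the private part of `P` under the
    -- identity renaming. So the two sides gain no common location.
    have hback : ∀ l ∈ h', l ∈ P.h → l ∈ θ := by
      intro l hl hlP
      by_contra hθ
      obtain ⟨W, hW⟩ := Finmap.mem_iff.1 hlP
      have hH := Finmap.mem_of_lookup_eq_some (hB.relP l W hW hθ)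
      rw [hap.renP] at hH
      rcases he.fresh l hl with hl' | hl'
      · refine hθ ?_
        rw [← hap.keys]
        exact Finset.mem_inter.2 ⟨Finmap.mem_keys.2 hl', Finmap.mem_keys.2 hlP⟩
      · exact hl' hH
    refine ⟨n, ⟨S', h', γ, id⟩, M', _, H', Nat.lt_succ_self n,
      ⟨⟨c, E, hB', ht', h₄,
        hE.later hB'.good (.refl hB.heapP.wf) hle (fun _ _ => rfl) (fun _ _ => rfl), rfl⟩,
        ⟨rfl, hap.renP, ?_, ?_, hap.fin, hap.gradedA, hap.gradedP⟩, hl⟩, hc,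
      fun hm => hm.of_tau (.tau hs'.step hS hh'.heapTyped ⟨1, ht'⟩)⟩
    · ext l
      simp only [Finset.mem_inter, Finmap.mem_keys]
      exact ⟨fun hl => hback l hl.1 hl.2,
        fun hl => ⟨he.sub (hB.shared l hl).1, (hB.shared l hl).2.1⟩⟩
    · intro l T₁ T₂ h₁ h₂
      have hl := hback l ((hh'.keys l).1 (Finmap.mem_of_lookup_eq_some h₁))
        ((hB.heapP.keys l).1 (Finmap.mem_of_lookup_eq_some h₂))
      obtain ⟨T₃, h₃⟩ := Finmap.mem_iff.1 ((hB.heapA.keys l).2 (hB.shared l hl).1)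
      have := hS _ _ h₃
      rw [h₁] at this; cases this
      exact hap.agree l _ _ h₃ h₂

end

/-! ### Induction on reductions, then on questions -/

/-- Every ready pair of configurations whose program reduces to a value in `n` steps meets. -/
def MeetsAt (n : ℕ) : Prop :=
  ∀ {A P : Side} {M : Tm} {T : Ty} {i : Layer} {φ : Set Name} {θ : Finset Loc}
    {ξA ξP : List Frame} {R : Tm} {H : Heap}, Ready A P M T i φ θ ξA ξP R H →
    ConvergesIn n R H → Meets A P M T i φ θ ξA ξP

theorem Ready.meets_internal {n : ℕ} (ih : ∀ m < n, MeetsAt m) {A P : Side} {M : Tm} {T : Ty}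
    {i : Layer} {φ : Set Name} {θ : Finset Loc} {ξA ξP : List Frame} {R : Tm} {H : Heap}
    (hR : Ready A P M T i φ θ ξA ξP R H) (hM : ¬ M.IsValue) (hx : ¬ External M)
    (hc : ConvergesIn n R H) : Meets A P M T i φ θ ξA ξP := by
  obtain ⟨m, A', M', R', H', hm, hR', hc', h⟩ := hR.internal hM hx hc
  exact h (ih m hm hR' hc')

/-- The name may stand for a name of the other side, so several questions may follow one another
without a reduction, each to a name of smaller weight. They end at a `λ` or `rec`, where a reduction
takes place and `ih` applies. -/
theorem Ready.meets_questionF {n : ℕ} (ih : ∀ m < n, MeetsAt m) (k : ℕ) :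
    ∀ {A P : Side} {K : ECtx} {f : Name} {V : Tm} {T : Ty} {i : Layer} {φ : Set Name}
      {θ : Finset Loc} {ξA ξP : List Frame} {R : Tm} {H : Heap}, f.weight ≤ k →
      Ready A P (K.plug (.app (.name f) V)) T i φ θ ξA ξP R H → V.IsValue →
      ConvergesIn n R H → Meets A P (K.plug (.app (.name f) V)) T i φ θ ξA ξP := by
  induction k with
  | zero =>
    intro A P K f V T i φ θ ξA ξP R H hk
    cases f <;> simp [Name.weight] at hk
  | succ k ihk =>
    intro A P K f V T i φ θ ξA ξP R H hk hR hV hc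
    obtain ⟨A', P', φ', θ', W, B, T', j, F, hW, hB, hlt, hR', hm⟩ := hR.questionF hV
    refine hm ?_
    by_cases hn : ∃ g, W = .name g
    · obtain ⟨g, rfl⟩ := hn
      exact ihk (K := .hole) (Nat.le_of_lt_succ (hlt.trans_le hk)) hR' hB hc
    · exact hR'.meets_internal ih id (not_external_app hW (fun g e => hn ⟨g, e⟩) hB) hc

/-- An answer keeps the total pending weight and shortens the stacks by one. A question to a box
lowers the pending weight, which counts twice, and lengthens the stacks by one. A question to a
function needs no measure here, as it leads to a reduction. -/
theorem Ready.meets_of_measure {n : ℕ} (ih : ∀ m < n, MeetsAt m) (k : ℕ) :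
    ∀ {A P : Side} {M : Tm} {T : Ty} {i : Layer} {φ : Set Name}
      {θ : Finset Loc} {ξA ξP : List Frame} {R : Tm} {H : Heap},
      2 * (M.pending + stackPending ξA + stackPending ξP) + (ξA.length + ξP.length) < k →
      Ready A P M T i φ θ ξA ξP R H → ConvergesIn n R H → Meets A P M T i φ θ ξA ξP := by
  induction k with
  | zero => intro A P M T i φ θ ξA ξP R H hk; exact absurd hk (Nat.not_lt_zero _)
  | succ k ihk =>
    intro A P M T i φ θ ξA ξP R H hk hR hc
    by_cases hM : M.IsValue
    · cases ξP with
      | nil => exact hR.meets_final hM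
      | cons F ξP =>
        obtain ⟨A', P', φ', θ', B, hB, hR', hm⟩ := hR.answer hM
        refine hm (ihk ?_ hR' hc)
        rw [ECtx.pending_plug, isValue_pending hB]
        simp only [stackPending, List.map_cons, List.sum_cons, List.length_cons] at hk ⊢
        omega
    · by_cases hx : External M
      · rcases hx with ⟨K, f, V, hV, rfl⟩ | ⟨K, b, d, s, rfl⟩
        · exact hR.meets_questionF ih _ le_rfl hV hc
        · obtain ⟨A', P', φ', θ', M', T', j, F, rfl, hlt, hR', hm⟩ := hR.questionB
          refine hm (ihk ?_ hR' hc)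
          rw [ECtx.pending_plug] at hk
          simp only [stackPending, List.map_cons, List.sum_cons, List.length_cons,
            Tm.pending] at hk ⊢
          omega
      · exact hR.meets_internal ih hM hx hc

theorem meetsAt (n : ℕ) : MeetsAt n := by
  induction n using Nat.strong_induction_on with
  | _ n ih => intro A P M T i φ θ ξA ξP R H hR hc; exact hR.meets_of_measure ih _ (Nat.lt_succ_self _) hc

/-! ## The initial configurations -/

theorem NewIn.union {A : Side} {PN N N' : Set Name} {γ γ' : NMap} (h : NewIn A PN N γ)
    (h' : NewIn A PN N' γ') : NewIn A PN (N ∪ N') (γ.union γ') := by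
  intro n W hn
  rcases e : γ n with _ | V
  · obtain ⟨h₁, h₂⟩ := h' n W (by simpa [NMap.union, e] using hn)
    exact ⟨Or.inr h₁, h₂⟩
  · have : V = W := by simpa [NMap.union, e] using hn
    obtain ⟨h₁, h₂⟩ := h n W (this ▸ e)
    exact ⟨Or.inl h₁, h₂⟩

theorem GSubTyped.lookup {S : Store} {σ : GSub} {Ψ : GCtx} (h : GSubTyped S σ Ψ) :
    σ.length = Ψ.length ∧ ∀ (u : ℕ) (N : Tm) (p : LCtx × Ty),
      σ[u]? = some N → Ψ[u]? = some p → HasTy S [] p.1 [] 0 N p.2 := by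
  obtain ⟨h₁, h₂⟩ := List.forall₂_iff_get.1 h
  refine ⟨h₁, fun u N p hN hp => ?_⟩
  obtain ⟨hu, rfl⟩ := List.getElem?_eq_some_iff.1 hN
  obtain ⟨hu', rfl⟩ := List.getElem?_eq_some_iff.1 hp
  exact h₂ u hu hu'

theorem AbsGSub.newIn {A : Side} {PN : Set Name} {σ : GSub} {Ψ : GCtx} {η : AGSub} {γ : NMap}
    (h : AbsGSub σ Ψ η γ) (hw : Store.Wf 1 A.S) (ht : GSubTyped A.S σ Ψ)
    (ho : ∀ N ∈ σ, Occ PN A.h.locs N) : NewIn A PN η.nu γ := by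
  obtain ⟨hl, -, g, hg, hu⟩ := h
  obtain ⟨hlen, ht⟩ := ht.lookup
  intro n W hn
  obtain ⟨u, hσ, hW⟩ := (hu n W).1 hn
  have hσ : u < σ.length := hσ
  have hN := List.getElem?_eq_getElem hσ
  have hp := List.getElem?_eq_getElem (hlen ▸ hσ)
  have hb := List.getElem?_eq_getElem (hl ▸ hσ)
  obtain ⟨e, rfl, h₁, h₂⟩ := (hg u _ _ _ hN hp hb).some hW
  cases e
  exact ⟨List.getElem_mem _, h₁, ho σ[u] (List.getElem_mem _), _, _, h₂,
    .box (CtxWf.nil hw 1) (ht u _ _ hN hp)⟩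

theorem AbsGSub.abstr {σ : GSub} {Ψ : GCtx} {η : AGSub} {g γ' γ'' : NMap}
    (h : AbsGSub σ Ψ η g) : ∀ (u : ℕ) (N : Tm) (p : LCtx × Ty) (b : Name), σ[u]? = some N →
    Ψ[u]? = some p → η[u]? = some b →
    Abstr ((g.union γ').union γ'') 1 (.box N) (.box p.1 p.2) (.name b) := by
  obtain ⟨hl, -, g', hg, hu⟩ := h
  intro u N p b hN hp hb
  refine ⟨g' u, hg u N p b hN hp hb, fun n W hn => ?_⟩
  have : g n = some W := (hu n W).2 ⟨u, (List.getElem?_eq_some_iff.1 hN).1, hn⟩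
  simp [NMap.union, this]

theorem Occ.pending {PL : Set Loc} {M : Tm} (h : Occ ∅ PL M) : M.pending = 0 := by
  induction M with
  | unbox => exact h.1.elim
  | _ => simp_all [Occ, Tm.pending]

theorem Occ.rank {PL : Set Loc} {M : Tm} (h : Occ ∅ PL M) : M.rank = 0 := by
  cases M with
  | name n => exact h.elim
  | box M => exact Occ.pending (M := M) h
  | _ => rfl

theorem Name.weight_pos (n : Name) : 0 < n.weight := by cases n <;> exact Nat.succ_pos _

theorem ECtxTyped.occ {S : Store} {i₀ i : Layer} {T₀ T : Ty} {K : ECtx}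
    (h : ECtxTyped S i₀ T₀ K i T) (hn : K.NameFree) : K.Occ ∅ {l | l ∈ S} := by
  induction h with
  | hole => trivial
  | appL _ h ih => exact ⟨ih hn.1, hn.2.occ h.occ⟩
  | appR h _ ih => exact ⟨hn.1.occ h.occ, ih hn.2⟩
  | arithL o _ h ih => exact ⟨ih hn.1, hn.2.occ h.occ⟩
  | arithR o h _ ih => exact ⟨hn.1.occ h.occ, ih hn.2⟩
  | ite _ h h' ih => exact ⟨ih hn.1, hn.2.1.occ h.occ, hn.2.2.occ h'.occ⟩
  | ref _ ih => exact ih hn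
  | deref _ ih => exact ih hn
  | assignL _ h ih => exact ⟨ih hn.1, hn.2.occ h.occ⟩
  | assignR h _ ih => exact ⟨hn.1.occ h.occ, ih hn.2⟩
  | letbox _ h ih => exact ⟨ih hn.1, hn.2.occ h.occ⟩

theorem ECtxTyped.wf {S : Store} {i₀ i : Layer} {T₀ T : Ty} {K : ECtx}
    (h : ECtxTyped S i₀ T₀ K i T) (hT : Ty.Wf i₀ T₀) : Ty.Wf i T := by
  induction h with
  | hole h => exact hT.mono h
  | appL _ _ ih => cases ih; assumption
  | appR h _ _ => have := h.wf; cases this; assumption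
  | arithL | arithR => exact .int _
  | ite _ h _ _ => exact h.wf
  | ref _ ih => exact .ref ih
  | deref _ ih => cases ih; assumption
  | assignL | assignR => exact .unit _
  | letbox _ h _ => exact h.wf

def Side.empty : Side := ⟨∅, ∅, .empty, id⟩

theorem NMap.dom_empty : NMap.empty.dom = ∅ := by
  ext n; simp [NMap.dom, NMap.empty]

theorem goodEnv_unit : GoodEnv (fun _ => .unit) :=
  ⟨fun _ => trivial, fun _ => trivial, nofun, nofun⟩

theorem Heap.occ_of_nameFree {S : Store} {h : Heap} (hh : HeapTy S h)
    (hn : ∀ l V, h.lookup l = some V → V.NameFree) : h.Occ ∅ := by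
  intro l V hl
  obtain ⟨T, hT⟩ := Finmap.mem_iff.1 ((hh.keys l).2 (Finmap.mem_of_lookup_eq_some hl))
  exact ((hn l V hl).occ (hh.typed l T V hT hl).occ).mono subset_rfl fun l hl => (hh.keys l).1 hl

/-- One side owns the whole heap and there are no names yet, so their interpretation is immaterial;
`unit` serves as default. -/
theorem Base.initial {S : Store} {h : Heap} (hh : HeapTy S h)
    (hn : ∀ l V, h.lookup l = some V → V.NameFree) :
    Base ⟨S, h, .empty, id⟩ .empty (fun _ => .unit) ∅ ∅ h := by
  refine ⟨goodEnv_unit, ?_, ?_, hh, ?_, ?_, ?_, ⟨?_, fun _ _ _ _ e => e⟩, ?_, fun _ _ _ _ e => e,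
    ?_, ?_, ?_, ?_⟩
  · rintro _ _ _ ⟨_, h⟩; cases h
  · rintro _ _ _ ⟨_, h⟩; cases h
  · exact ⟨fun _ => Iff.rfl, nofun, nofun, nofun⟩
  · rw [show Side.empty.γ.dom = ∅ from NMap.dom_empty]; exact Heap.occ_of_nameFree hh hn
  · intro _ _ h; cases h
  · intro l V hl
    rw [(hn l V hl).conc_id]; exact hl
  · intro _ _ h; cases h
  · intro l hl; exact absurd hl Finmap.notMem_empty
  · intro l hl; exact absurd hl (Finset.notMem_empty l)
  · intro _ _ h; cases h
  · intro _ _ h; cases h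

theorem Apart.initial (S : Store) (h : Heap) : Apart ⟨S, h, .empty, id⟩ .empty ∅ ∅ := by
  refine ⟨rfl, rfl, ?_, ?_, Set.finite_empty, ?_, ?_⟩
  · ext l
    simp only [Side.empty, Finset.mem_inter, Finmap.mem_keys]
    exact ⟨fun hl => absurd hl.2 Finmap.notMem_empty, fun hl => absurd hl (Finset.notMem_empty l)⟩
  · intro _ _ _ _ h; cases h
  · intro _ _ h; cases h
  · intro _ _ h; cases h

/-- In the left-biased union, a value of `g` is visible only where `g'` is undefined; disjointness
of the names provides this. -/
theorem AbsLSub.abstr_right {S : Store} {i : Layer} {δ ρ : LSub} {Γ : LCtx} {g g' γ'' : NMap}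
    {N : Set Name} (h : AbsLSub i δ Γ ρ g) (ht : LSubTyped S i δ Γ)
    (hN : ∀ n W, g' n = some W → n ∈ N) (hd : Disjoint N ρ.nu) :
    ∀ x T, (x, T) ∈ Γ → Abstr ((g'.union g).union γ'') i (δ.fn x) T (ρ.fn x) := by
  intro x T hx
  obtain ⟨g₀, h₁, h₂⟩ := h.abstr (γ'' := .empty) ht.1 x T hx
  refine ⟨g₀, h₁, fun n W hn => ?_⟩
  have hg : g n = some W := by simpa [NMap.union, NMap.empty] using h₂ n W hn
  have hx' : x ∈ ρ.dom := h.1 ▸ (ht.1 x).2 (List.mem_map_of_mem hx)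
  have hnρ : n ∈ ρ.nu := ⟨⟨x, hx'⟩, by rw [← LSub.fn_of_mem hx']; exact (h₁.some hn).1⟩
  rcases e : g' n with _ | V
  · simp [NMap.union, e, hg]
  · exact absurd hnρ (Set.disjoint_left.1 hd (hN n V e))

/-- The initial configurations are views of the program in its context. -/
theorem ready_initial {S S' S'' : Store} {Ψ : GCtx} {Γ : LCtx} {i i' : Layer} {T T' : Ty}
    {M : Tm} {K : ECtx} {σ : GSub} {δ : LSub} {h h' : Heap}
    {η : AGSub} {γ : NMap} {ρ : LSub} {γ' : NMap} {χ : Heap} {γ'' : NMap}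
    (hM : HasTy S Ψ Γ [] i M T) (hMn : M.NameFree)
    (hK : ECtxTyped S' i T K i' T') (hKn : K.NameFree)
    (hσ : GSubTyped S' σ Ψ) (hσn : ∀ N ∈ σ, N.NameFree)
    (hδ : LSubTyped S' i δ Γ) (hδn : ∀ x, (δ.val x).NameFree)
    (hh : HeapTyped S' h) (hhn : ∀ l V, h.lookup l = some V → V.NameFree)
    (hS : MapSub S S')
    (hη : AbsGSub σ Ψ η γ) (hρ : AbsLSub i δ Γ ρ γ')
    (hr : IsRestr S' h (S.keys ∪ ρ.mu) S'' h') (hχ : AbsHeap S' h' χ γ'')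
    (hd₁ : Disjoint η.nu ρ.nu) (hd₂ : Disjoint η.nu χ.nu) (hd₃ : Disjoint ρ.nu χ.nu) :
    Ready ⟨S'', χ, .empty, id⟩ ⟨S', h, (γ.union γ').union γ'', id⟩ ((M.subG η.fn).lsub ρ) T i
      (η.nu ∪ ρ.nu ∪ χ.nu) χ.keys [] [⟨S', K, T, i, T', i'⟩]
      (K.plug ((M.subG σ.fn).lsub δ)) h := by
  have hhT := hh.heapTy
  -- The starting point is the context alone, facing an empty side. The abstractions of `σ`, `δ` and
  -- the heap are sent in one exchange, with the locations of `S` and `ρ` as those of the move; the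
  -- receiver is then the program.
  let A : Side := ⟨S', h, .empty, id⟩
  have hB : Base A .empty (fun _ => .unit) ∅ ∅ h := Base.initial hhT hhn
  have hPN : Side.empty.γ.dom = ∅ := NMap.dom_empty
  have hr' : IsRestr A.S A.h (∅ ∪ (S.keys ∪ ρ.mu)) S'' h' := by rwa [Finset.empty_union]
  have hO : OHeap Side.empty.S Side.empty.h ∅ (S.keys ∪ ρ.mu) S'' χ :=
    hχ.oheap hhT hr' (fun _ _ _ h => by cases h) (Apart.initial S' h).keys
  have hlocs : {l | l ∈ S'} ⊆ A.h.locs := fun l hl => (hhT.keys l).1 hl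
  obtain ⟨hlen, hσt⟩ := hσ.lookup
  have hσo : ∀ N ∈ σ, Occ ∅ A.h.locs N := by
    intro N hN
    obtain ⟨u, hu, rfl⟩ := List.getElem_of_mem hN
    have := hσt u _ _ (List.getElem?_eq_getElem hu) (List.getElem?_eq_getElem (hlen ▸ hu))
    exact ((hσn _ hN).occ this.occ).mono subset_rfl hlocs
  have hδo : ∀ x, Occ ∅ A.h.locs (δ.val x) := by
    intro x
    obtain ⟨p, hp, hx⟩ := List.mem_map.1 ((hδ.1 x).1 x.2)
    have := hδ.2.2 _ _ hp
    rw [hx, LSub.fn_of_mem x.2] at this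
    exact ((hδn x).occ this.occ).mono subset_rfl hlocs
  have hnη : NewIn A Side.empty.γ.dom η.nu γ := hη.newIn hhT.wf hσ (by rwa [hPN])
  have hnρ : NewIn A Side.empty.γ.dom ρ.nu γ' := hρ.newIn (by rwa [hPN]) hδ
  have hnew := hnη.union hnρ
  have hX := hχ.exchange (φ := ∅) hB.occA hr' hO
    ⟨Set.empty_disjoint _, Set.empty_disjoint _, Set.disjoint_union_left.2 ⟨hd₂, hd₃⟩, hχ.2.1⟩ hnew
  rw [Set.empty_union] at hX
  have hfin : (η.nu ∪ ρ.nu ∪ χ.nu).Finite :=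
    ((List.finite_toSet η).union ρ.nu_finite).union χ.nu_finite
  -- The initial values are name-free and so of rank `0`, below every weight.
  have hgr : NMap.Graded ((γ.union γ').union γ'') := by
    intro n V hn
    have ho := (hX.new n V hn).2.2.2.1
    rw [hPN] at ho
    rw [ho.rank]; exact n.weight_pos
  have hap := (Apart.initial S' h).exchange hr' hχ.1 hgr hfin
  obtain ⟨hgood, -, hB', -, -, habs⟩ := hB.exchange hX.sub hX.new hX.restr hX.heap hX.oheap
  -- Both renamings are the identity, so the case distinction in the new one disappears.
  have eP : Side.empty.receive A.r S'' χ = ⟨S'', χ, .empty, id⟩ := by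
    simp only [Side.receive, Side.empty, Finmap.empty_union, Finmap.union_empty]
    congr 1
    funext l
    exact ite_self l
  have eA : A.intro ((γ.union γ').union γ'') = ⟨S', h, (γ.union γ').union γ'', id⟩ := rfl
  rw [eP] at hap hB' habs
  rw [eA] at hap hB' habs
  have hS''wf : Store.Wf 1 S'' := hhT.wf_mono hr.2.2.1
  have hLk : S.keys ∪ ρ.mu ⊆ S''.keys := by rw [hr.2.2.2]; exact hr.1.2.1
  have hLχ : S.keys ∪ ρ.mu ⊆ χ.keys := by rw [hχ.1]; exact hr.1.2.1
  have hSS : MapSub S S'' := by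
    intro l T hl
    have := Finmap.mem_keys.1 (hLk (Finset.mem_union_left _
      (Finmap.mem_keys.2 (Finmap.mem_of_lookup_eq_some hl))))
    rw [hr.2.2.1.lookup_eq this]; exact hS l T hl
  have hGΨ : ∀ (u : ℕ) (b : Name), η[u]? = some b → ∃ N p, σ[u]? = some N ∧ Ψ[u]? = some p := by
    intro u b hb
    have hu : u < σ.length := hη.1 ▸ (List.getElem?_eq_some_iff.1 hb).1
    exact ⟨_, _, List.getElem?_eq_getElem hu, List.getElem?_eq_getElem (hlen ▸ hu)⟩
  have hcode : ∀ (u : ℕ) (b : Name), η[u]? = some b → ∃ N, σ[u]? = some N ∧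
      extend A.r (fun _ => .unit) ((γ.union γ').union γ'') b = .box N ∧
      b ∈ NMap.dom ((γ.union γ').union γ'') := by
    intro u b hb
    obtain ⟨N, p, hN, hp⟩ := hGΨ u b hb
    have hNm := List.mem_of_getElem? hN
    obtain ⟨e, ho⟩ := habs 1 (.box N) _ (.name b) (hη.abstr u N p b hN hp hb)
      (Finset.empty_subset _) (by rw [hPN]; exact hσo N hNm)
    refine ⟨N, hN, ?_, ho⟩
    have := Tm.NameFree.conc_id (M := .box N) (hσn N hNm)
      (extend A.r (fun _ => .unit) ((γ.union γ').union γ''))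
    exact e.trans this
  have hρval : ∀ x : {x // x ∈ ρ.dom}, ∃ T, (x.1, T) ∈ Γ ∧ Typed S'' i (ρ.val x) T ∧
      conc id (extend A.r (fun _ => .unit) ((γ.union γ').union γ'')) (ρ.val x) = δ.fn x.1 ∧
      Occ (NMap.dom ((γ.union γ').union γ'')) χ.locs (ρ.val x) := by
    intro x
    have hxδ : x.1 ∈ δ.dom := hρ.1 ▸ x.2
    obtain ⟨p, hp, hx⟩ := List.mem_map.1 ((hδ.1 x.1).1 hxδ)
    rw [← Prod.eta p, hx] at hp
    have hmu : (ρ.fn x.1).mu ⊆ S.keys ∪ ρ.mu := by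
      rw [LSub.fn_of_mem x.2]
      exact (ρ.mu_val_subset x).trans Finset.subset_union_right
    have ho : Occ ∅ A.h.locs (δ.fn x.1) := by rw [LSub.fn_of_mem hxδ]; exact hδo _
    have hn : (δ.fn x.1).NameFree := by rw [LSub.fn_of_mem hxδ]; exact hδn _
    obtain ⟨e, ho'⟩ := habs i _ _ _ (hρ.abstr_right hδ (fun n W hn => (hnη n W hn).1) hd₁ _ _ hp)
      (hmu.trans hLχ) (by rwa [hPN])
    obtain ⟨-, -, g, hg, -⟩ := hρ
    have ht := (hg _ _ hp).typed (hδ.2.2 _ _ hp) (hδ.2.2 _ _ hp).wf hr.2.2.1 hS''wf (hmu.trans hLk)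
    rw [LSub.fn_of_mem x.2] at e ho' ht
    exact ⟨_, hp, ht, e.trans (hn.conc_id _), ho'⟩
  have hMη : HasTy S'' [] Γ [] i (M.subG η.fn) T := by
    refine (hM.store hSS hS''wf).subG (Ψ' := []) (by simp [GCtx.Wf]) (fun u p hp => ?_)
    have hu : u < η.length := by
      rw [hη.1, hlen]; exact (List.getElem?_eq_some_iff.1 hp).1
    have hb := List.getElem?_eq_getElem hu
    obtain ⟨N, p', hN, hp'⟩ := hGΨ u _ hb
    rw [hp] at hp'; cases hp'
    obtain ⟨-, -, g, hg, -⟩ := hη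
    simp only [AGSub.fn, hb, Code.Typed]
    have := hg u N p _ hN hp hb
    generalize g u = g' at this
    cases this
    assumption
  have hρdom : ∀ x, x ∈ ρ.dom ↔ x ∈ Γ.map Prod.fst := fun x => by rw [hρ.1]; exact hδ.1 x
  have hρv : ∀ x, (ρ.val x).IsValue := by
    intro x
    obtain ⟨U, hU, -⟩ := hρval x
    obtain ⟨-, -, g, hg, -⟩ := hρ
    have := (hg _ _ hU).isAbs.isValue
    rwa [LSub.fn_of_mem x.2] at this
  have hMt : Typed S'' i ((M.subG η.fn).lsub ρ) T := by
    refine hMη.subL (CtxWf.nil hS''wf i) (by simp) (fun _ => trivial) (fun x U hx => ?_)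
      (LSub.fn_isValue hρv)
    obtain ⟨-, -, g, hg, -⟩ := hρ
    have hxρ : x ∈ ρ.dom := (hρdom x).2 (List.mem_map_of_mem hx)
    refine (hg _ _ hx).typed (hδ.2.2 _ _ hx) (hδ.2.2 _ _ hx).wf hr.2.2.1 hS''wf
      (subset_trans ?_ hLk)
    rw [LSub.fn_of_mem hxρ]; exact (ρ.mu_val_subset _).trans Finset.subset_union_right
  have hMo : Occ (NMap.dom ((γ.union γ').union γ'')) χ.locs ((M.subG η.fn).lsub ρ) := by
    have h₀ : Occ (NMap.dom ((γ.union γ').union γ'')) χ.locs M :=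
      (hMn.occ hM.occ).mono (Set.empty_subset _) fun l hl =>
        Finmap.mem_keys.1 (hLχ (Finset.mem_union_left _ (Finmap.mem_keys.2 hl)))
    refine (h₀.subG (fun u => ?_)).subL (fun _ => trivial) (Occ.fn fun x => ?_)
    · rcases hb : η[u]? with _ | b
      · simp only [AGSub.fn, hb]; trivial
      · obtain ⟨N, -, -, ho⟩ := hcode u b hb
        simp only [AGSub.fn, hb]; exact ho
    · obtain ⟨_, -, -, -, ho⟩ := hρval x; exact ho
  -- Concretization turns `η` and `ρ` back into `σ` and `δ`, and leaves the name-free `M` alone.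
  have hconc : conc id (extend A.r (fun _ => .unit) ((γ.union γ').union γ''))
      ((M.subG η.fn).lsub ρ) = (M.subG σ.fn).lsub δ := by
    rw [conc_lsub hgood hMη.someSc fun x => let ⟨_, _, h, _⟩ := hρval x; h.someSc,
      conc_subG hgood hM.sc (Ψ' := []) ?_, hMn.conc_id]
    · congr 1
      · congr 1
        funext u
        rcases hb : η[u]? with _ | b
        · have hN : σ[u]? = none := by
            rw [List.getElem?_eq_none_iff] at hb ⊢; rwa [← hη.1]
          simp only [AGSub.fn, GSub.fn, hb, hN, concCode]
        · obtain ⟨N, hN, hc, -⟩ := hcode u b hb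
          simp only [AGSub.fn, GSub.fn, hb, hN, concCode]
          exact codeOf_of_box hc
      · refine LSub.ext_fn hρ.1 fun x hx => ?_
        have hx : x ∈ ρ.dom := hx
        rw [LSub.fn_mk_of_mem _ hx]
        obtain ⟨_, -, -, e, -⟩ := hρval ⟨x, hx⟩
        exact e
    · intro u d hd
      rw [List.getElem?_map] at hd
      rcases hp : Ψ[u]? with _ | p
      · rw [hp] at hd; cases hd
      · rw [hp] at hd; cases hd
        have hu : u < η.length := by
          rw [hη.1, hlen]; exact (List.getElem?_eq_some_iff.1 hp).1
        have hb := List.getElem?_eq_getElem hu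
        obtain ⟨N, p', hN, hp'⟩ := hGΨ u _ hb
        rw [hp] at hp'; cases hp'
        obtain ⟨-, -, g, hg, -⟩ := hη
        have := hg u N p _ hN hp hb
        generalize g u = g' at this
        simp only [AGSub.fn, hb]
        cases this with
        | bx _ _ hb => exact hb.dom_box.symm
  have hKo : K.Occ ∅ A.h.locs := (hK.occ hKn).mono subset_rfl hlocs
  refine ⟨⟨_, _, hB', hMt.one, hMo, .cons (F := ⟨S', K, T, i, T', i'⟩) hK.one
    (hKo.mono (Set.empty_subset _) subset_rfl) .nil, ?_⟩, hap,
    .cons (F := ⟨S', K, T, i, T', i'⟩) hM.wf (.nil (hK.wf hM.wf))⟩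
  rw [hconc, ECtx.plug_comp]
  change _ = (concE id hgood K).plug _
  rw [concE_id hgood hKn]

end LMML

theorem mainTheorem3
    (S S' S'' : Store) (Ψ : GCtx) (Γ : LCtx) (i i' : Layer) (T T' : Ty)
    (M : Tm) (K : ECtx) (σ : GSub) (δ : LSub) (h h' : Heap)
    (η : AGSub) (γ : NMap) (ρ : LSub) (γ' : NMap) (χ : Heap) (γ'' : NMap)
    -- the term, evaluation context, closing substitutions and heap, all of the source language
    (hM : HasTy S Ψ Γ [] i M T) (hMn : M.NameFree)
    (hK : ECtxTyped S' i T K i' T') (hKn : K.NameFree)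
    (hσ : GSubTyped S' σ Ψ) (hσn : ∀ N ∈ σ, N.NameFree)
    (hδ : LSubTyped S' i δ Γ) (hδn : ∀ x, (δ.val x).NameFree)
    (hh : HeapTyped S' h) (hhn : ∀ l V, h.lookup l = some V → V.NameFree)
    (hS : MapSub S S')
    -- the chosen abstractions
    (hη : AbsGSub σ Ψ η γ) (hρ : AbsLSub i δ Γ ρ γ')
    (hr : IsRestr S' h (S.keys ∪ ρ.mu) S'' h') (hχ : AbsHeap S' h' χ γ'')
    -- the unions of names in the two configurations are disjoint
    (hd₁ : Disjoint η.nu ρ.nu) (hd₂ : Disjoint η.nu χ.nu) (hd₃ : Disjoint ρ.nu χ.nu) :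
    Converges (K.plug ((M.subG σ.fn).lsub δ)) h ↔
      ∃ t : List Action,
        SharesTrace (ctxConf S' K T i T' i' h η γ ρ γ' χ γ'') (progConf M i T S'' η ρ χ) t := by
  have hR := ready_initial hM hMn hK hKn hσ hσn hδ hδn hh hhn hS hη hρ hr hχ hd₁ hd₂ hd₃
  constructor
  · intro hc
    obtain ⟨n, hn⟩ := hc.convergesIn
    exact meetsAt n hR hn
  · rintro ⟨t, ht⟩
    exact hR.linked.converges _ rfl ht
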